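/- Let $M$ be a connected smooth 6-manifold (Hausdorff, second countable) with a nearly Kähler structure $(g,J,\omega,\psi)$: a smooth $\mathrm{SU}(3)$-structure, i.e. at each point there is a linear isomorphism of the tangent space with $\mathbb{C}^3$ taking $g$, $J$, $\omega=g(J\cdot,\cdot)$, $\psi$ to the Euclidean metric, multiplication by $i$, $\frac i2\sum_j dz_j\wedge d\bar z_j$ and $dz_1\wedge dz_2\wedge dz_3$, such that $d\omega=3\,\mathrm{Re}\,\psi$ and $d\,\mathrm{Im}\,\psi=-2\,\omega\wedge\omega$. A special Lagrangian is an embedded 3-dimensional submanifold on which $\omega$ and $\mathrm{Re}\,\psi$ vanish. Let $\mathrm{SU}(2)$ act smoothly on $M$ by nearly Kähler automorphisms (diffeomorphisms preserving $g$, $J$, $\omega$, $\psi$), with three-dimensional principal orbits. (The action is then almost effective; it need not be effective.) Let $\xi_1,\xi_2,\xi_3$ be any basis of $\mathfrak{su}(2)$ with $[\xi_i,\xi_j]=-\epsilon_{ijk}\xi_k$, let $K_i(x)=\frac{d}{dt}\big|_{t=0}\exp(t\xi_i)x$ be the fundamental vector fields, and put $$\mu=\big(\omega(K_2,K_3),\,\omega(K_3,K_1),\,\omega(K_1,K_2)\big)\colon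 M\to\mathbb{R}^3,\qquad \nu=\mathrm{Im}\,\psi(K_1,K_2,K_3)\colon M\to\mathbb{R}.$$ Then: 1. For every $x\in M$, the orbit of $x$ is special Lagrangian if and only if $\nu(x)\neq0$ and $\mu(x)=0$. 2. The set $\nu^{-1}(0)\cap\mu^{-1}(0)$ is a union of orbits, each of which is a fixed point, or an embedded two-sphere on which $\omega$ vanishes, or an embedded real projective plane on which $\omega$ vanishes. The last case does not occur if the action is effective. 3. If the de Rham cohomology of $M$ is finite-dimensional (for instance if $M$ is compact) and the Euler characteristic of $M$ is non-zero, then $\nu$ has a zero. 4. The function $\nu$ is smooth and not identically zero; if $\nu$ is constant, then every orbit is special Lagrangian. 5. The set of points at which $d\nu=0$ and $\nu\neq0$ is exactly the union of the special Lagrangian orbits. 6. If $M$ is compact, then the action has a special Lagrangian orbit. -/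

import Mathlib

open scoped Manifold ContDiff Topology

noncomputable section

/-! ### Differential forms on a smooth 6-manifold -/

/-- The model space `ℝ⁶`. -/
abbrev E6 : Type := EuclideanSpace ℝ (Fin 6)

/-- (Not necessarily continuous) `F`-valued differential `k`-forms on `M`. -/
abbrev DForm (M : Type*) [TopologicalSpace M] [ChartedSpace E6 M]
    (F : Type*) [NormedAddCommGroup F] [NormedSpace ℝ F] (k : ℕ) : Type _ :=
  ∀ x : M, TangentSpace (𝓡 6) x [⋀^Fin k]→L[ℝ] F

namespace DForm

variable {M : Type*} [TopologicalSpace M] [ChartedSpace E6 M]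
  {F : Type*} [NormedAddCommGroup F] [NormedSpace ℝ F] {k : ℕ}

/-- The local expression of `α` in the preferred chart at `x₀`: the pullback of `α` under the
inverse of the chart. It is meaningful on the (open) target of the chart. -/
def inChart (α : DForm M F k) (x₀ : M) (y : E6) : E6 [⋀^Fin k]→L[ℝ] F :=
  (α ((chartAt E6 x₀).symm y)).compContinuousLinearMap
    (mfderiv (𝓡 6) (𝓡 6) (chartAt E6 x₀).symm y)

/-- A form is smooth if its local expressions are. -/
def IsSmooth (α : DForm M F k) : Prop :=
  ∀ x₀ : M, ContDiffOn ℝ ∞ (α.inChart x₀) (chartAt E6 x₀).target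

/-- The exterior derivative, computed at `x` in the preferred chart at `x`. -/
def d (α : DForm M F k) : DForm M F (k + 1) := fun x =>
  (extDeriv (α.inChart x) (chartAt E6 x x)).compContinuousLinearMap
    (mfderiv (𝓡 6) (𝓡 6) (chartAt E6 x) x)

theorem inChart_add (α β : DForm M F k) (x₀ : M) :
    inChart (α + β) x₀ = inChart α x₀ + inChart β x₀ := rfl

theorem inChart_smul (c : ℝ) (α : DForm M F k) (x₀ : M) :
    inChart (c • α) x₀ = c • inChart α x₀ := rfl

theorem IsSmooth.add {α β : DForm M F k} (hα : α.IsSmooth) (hβ : β.IsSmooth) :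
    IsSmooth (α + β) := fun x₀ => by
  rw [inChart_add]; exact (hα x₀).add (hβ x₀)

theorem IsSmooth.smul (c : ℝ) {α : DForm M F k} (hα : α.IsSmooth) :
    IsSmooth (c • α) := fun x₀ => by
  rw [inChart_smul]; exact contDiffOn_const.smul (hα x₀)

theorem isSmooth_zero : IsSmooth (0 : DForm M F k) := fun _ => contDiffOn_const (c := 0)

theorem IsSmooth.differentiableAt {α : DForm M F k} (hα : α.IsSmooth) (x : M) :
    DifferentiableAt ℝ (α.inChart x) (chartAt E6 x x) :=
  ((hα x).contDiffAt ((chartAt E6 x).open_target.mem_nhds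
    (mem_chart_target E6 x))).differentiableAt (by simp)

theorem d_add {α β : DForm M F k} (hα : α.IsSmooth) (hβ : β.IsSmooth) :
    d (α + β) = d α + d β := by
  funext x
  have h : extDeriv (inChart (α + β) x) (chartAt E6 x x) =
      extDeriv (inChart α x) (chartAt E6 x x) + extDeriv (inChart β x) (chartAt E6 x x) := by
    rw [inChart_add]
    exact extDeriv_add (hα.differentiableAt x) (hβ.differentiableAt x)
  change (extDeriv (inChart (α + β) x) (chartAt E6 x x)).compContinuousLinearMap _ = _
  rw [h]; rfl

theorem d_smul (c : ℝ) (α : DForm M F k) : d (c • α) = c • d α := by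
  funext x
  have h : extDeriv (inChart (c • α) x) (chartAt E6 x x) =
      c • extDeriv (inChart α x) (chartAt E6 x x) := by
    rw [inChart_smul]
    exact extDeriv_smul c _
  change (extDeriv (inChart (c • α) x) (chartAt E6 x x)).compContinuousLinearMap _ = _
  rw [h]; rfl

theorem d_zero : d (0 : DForm M F k) = 0 := by
  simpa using d_smul 0 (0 : DForm M F k)

end DForm

/-! ### De Rham cohomology and the Euler characteristic -/

section DeRham

variable (M : Type*) [TopologicalSpace M] [ChartedSpace E6 M]

/-- The space `Z^k(M)` of closed smooth `k`-forms. -/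
def closedForms (k : ℕ) : Submodule ℝ (DForm M ℝ k) where
  carrier := {α | α.IsSmooth ∧ α.d = 0}
  add_mem' := fun h₁ h₂ => ⟨h₁.1.add h₂.1, by rw [DForm.d_add h₁.1 h₂.1, h₁.2, h₂.2, add_zero]⟩
  zero_mem' := ⟨DForm.isSmooth_zero, DForm.d_zero⟩
  smul_mem' := fun c _ h => ⟨h.1.smul c, by rw [DForm.d_smul, h.2, smul_zero]⟩

/-- The space `B^k(M)` of exact `k`-forms `dβ`, `β` smooth. -/
def exactForms : ∀ k : ℕ, Submodule ℝ (DForm M ℝ k)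
  | 0 => ⊥
  | k + 1 =>
    { carrier := {α | ∃ β : DForm M ℝ k, β.IsSmooth ∧ β.d = α}
      add_mem' := by
        rintro _ _ ⟨β, h, rfl⟩ ⟨γ, h', rfl⟩
        exact ⟨β + γ, h.add h', DForm.d_add h h'⟩
      zero_mem' := ⟨0, DForm.isSmooth_zero, DForm.d_zero⟩
      smul_mem' := by
        rintro c _ ⟨β, h, rfl⟩
        exact ⟨c • β, h.smul c, DForm.d_smul c β⟩ }

/-- De Rham cohomology `H^k(M)`: closed forms modulo exact forms. -/
abbrev DeRham (k : ℕ) : Type _ :=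
  closedForms M k ⧸ (exactForms M k).submoduleOf (closedForms M k)

/-- The Euler characteristic, i.e. the alternating sum of the Betti numbers, of a 6-manifold
all of whose cohomology is finite-dimensional. -/
def eulerChar : ℤ :=
  ∑ k ∈ Finset.range 7, (-1 : ℤ) ^ k * (Module.finrank ℝ (DeRham M k) : ℤ)

end DeRham

/-! ### Nearly Kähler 6-manifolds and their special Lagrangian submanifolds -/

section NearlyKahler

variable {M : Type*} [TopologicalSpace M] [ChartedSpace E6 M]

/-- `(g, J, ψ)` is, at the point `x`, the standard structure of `ℂ³` in a suitable frame, with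
`g = Re ∑ dz̄ᵢ ⊗ dzᵢ`, `J = i` and `ψ = dz₁ ∧ dz₂ ∧ dz₃`. -/
def IsSU3At (x : M) (g : TangentSpace (𝓡 6) x →L[ℝ] TangentSpace (𝓡 6) x →L[ℝ] ℝ)
    (J : TangentSpace (𝓡 6) x →L[ℝ] TangentSpace (𝓡 6) x)
    (ψ : TangentSpace (𝓡 6) x [⋀^Fin 3]→L[ℝ] ℂ) : Prop :=
  ∃ e : TangentSpace (𝓡 6) x ≃ₗ[ℝ] (Fin 3 → ℂ),
    (∀ u v, g u v = (∑ i, (starRingEnd ℂ) (e u i) * e v i).re) ∧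
    (∀ u, e (J u) = Complex.I • e u) ∧
    (∀ v : Fin 3 → TangentSpace (𝓡 6) x, ψ v = Matrix.det (Matrix.of fun i j => e (v i) j))

/-- The value `(α ∧ α)(v₀, v₁, v₂, v₃)` for a 2-form `α`. -/
def wedgeSq {x : M} (α : TangentSpace (𝓡 6) x [⋀^Fin 2]→L[ℝ] ℝ)
    (v : Fin 4 → TangentSpace (𝓡 6) x) : ℝ :=
  2 * (α ![v 0, v 1] * α ![v 2, v 3] - α ![v 0, v 2] * α ![v 1, v 3]
    + α ![v 0, v 3] * α ![v 1, v 2])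

variable (M) in
/-- A nearly Kähler structure on a 6-manifold: a smooth `SU(3)`-structure `(g, J, ω, ψ)` with
`dω = 3 Re ψ` and `d Im ψ = -2 ω ∧ ω`. The almost complex structure `J` is automatically smooth,
since `ω = g(J·,·)` and `g` are. -/
structure NearlyKahler [IsManifold (𝓡 6) ∞ M] where
  g : Bundle.ContMDiffRiemannianMetric (𝓡 6) ∞ E6 (fun x : M => TangentSpace (𝓡 6) x)
  J : ∀ x : M, TangentSpace (𝓡 6) x →L[ℝ] TangentSpace (𝓡 6) x
  omega : DForm M ℝ 2
  psi : DForm M ℂ 3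
  smooth_omega : omega.IsSmooth
  smooth_psi : psi.IsSmooth
  su3 : ∀ x, IsSU3At x (g.inner x) (J x) (psi x)
  omega_eq : ∀ x u v, omega x ![u, v] = g.inner x (J x u) v
  d_omega : ∀ x v, omega.d x v = 3 * (psi x v).re
  d_im_psi : ∀ x v, DForm.d (fun y => Complex.imCLM.compContinuousAlternatingMap (psi y)) x v
    = -2 * wedgeSq (omega x) v

/-- The chart `φ` of `M` flattens the subset `L` near `p` to the affine subspace `φ p + W`. -/
def IsSliceChart [IsManifold (𝓡 6) ∞ M] (L : Set M) (p : M)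
    (φ : OpenPartialHomeomorph M E6) (W : Submodule ℝ E6) : Prop :=
  φ ∈ IsManifold.maximalAtlas (𝓡 6) ∞ M ∧ p ∈ φ.source ∧
    ∀ y ∈ φ.source, y ∈ L ↔ φ y - φ p ∈ W

/-- The tangent space at `p` of a submanifold flattened by `φ` to `φ p + W`. -/
def sliceTangent (p : M) (φ : OpenPartialHomeomorph M E6) (W : Submodule ℝ E6) :
    Set (TangentSpace (𝓡 6) p) :=
  {u | (mfderiv (𝓡 6) (𝓡 6) φ p u : E6) ∈ W}

/-- `L` is a special Lagrangian submanifold: an embedded 3-dimensional submanifold on which `ω`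
and `Re ψ` vanish. -/
def NearlyKahler.IsSpecialLagrangian [IsManifold (𝓡 6) ∞ M] (S : NearlyKahler M)
    (L : Set M) : Prop :=
  ∀ p ∈ L, ∃ φ W, IsSliceChart L p φ W ∧ Module.finrank ℝ W = 3 ∧
    (∀ u ∈ sliceTangent p φ W, ∀ v ∈ sliceTangent p φ W, S.omega p ![u, v] = 0) ∧
    (∀ u ∈ sliceTangent p φ W, ∀ v ∈ sliceTangent p φ W, ∀ w ∈ sliceTangent p φ W,
      (S.psi p ![u, v, w]).re = 0)

end NearlyKahler

/-! ### The group `SU(2)` and its actions -/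

/-- The group `SU(2)`. -/
abbrev SU2 : Type := Matrix.specialUnitaryGroup (Fin 2) ℂ

/-- The Lie algebra `𝔰𝔲(2)` of trace-free skew-Hermitian matrices. -/
def su2 : Submodule ℝ (Matrix (Fin 2) (Fin 2) ℂ) where
  carrier := {A | A.conjTranspose = -A ∧ A.trace = 0}
  add_mem' := by
    rintro A B ⟨h1, h2⟩ ⟨h3, h4⟩
    exact ⟨by rw [Matrix.conjTranspose_add, h1, h3]; abel, by rw [Matrix.trace_add, h2, h4]; simp⟩
  zero_mem' := by simp
  smul_mem' := by
    rintro c A ⟨h1, h2⟩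
    exact ⟨by simp [Matrix.conjTranspose_smul, h1], by simp [Matrix.trace_smul, h2]⟩

/-- For a `2 × 2` matrix, `J Bᵀ J⁻¹` is the adjugate. -/
theorem adjugate_two_eq (B : Matrix (Fin 2) (Fin 2) ℂ) :
    B.adjugate = !![0, 1; -1, 0] * B.transpose * !![0, -1; 1, 0] := by
  rw [Matrix.adjugate_fin_two]
  ext i j
  fin_cases i <;> fin_cases j <;> simp [Matrix.mul_apply, Fin.sum_univ_two, Matrix.vecMul, dotProduct]

theorem exp_mem_SU2 {A : Matrix (Fin 2) (Fin 2) ℂ} (hA : A ∈ su2) :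
    NormedSpace.exp A ∈ Matrix.specialUnitaryGroup (Fin 2) ℂ := by
  obtain ⟨h1, h2⟩ := hA
  have hneg : NormedSpace.exp (-A) * NormedSpace.exp A = 1 := by
    rw [← Matrix.exp_add_of_commute _ _ (Commute.neg_left (Commute.refl A))]
    simp
  have hneg' : NormedSpace.exp A * NormedSpace.exp (-A) = 1 := by
    rw [← Matrix.exp_add_of_commute _ _ (Commute.neg_right (Commute.refl A))]
    simp
  rw [Matrix.mem_specialUnitaryGroup_iff]
  refine ⟨?_, ?_⟩
  · rw [Matrix.mem_unitaryGroup_iff', Matrix.star_eq_conjTranspose, ← Matrix.exp_conjTranspose,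
      h1, hneg]
  · have hadj : A.adjugate = -A := by
      rw [Matrix.adjugate_fin_two]
      have h3 : A 0 0 + A 1 1 = 0 := by simpa [Matrix.trace_fin_two] using h2
      have h4 : A 1 1 = -A 0 0 := by linear_combination h3
      have h5 : A 0 0 = -A 1 1 := by linear_combination h3
      ext i j
      fin_cases i <;> fin_cases j <;> simp [h4]
    let U : (Matrix (Fin 2) (Fin 2) ℂ)ˣ :=
      ⟨!![0, 1; -1, 0], !![0, -1; 1, 0], by simp [Matrix.one_fin_two], by
        simp [Matrix.one_fin_two]⟩
    have hexp : (NormedSpace.exp A).adjugate = NormedSpace.exp (-A) := by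
      rw [← hadj, adjugate_two_eq A, adjugate_two_eq (NormedSpace.exp A), ← Matrix.exp_transpose]
      exact (Matrix.exp_units_conj U _).symm
    have h6 := Matrix.mul_adjugate (NormedSpace.exp A)
    rw [hexp, hneg'] at h6
    have h7 := congrFun (congrFun h6 0) 0
    simpa using h7.symm

/-- The exponential map of `SU(2)`. -/
def expSU2 (ξ : su2) : SU2 := ⟨NormedSpace.exp (ξ : Matrix (Fin 2) (Fin 2) ℂ), exp_mem_SU2 ξ.2⟩

/-- A basis of `𝔰𝔲(2)` with `[ξᵢ, ξⱼ] = -εᵢⱼₖ ξₖ`. -/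
def IsStandardBasis (ξ : Module.Basis (Fin 3) ℝ su2) : Prop :=
  ∀ i : Fin 3, (⁅(ξ i : Matrix (Fin 2) (Fin 2) ℂ), (ξ (i + 1) : Matrix (Fin 2) (Fin 2) ℂ)⁆)
    = -(ξ (i + 2) : Matrix (Fin 2) (Fin 2) ℂ)

/-- The unit sphere `Sⁿ` in `ℝⁿ⁺¹`. -/
abbrev USphere (n : ℕ) : Type := Metric.sphere (0 : EuclideanSpace ℝ (Fin (n + 1))) 1

/-- The standard identification `S³ ≅ SU(2)`, `(a, b) ↦ (a, -b̄; b, ā)` for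
`(a, b) = (q₀ + i q₁, q₂ + i q₃)`. It defines the smooth structure of `SU(2)`. -/
def sphereToSU2 (q : USphere 3) : SU2 :=
  ⟨!![⟨q.1 0, q.1 1⟩, -⟨q.1 2, -q.1 3⟩; ⟨q.1 2, q.1 3⟩, ⟨q.1 0, -q.1 1⟩], by
    have hq : q.1 0 ^ 2 + q.1 1 ^ 2 + q.1 2 ^ 2 + q.1 3 ^ 2 = 1 := by
      have h : (q.1 : EuclideanSpace ℝ (Fin 4)) ∈ Metric.sphere 0 1 := q.2
      have h' : ‖q.1‖ = 1 := mem_sphere_zero_iff_norm.mp h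
      have h2 := EuclideanSpace.real_norm_sq_eq q.1
      rw [h', Fin.sum_univ_four] at h2
      linarith
    rw [Matrix.mem_specialUnitaryGroup_iff, Matrix.mem_unitaryGroup_iff]
    refine ⟨?_, ?_⟩
    · ext i j
      fin_cases i <;> fin_cases j <;>
        simp [Matrix.mul_apply, Fin.sum_univ_two, Matrix.star_eq_conjTranspose, Complex.ext_iff] <;>
        constructor <;> nlinarith [hq]
    · simp [Matrix.det_fin_two, Complex.ext_iff]
      constructor <;> nlinarith [hq]⟩

section Action

variable {M : Type*} [TopologicalSpace M] [ChartedSpace E6 M] [MulAction SU2 M]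

/-- The fundamental vector field `K^ξ`, `K^ξ_x = d/dt|₀ exp(tξ)·x`. -/
def fundamentalField (ξ : su2) (x : M) : TangentSpace (𝓡 6) x :=
  (mfderiv 𝓘(ℝ, ℝ) (𝓡 6) (fun t : ℝ => expSU2 (t • ξ) • x) 0 (1 : ℝ) : E6)

variable (M) in
/-- The action of `SU(2)` on `M` is smooth. -/
def IsSmoothAction : Prop :=
  ContMDiff ((𝓡 3).prod (𝓡 6)) (𝓡 6) ∞ (fun p : USphere 3 × M => sphereToSU2 p.1 • p.2)

/-- `SU(2)` acts smoothly, by automorphisms of the nearly Kähler structure. -/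
structure NearlyKahler.IsAutomorphicAction [IsManifold (𝓡 6) ∞ M] (S : NearlyKahler M) :
    Prop where
  smooth : IsSmoothAction M
  map_g : ∀ (a : SU2) (x : M) (u v : TangentSpace (𝓡 6) x),
    S.g.inner (a • x) (mfderiv (𝓡 6) (𝓡 6) (fun y : M => a • y) x u)
      (mfderiv (𝓡 6) (𝓡 6) (fun y : M => a • y) x v) = S.g.inner x u v
  map_J : ∀ (a : SU2) (x : M) (u : TangentSpace (𝓡 6) x),
    S.J (a • x) (mfderiv (𝓡 6) (𝓡 6) (fun y : M => a • y) x u)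
      = mfderiv (𝓡 6) (𝓡 6) (fun y : M => a • y) x (S.J x u)
  map_psi : ∀ (a : SU2) (x : M) (v : Fin 3 → TangentSpace (𝓡 6) x),
    S.psi (a • x) (fun i => mfderiv (𝓡 6) (𝓡 6) (fun y : M => a • y) x (v i)) = S.psi x v

/-- The dimension of the orbit of `x`, i.e. of its tangent space `{K^ξ_x | ξ ∈ 𝔰𝔲(2)}`. -/
def orbitDim (x : M) : ℕ :=
  Module.finrank ℝ (Submodule.span ℝ (Set.range fun ξ : su2 => fundamentalField ξ x))

/-- The orbit of `x` is principal: up to conjugation, the stabiliser of `x` is contained in every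
other stabiliser. -/
def IsPrincipalOrbit (x : M) : Prop :=
  ∀ y : M, ∃ a : SU2, MulAction.stabilizer SU2 (a • x) ≤ MulAction.stabilizer SU2 y

variable (M) in
/-- The principal orbits, all of which are of the same type, are three-dimensional. -/
def HasThreeDimPrincipalOrbits : Prop :=
  ∃ x : M, IsPrincipalOrbit x ∧ orbitDim x = 3

variable [IsManifold (𝓡 6) ∞ M]

/-- The map `μ = (ω(K₂, K₃), ω(K₃, K₁), ω(K₁, K₂)) : M → ℝ³`, where `Kᵢ = K^{ξᵢ}`. -/
def NearlyKahler.mu (S : NearlyKahler M) (ξ : Module.Basis (Fin 3) ℝ su2) (x : M) : Fin 3 → ℝ :=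
  fun i => S.omega x ![fundamentalField (ξ (i + 1)) x, fundamentalField (ξ (i + 2)) x]

/-- The function `ν = Im ψ(K₁, K₂, K₃)`, where `Kᵢ = K^{ξᵢ}`. -/
def NearlyKahler.nu (S : NearlyKahler M) (ξ : Module.Basis (Fin 3) ℝ su2) (x : M) : ℝ :=
  (S.psi x ![fundamentalField (ξ 0) x, fundamentalField (ξ 1) x, fundamentalField (ξ 2) x]).im

/-- The orbit of `x` is the image of a smooth immersion `f` of the two-sphere on which `ω`
vanishes, and either `f` is injective, so that the orbit is an embedded two-sphere, or the action
is not effective and `f` identifies exactly the antipodal points, so that the orbit is an embedded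
real projective plane. -/
def NearlyKahler.IsIsotropicSphereOrbit (S : NearlyKahler M) (x : M) : Prop :=
  ∃ f : USphere 2 → M, ContMDiff (𝓡 2) (𝓡 6) ∞ f ∧
    Set.range f = MulAction.orbit SU2 x ∧
    (∀ p, Function.Injective (mfderiv (𝓡 2) (𝓡 6) f p)) ∧
    (∀ p (u v : TangentSpace (𝓡 2) p),
      S.omega (f p) ![mfderiv (𝓡 2) (𝓡 6) f p u, mfderiv (𝓡 2) (𝓡 6) f p v] = 0) ∧
    (Function.Injective f ∨
      (¬ FaithfulSMul SU2 M ∧ ∀ p q : USphere 2, f p = f q ↔ (q = p ∨ q = -p)))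

end Action

end

/-! The whole argument rests on one formula. Write K₀, K₁, K₂ for the fundamental fields of the
basis. Since ω and ψ are invariant, Cartan's formula and the bracket relations determine the
derivatives of their contractions. For ω the relation dω = 3 Re ψ gives Re ψ(K₀,K₁,K₂) = 0
(`re_psi_fundVec`), so ν vanishes exactly where ψ(K₀,K₁,K₂) does. For Im ψ the relation d Im ψ = -2
ω∧ω gives dν = 4 ∑ μᵢ ω(Kᵢ,·) (`mfderiv_nu`).

Linear algebra in ℂ³ supplies the rest: ω is nondegenerate, and real independent ω-isotropic vectors
are independent over ℂ, so ψ is nonzero on an isotropic triple (`psi_ne_zero_of_isotropic`). Where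
the Kᵢ are independent, dν = 0 is therefore equivalent to μ = 0, and μ = 0 forces ν ≠ 0. This
identifies the critical points with ν ≠ 0. It also shows that ν is not identically zero, because at
a point with a three-dimensional orbit dν = 0 would give μ = 0 and hence ν ≠ 0. On a compact
manifold a nonzero maximum or minimum of ν is the required critical point.

To pass from tangent vectors to orbits, `exists_sliceChart_orbit` flattens an orbit by the inverse
function theorem when the infinitesimal action is injective. Conversely, an orbit that is an
embedded 3-manifold has injective infinitesimal action (`infAct_injective_of_sliceChart`): otherwise
the orbit map, read in the slice, would be singular everywhere, so its image would be a null set by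
Sard's theorem, and yet it contains a neighbourhood.

If ν and μ both vanish at x, the Kᵢ are dependent there. Either all vanish and x is fixed, or a
conjugate of the diagonal torus T is the identity component of the stabiliser; the stabiliser of a
suitable point of the orbit lies between T and its normaliser, and the Hopf map parametrises the
orbit by S², injectively or two-to-one. The central element -1 then fixes that point and is trivial
on the tangent plane of the orbit. Preserving J and ψ, it is trivial on the whole tangent space,
hence on the connected manifold M (`not_faithfulSMul_of_isotropic`).

For the Euler characteristic, suppose that ν has no zero. Then θ = Im ψ(K₀,K₁,·) satisfies θ(K₂) = ν
≠ 0, and a multiple of K₂ generates a circle action. Forms invariant under the circle compute de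
Rham cohomology by averaging. On them contraction anticommutes with d and is exact, with averaged
lifts θ∧β/ν. The resulting Gysin sequence makes the alternating sum of Betti numbers vanish
(`eulerChar_eq_zero_of_contraction`). -/

open scoped Manifold ContDiff Topology

noncomputable section

/-! ### Smoothness of pulling back alternating maps. -/

section AlternatingSmooth

variable {E G H : Type*} [NormedAddCommGroup E] [NormedSpace ℝ E] [NormedAddCommGroup G]
  [NormedSpace ℝ G] [NormedAddCommGroup H] [NormedSpace ℝ H] {k : ℕ}

theorem norm_alternatization_le (f : ContinuousMultilinearMap ℝ (fun _ : Fin k => E) G) :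
    ‖ContinuousMultilinearMap.alternatization f‖ ≤ (Fintype.card (Equiv.Perm (Fin k)) : ℝ) * ‖f‖ := by
  rw [← ContinuousAlternatingMap.norm_toContinuousMultilinearMap]
  refine ContinuousMultilinearMap.opNorm_le_bound (by positivity) fun m => ?_
  have : (ContinuousMultilinearMap.alternatization f).toContinuousMultilinearMap m
      = ∑ σ : Equiv.Perm (Fin k), Equiv.Perm.sign σ • f (m ∘ σ) := by
    exact ContinuousMultilinearMap.alternatization_apply_apply f m
  rw [this]
  refine (norm_sum_le _ _).trans ?_
  have h : ∀ σ ∈ (Finset.univ : Finset (Equiv.Perm (Fin k))),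
      ‖Equiv.Perm.sign σ • f (m ∘ σ)‖ ≤ ‖f‖ * ∏ i, ‖m i‖ := fun σ _ => by
    have h1 : ‖Equiv.Perm.sign σ • f (m ∘ σ)‖ = ‖f (m ∘ σ)‖ := by
      rcases Int.units_eq_one_or (Equiv.Perm.sign σ) with h | h <;> simp [h]
    rw [h1]
    refine (f.le_opNorm _).trans (le_of_eq ?_)
    congr 1
    exact Equiv.prod_comp σ fun i => ‖m i‖
  refine (Finset.sum_le_sum h).trans (le_of_eq ?_)
  simp [mul_assoc]

/-- Pulling back an alternating map along a linear map depends smoothly on both. -/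
theorem contDiff_compContinuousLinearMap {n : WithTop ℕ∞} :
    ContDiff ℝ n (fun p : (G [⋀^Fin k]→L[ℝ] H) × (E →L[ℝ] G) =>
      p.1.compContinuousLinearMap p.2) := by
  let A : ContinuousMultilinearMap ℝ (fun _ : Fin k => E) H →L[ℝ] E [⋀^Fin k]→L[ℝ] H :=
    LinearMap.mkContinuous
      { toFun := fun f => ContinuousMultilinearMap.alternatization f
        map_add' := fun f g => map_add _ f g
        map_smul' := fun c f => by
          ext v
          simp [ContinuousMultilinearMap.alternatization_apply_apply, Finset.smul_sum,
            smul_comm c] }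
      (Fintype.card (Equiv.Perm (Fin k)) : ℝ) norm_alternatization_le
  -- A pullback of an alternating map is already alternating, so alternatising it only multiplies by
  -- k!. Dividing by k! factors the operation through the pullback of multilinear maps, which is
  -- itself continuous multilinear in the linear maps.
  have hA : ∀ p : (G [⋀^Fin k]→L[ℝ] H) × (E →L[ℝ] G), p.1.compContinuousLinearMap p.2 =
      ((Fintype.card (Equiv.Perm (Fin k)) : ℝ)⁻¹) •
        A (p.1.toContinuousMultilinearMap.compContinuousLinearMap fun _ => p.2) := by
    intro p
    ext v
    have hc : ((Fintype.card (Equiv.Perm (Fin k)) : ℝ)) ≠ 0 := by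
      exact_mod_cast Fintype.card_ne_zero
    have : A (p.1.toContinuousMultilinearMap.compContinuousLinearMap fun _ => p.2) v =
        ∑ σ : Equiv.Perm (Fin k), Equiv.Perm.sign σ • p.1 (fun i => p.2 (v (σ i))) :=
      ContinuousMultilinearMap.alternatization_apply_apply _ _
    have h2 : ∀ σ : Equiv.Perm (Fin k), Equiv.Perm.sign σ • p.1 (fun i => p.2 (v (σ i)))
        = p.1 (fun i => p.2 (v i)) := fun σ => by
      have := p.1.toAlternatingMap.map_perm (fun i => p.2 (v i)) σ
      have h3 : p.1 (fun i => p.2 (v (σ i))) = Equiv.Perm.sign σ • p.1 (fun i => p.2 (v i)) := this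
      rw [h3, smul_smul, Int.units_mul_self, one_smul]
    rw [ContinuousAlternatingMap.smul_apply, this, Finset.sum_congr rfl fun σ _ => h2 σ,
      Finset.sum_const, Finset.card_univ, ← Nat.cast_smul_eq_nsmul ℝ, smul_smul,
      inv_mul_cancel₀ hc, one_smul]
    rfl
  rw [funext hA]
  have h1 : ContDiff ℝ n (fun p : (G [⋀^Fin k]→L[ℝ] H) × (E →L[ℝ] G) =>
      ContinuousMultilinearMap.compContinuousLinearMapContinuousMultilinear ℝ
        (fun _ : Fin k => E) (fun _ : Fin k => G) H (fun _ => p.2)) :=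
    (ContinuousMultilinearMap.compContinuousLinearMapContinuousMultilinear ℝ
      (fun _ : Fin k => E) (fun _ : Fin k => G) H).contDiff.comp
      (contDiff_pi.2 fun _ => contDiff_snd)
  have h2 : ContDiff ℝ n (fun p : (G [⋀^Fin k]→L[ℝ] H) × (E →L[ℝ] G) =>
      p.1.toContinuousMultilinearMap) :=
    (ContinuousAlternatingMap.toContinuousMultilinearMapCLM ℝ (𝕜 := ℝ) (ι := Fin k) (E := G)
      (F := H)).contDiff.comp contDiff_fst
  have h3 : ContDiff ℝ n (fun p : (G [⋀^Fin k]→L[ℝ] H) × (E →L[ℝ] G) =>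
      A (p.1.toContinuousMultilinearMap.compContinuousLinearMap fun _ => p.2)) :=
    ContDiff.comp (g := A) A.contDiff (h1.clm_apply h2)
  exact h3.const_smul _

theorem ContDiffAt.compAlternating {P : Type*} [NormedAddCommGroup P] [NormedSpace ℝ P]
    {n : WithTop ℕ∞} {f : P → G [⋀^Fin k]→L[ℝ] H} {g : P → E →L[ℝ] G} {p : P}
    (hf : ContDiffAt ℝ n f p) (hg : ContDiffAt ℝ n g p) :
    ContDiffAt ℝ n (fun p => (f p).compContinuousLinearMap (g p)) p :=
  contDiff_compContinuousLinearMap.contDiffAt.comp p (hf.prodMk hg)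

end AlternatingSmooth

/-! ### Pullback of forms and naturality of the exterior derivative. -/

namespace DForm

variable {M : Type*} [TopologicalSpace M] [ChartedSpace E6 M]
  {F : Type*} [NormedAddCommGroup F] [NormedSpace ℝ F] {k : ℕ}
  {P : Type*} [NormedAddCommGroup P] [NormedSpace ℝ P]

/-- The pullback of a form under a map from a normed space. -/
def pb (f : P → M) (α : DForm M F k) (y : P) : P [⋀^Fin k]→L[ℝ] F :=
  (α (f y)).compContinuousLinearMap (mfderiv 𝓘(ℝ, P) (𝓡 6) f y)

theorem IsSmooth.contDiffAt_inChart {α : DForm M F k} (hα : α.IsSmooth) {x₁ : M} {y : E6}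
    (hy : y ∈ (chartAt E6 x₁).target) : ContDiffAt ℝ ∞ (α.inChart x₁) y :=
  (hα x₁).contDiffAt ((chartAt E6 x₁).open_target.mem_nhds hy)

theorem eventually_mem_source {X : Type*} [TopologicalSpace X] {f : X → M} {y : X}
    (hf : ContinuousAt f y) {x₁ : M} (hy : f y ∈ (chartAt E6 x₁).source) :
    ∀ᶠ z in 𝓝 y, f z ∈ (chartAt E6 x₁).source :=
  hf ((chartAt E6 x₁).open_source.mem_nhds hy)

variable [IsManifold (𝓡 6) ∞ M]

/-- The differentials of a chart and of its inverse cancel. This turns questions about pullbacks of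
forms on `M` into questions about pullbacks between normed spaces. -/
theorem pb_eq_inChart (α : DForm M F k) {f : P → M} {y : P} {x₁ : M}
    (hf : MDifferentiableAt 𝓘(ℝ, P) (𝓡 6) f y) (hy : f y ∈ (chartAt E6 x₁).source) :
    pb f α y = (α.inChart x₁ (chartAt E6 x₁ (f y))).compContinuousLinearMap
      (fderiv ℝ (fun z => chartAt E6 x₁ (f z)) y) := by
  have hchart := mdifferentiable_chart (I := 𝓡 6) x₁
  have hc : MDifferentiableAt (𝓡 6) (𝓡 6) (chartAt E6 x₁) (f y) := hchart.mdifferentiableAt hy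
  have h1 : fderiv ℝ (fun z => chartAt E6 x₁ (f z)) y =
      (mfderiv (𝓡 6) (𝓡 6) (chartAt E6 x₁) (f y)).comp (mfderiv 𝓘(ℝ, P) (𝓡 6) f y) := by
    rw [← mfderiv_eq_fderiv]
    exact mfderiv_comp y hc hf
  have h2 := hchart.symm_comp_deriv hy
  have h3 : (chartAt E6 x₁).symm (chartAt E6 x₁ (f y)) = f y := (chartAt E6 x₁).left_inv hy
  rw [h1]
  ext v
  simp only [pb, inChart]
  have h4 : ∀ u : TangentSpace (𝓡 6) (f y), mfderiv (𝓡 6) (𝓡 6) (chartAt E6 x₁).symm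
      (chartAt E6 x₁ (f y)) (mfderiv (𝓡 6) (𝓡 6) (chartAt E6 x₁) (f y) u) = u := fun u => by
    have := congrArg (fun L => L u) h2
    exact this
  -- The base points agree only propositionally, so forms are compared on the common model space
  -- after substituting the equality.
  have h5 : ∀ (z : M) (hz : z = f y) (w w' : Fin k → E6), w = w' →
      (α z : E6 [⋀^Fin k]→L[ℝ] F) w = (α (f y) : E6 [⋀^Fin k]→L[ℝ] F) w' := by
    rintro z rfl w w' rfl; rfl
  refine (h5 _ h3 _ _ ?_).symm
  funext i
  exact h4 _

theorem contDiffAt_chart_comp {f : P → M} {y : P} {x₁ : M}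
    (hf : ContMDiffAt 𝓘(ℝ, P) (𝓡 6) ∞ f y) (hy : f y ∈ (chartAt E6 x₁).source) :
    ContDiffAt ℝ ∞ (fun z => chartAt E6 x₁ (f z)) y := by
  rw [← contMDiffAt_iff_contDiffAt]
  exact (contMDiffAt_of_mem_maximalAtlas (IsManifold.chart_mem_maximalAtlas x₁) hy).comp y hf

theorem eventually_mdifferentiableAt {f : P → M} {y : P}
    (hf : ContMDiffAt 𝓘(ℝ, P) (𝓡 6) ∞ f y) :
    ∀ᶠ z in 𝓝 y, MDifferentiableAt 𝓘(ℝ, P) (𝓡 6) f z := by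
  have h1 : ContMDiffAt 𝓘(ℝ, P) (𝓡 6) 1 f y := hf.of_le (by simp)
  have : IsManifold (𝓡 6) 1 M := .of_le (n := ∞) (by simp)
  exact ((contMDiffAt_iff_contMDiffAt_nhds (by simp)).1 h1).mono
    fun z hz => hz.mdifferentiableAt (by simp)

theorem eventually_pb_eq (α : DForm M F k) {f : P → M} {y : P} {x₁ : M}
    (hf : ContMDiffAt 𝓘(ℝ, P) (𝓡 6) ∞ f y) (hy : f y ∈ (chartAt E6 x₁).source) :
    pb f α =ᶠ[𝓝 y] fun z => (α.inChart x₁ (chartAt E6 x₁ (f z))).compContinuousLinearMap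
      (fderiv ℝ (fun z => chartAt E6 x₁ (f z)) z) := by
  filter_upwards [eventually_mdifferentiableAt hf, eventually_mem_source hf.continuousAt hy]
    with z h1 h2 using pb_eq_inChart α h1 h2

theorem IsSmooth.contDiffAt_pb {α : DForm M F k} (hα : α.IsSmooth) {f : P → M} {y : P}
    (hf : ContMDiffAt 𝓘(ℝ, P) (𝓡 6) ∞ f y) : ContDiffAt ℝ ∞ (pb f α) y := by
  have hy := mem_chart_source E6 (f y)
  refine ContDiffAt.congr_of_eventuallyEq ?_ (eventually_pb_eq α hf hy)
  have h1 := contDiffAt_chart_comp hf hy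
  refine ContDiffAt.compAlternating ?_ (h1.fderiv_right (by simp))
  exact (hα.contDiffAt_inChart ((chartAt E6 (f y)).map_source hy)).comp y h1

/-- The exterior derivative commutes with pullbacks. -/
theorem IsSmooth.extDeriv_pb {α : DForm M F k} (hα : α.IsSmooth) {f : P → M} {y : P}
    (hf : ContMDiffAt 𝓘(ℝ, P) (𝓡 6) ∞ f y) : extDeriv (pb f α) y = pb f α.d y := by
  have hy := mem_chart_source E6 (f y)
  have h1 := contDiffAt_chart_comp hf hy
  have h0 := extDeriv_pullback (f := fun z => chartAt E6 (f y) (f z)) (r := ∞)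
    (hα.differentiableAt (f y)) h1
    (by rw [minSmoothness_of_isRCLikeNormedField]; exact WithTop.coe_le_coe.2 le_top)
  rw [(eventually_pb_eq α hf hy).extDeriv_eq, h0]
  have hc : MDifferentiableAt (𝓡 6) (𝓡 6) (chartAt E6 (f y)) (f y) :=
    (mdifferentiable_chart (I := 𝓡 6) (f y)).mdifferentiableAt hy
  have h2 : fderiv ℝ (fun z => chartAt E6 (f y) (f z)) y =
      (mfderiv (𝓡 6) (𝓡 6) (chartAt E6 (f y)) (f y)).comp (mfderiv 𝓘(ℝ, P) (𝓡 6) f y) := by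
    rw [← mfderiv_eq_fderiv]
    exact mfderiv_comp y hc (hf.mdifferentiableAt (by simp))
  rw [h2]
  rfl

theorem contMDiffAt_chart_symm {x₀ : M} {y : E6} (hy : y ∈ (chartAt E6 x₀).target) :
    ContMDiffAt 𝓘(ℝ, E6) (𝓡 6) ∞ (chartAt E6 x₀).symm y :=
  contMDiffAt_symm_of_mem_maximalAtlas (IsManifold.chart_mem_maximalAtlas x₀) hy

/-- The definition of `d` uses a different chart at each point. Naturality under the inverse chart
shows that a single chart computes `d` on its whole domain, which is what smoothness of dα and d² =
0 need. -/
theorem IsSmooth.extDeriv_inChart {α : DForm M F k} (hα : α.IsSmooth) {x₀ : M} {y : E6}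
    (hy : y ∈ (chartAt E6 x₀).target) : extDeriv (α.inChart x₀) y = α.d.inChart x₀ y :=
  hα.extDeriv_pb (contMDiffAt_chart_symm hy)

theorem IsSmooth.d {α : DForm M F k} (hα : α.IsSmooth) : α.d.IsSmooth := fun x₀ => by
  have h : ContDiffOn ℝ ∞ (extDeriv (α.inChart x₀)) (chartAt E6 x₀).target := by
    intro y hy
    refine ContDiffAt.contDiffWithinAt ?_
    have := (hα.contDiffAt_inChart hy).fderiv_right (m := ∞) (by simp)
    exact (ContinuousAlternatingMap.alternatizeUncurryFinCLM ℝ E6 F).contDiff.contDiffAt.comp y this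
  exact h.congr fun y hy => (hα.extDeriv_inChart hy).symm

theorem IsSmooth.d_d {α : DForm M F k} (hα : α.IsSmooth) : α.d.d = 0 := by
  funext x
  have hx := mem_chart_target E6 x
  have h1 : α.d.inChart x =ᶠ[𝓝 (chartAt E6 x x)] extDeriv (α.inChart x) := by
    filter_upwards [(chartAt E6 x).open_target.mem_nhds hx] with y hy
    exact (hα.extDeriv_inChart hy).symm
  have h2 : extDeriv (α.d.inChart x) (chartAt E6 x x) = 0 := by
    rw [h1.extDeriv_eq]
    exact extDeriv_extDeriv_apply (hα.contDiffAt_inChart hx)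
      (by rw [minSmoothness_of_isRCLikeNormedField]; exact WithTop.coe_le_coe.2 le_top)
  change (extDeriv (α.d.inChart x) (chartAt E6 x x)).compContinuousLinearMap _ = _
  rw [h2]; rfl

end DForm

/-! ### The gnomonic parametrisation of `SU(2)` -/

/-- The real coordinates `(q₀, q₁, q₂, q₃)` of the matrix `(a, -b̄; b, ā)`, with `a = q₀ + i q₁`
and `b = q₂ + i q₃`. -/
def quatVec : Matrix (Fin 2) (Fin 2) ℂ →ₗ[ℝ] EuclideanSpace ℝ (Fin 4) where
  toFun a := !₂[(a 0 0).re, (a 0 0).im, (a 1 0).re, (a 1 0).im]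
  map_add' a b := by ext i; fin_cases i <;> simp
  map_smul' c a := by ext i; fin_cases i <;> simp

@[simp] theorem quatVec_zero (a : Matrix (Fin 2) (Fin 2) ℂ) : quatVec a 0 = (a 0 0).re := rfl
@[simp] theorem quatVec_one (a : Matrix (Fin 2) (Fin 2) ℂ) : quatVec a 1 = (a 0 0).im := rfl
@[simp] theorem quatVec_two (a : Matrix (Fin 2) (Fin 2) ℂ) : quatVec a 2 = (a 1 0).re := rfl
@[simp] theorem quatVec_three (a : Matrix (Fin 2) (Fin 2) ℂ) : quatVec a 3 = (a 1 0).im := rfl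

/-- For a unitary matrix of determinant one the conjugate transpose and the adjugate are both the
inverse; comparing entries gives this and the next identity. -/
theorem SU2.apply_one_one (a : SU2) : a.1 1 1 = starRingEnd ℂ (a.1 0 0) := by
  have h1 := Matrix.mem_specialUnitaryGroup_iff.1 a.2
  have h2 := Matrix.mem_unitaryGroup_iff'.1 h1.1
  have h3 := h1.2
  rw [Matrix.det_fin_two] at h3
  have h00 := congrFun (congrFun h2 0) 0
  have h01 := congrFun (congrFun h2 0) 1
  simp [Matrix.mul_apply, Fin.sum_univ_two, Matrix.star_eq_conjTranspose] at h00 h01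
  linear_combination (starRingEnd ℂ (a.1 0 0)) * h3 - a.1 1 1 * h00 + a.1 1 0 * h01

theorem SU2.apply_zero_one (a : SU2) : a.1 0 1 = -starRingEnd ℂ (a.1 1 0) := by
  have h1 := Matrix.mem_specialUnitaryGroup_iff.1 a.2
  have h2 := Matrix.mem_unitaryGroup_iff'.1 h1.1
  have h3 := h1.2
  rw [Matrix.det_fin_two] at h3
  have h00 := congrFun (congrFun h2 0) 0
  have h01 := congrFun (congrFun h2 0) 1
  simp [Matrix.mul_apply, Fin.sum_univ_two, Matrix.star_eq_conjTranspose] at h00 h01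
  linear_combination (-starRingEnd ℂ (a.1 1 0)) * h3 - a.1 0 1 * h00 + a.1 0 0 * h01

theorem SU2.sq_sum (a : SU2) :
    (a.1 0 0).re ^ 2 + (a.1 0 0).im ^ 2 + (a.1 1 0).re ^ 2 + (a.1 1 0).im ^ 2 = 1 := by
  have h1 := Matrix.mem_specialUnitaryGroup_iff.1 a.2
  have h3 := h1.2
  rw [Matrix.det_fin_two, SU2.apply_one_one, SU2.apply_zero_one] at h3
  have := congrArg Complex.re h3
  simp at this
  linarith

theorem SU2.ext_col {a b : SU2} (h0 : a.1 0 0 = b.1 0 0) (h1 : a.1 1 0 = b.1 1 0) : a = b := by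
  apply Subtype.ext
  ext i j
  fin_cases i <;> fin_cases j
  · exact h0
  · change a.1 0 1 = b.1 0 1
    rw [SU2.apply_zero_one, SU2.apply_zero_one, h1]
  · exact h1
  · change a.1 1 1 = b.1 1 1
    rw [SU2.apply_one_one, SU2.apply_one_one, h0]

/-- The inverse of `sphereToSU2`. -/
def sphereOf (a : SU2) : USphere 3 :=
  ⟨quatVec a.1, by
    rw [mem_sphere_zero_iff_norm, EuclideanSpace.norm_eq, Real.sqrt_eq_one, Fin.sum_univ_four]
    simpa using SU2.sq_sum a⟩

theorem sphereToSU2_sphereOf (a : SU2) : sphereToSU2 (sphereOf a) = a := by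
  apply SU2.ext_col
  · apply Complex.ext <;> rfl
  · apply Complex.ext <;> rfl

theorem gnomonic_aux (p : Fin 3 → ℝ) : 0 < 1 + p 0 ^ 2 + p 1 ^ 2 + p 2 ^ 2 := by positivity

/-- The point `(1, p) / |(1, p)|` of `S³`. -/
def gnomonicSphere : (Fin 3 → ℝ) → USphere 3 :=
  Set.codRestrict (fun p => (√(1 + p 0 ^ 2 + p 1 ^ 2 + p 2 ^ 2))⁻¹ •
    (!₂[1, p 0, p 1, p 2] : EuclideanSpace ℝ (Fin 4))) _ (fun p => by
    have h := gnomonic_aux p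
    rw [mem_sphere_zero_iff_norm, norm_smul, EuclideanSpace.norm_eq, Fin.sum_univ_four]
    simp only [norm_inv, Real.norm_eq_abs, sq_abs]
    rw [abs_of_pos (Real.sqrt_pos.2 h)]
    have : (!₂[1, p 0, p 1, p 2] : EuclideanSpace ℝ (Fin 4)).ofLp 0 ^ 2 +
      (!₂[1, p 0, p 1, p 2] : EuclideanSpace ℝ (Fin 4)).ofLp 1 ^ 2 +
      (!₂[1, p 0, p 1, p 2] : EuclideanSpace ℝ (Fin 4)).ofLp 2 ^ 2 +
      (!₂[1, p 0, p 1, p 2] : EuclideanSpace ℝ (Fin 4)).ofLp 3 ^ 2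
      = 1 + p 0 ^ 2 + p 1 ^ 2 + p 2 ^ 2 := by simp
    rw [this]
    exact inv_mul_cancel₀ (Real.sqrt_pos.2 h).ne')

theorem contMDiff_gnomonicSphere : ContMDiff 𝓘(ℝ, Fin 3 → ℝ) (𝓡 3) ∞ gnomonicSphere := by
  have : Fact (Module.finrank ℝ (WithLp 2 (Fin 4 → ℝ)) = 3 + 1) := ⟨by
    rw [finrank_euclideanSpace_fin]⟩
  apply ContMDiff.codRestrict_sphere
  rw [contMDiff_iff_contDiff]
  have h1 : ContDiff ℝ ∞ fun p : Fin 3 → ℝ => (√(1 + p 0 ^ 2 + p 1 ^ 2 + p 2 ^ 2))⁻¹ :=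
    ContDiff.inv (ContDiff.sqrt (by fun_prop) fun p => (gnomonic_aux p).ne')
      fun p => (Real.sqrt_pos.2 (gnomonic_aux p)).ne'
  have h2 : ContDiff ℝ ∞ fun p : Fin 3 → ℝ =>
      (!₂[1, p 0, p 1, p 2] : EuclideanSpace ℝ (Fin 4)) := by
    rw [contDiff_euclidean]
    intro i
    fin_cases i <;> simp <;> fun_prop
  exact h1.smul h2

/-- The element of `SU(2)` proportional to the quaternion `1 + p`. -/
def gnomonic (p : Fin 3 → ℝ) : SU2 := sphereToSU2 (gnomonicSphere p)

theorem gnomonic_zero_zero (p : Fin 3 → ℝ) : (gnomonic p).1 0 0 =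
    ((√(1 + p 0 ^ 2 + p 1 ^ 2 + p 2 ^ 2))⁻¹ : ℝ) * ⟨1, p 0⟩ := by
  apply Complex.ext <;>
    simp [gnomonic, sphereToSU2, gnomonicSphere, Set.codRestrict]

theorem gnomonic_one_zero (p : Fin 3 → ℝ) : (gnomonic p).1 1 0 =
    ((√(1 + p 0 ^ 2 + p 1 ^ 2 + p 2 ^ 2))⁻¹ : ℝ) * ⟨p 1, p 2⟩ := by
  apply Complex.ext <;>
    simp [gnomonic, sphereToSU2, gnomonicSphere, Set.codRestrict]

theorem gnomonic_zero : gnomonic 0 = 1 := by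
  apply SU2.ext_col
  · rw [gnomonic_zero_zero]; apply Complex.ext <;> simp
  · rw [gnomonic_one_zero]; apply Complex.ext <;> simp

/-- The coordinates of an element of `SU(2)` in the gnomonic parametrisation. -/
def gnomCoord (v : EuclideanSpace ℝ (Fin 4)) : Fin 3 → ℝ := ![v 1 / v 0, v 2 / v 0, v 3 / v 0]

/-- Central projection identifies the open hemisphere q₀ > 0 of S³ with the affine space q₀ = 1.
Positivity selects one of the two antipodal points on each line. These are the coordinates of SU(2)
near 1 used throughout. -/
theorem gnomonic_gnomCoord {a : SU2} (ha : 0 < (a.1 0 0).re) : gnomonic (gnomCoord (quatVec a.1)) = a := by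
  have h := SU2.sq_sum a
  have h1 : (√(1 + (gnomCoord (quatVec a.1)) 0 ^ 2 + (gnomCoord (quatVec a.1)) 1 ^ 2 + (gnomCoord (quatVec a.1)) 2 ^ 2))⁻¹
      = (a.1 0 0).re := by
    rw [inv_eq_iff_eq_inv, Real.sqrt_eq_iff_eq_sq (by positivity) (by positivity)]
    simp only [gnomCoord, Matrix.cons_val_zero, Matrix.cons_val_one, Matrix.cons_val, quatVec_zero,
      quatVec_one, quatVec_two, quatVec_three]
    field_simp
    linarith
  apply SU2.ext_col
  · rw [gnomonic_zero_zero, h1]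
    apply Complex.ext <;> simp [gnomCoord]
    field_simp
  · rw [gnomonic_one_zero, h1]
    apply Complex.ext <;> simp [gnomCoord] <;> field_simp

theorem gnomonic_re_pos (p : Fin 3 → ℝ) : 0 < ((gnomonic p).1 0 0).re := by
  rw [gnomonic_zero_zero, Complex.re_ofReal_mul, mul_one]
  exact inv_pos.2 (Real.sqrt_pos.2 (gnomonic_aux p))

theorem gnomCoord_gnomonic (p : Fin 3 → ℝ) : gnomCoord (quatVec (gnomonic p).1) = p := by
  have h := (Real.sqrt_pos.2 (gnomonic_aux p)).ne'
  funext i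
  fin_cases i <;>
    simp only [gnomCoord, quatVec_zero, quatVec_one, quatVec_two, quatVec_three, gnomonic_zero_zero,
      gnomonic_one_zero, Complex.re_ofReal_mul, Complex.im_ofReal_mul, Fin.zero_eta, Fin.mk_one,
      Fin.reduceFinMk, Matrix.cons_val_zero, Matrix.cons_val_one, Matrix.cons_val] <;> field_simp

theorem contDiffAt_gnomCoord {n : WithTop ℕ∞} {v : EuclideanSpace ℝ (Fin 4)} (hv : v 0 ≠ 0) :
    ContDiffAt ℝ n gnomCoord v := by
  have h : ∀ i, ContDiffAt ℝ n (fun v : EuclideanSpace ℝ (Fin 4) => v i) v := fun i => by fun_prop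
  rw [contDiffAt_pi]
  intro i
  fin_cases i
  · exact (h 1).div (h 0) hv
  · exact (h 2).div (h 0) hv
  · exact (h 3).div (h 0) hv

/-- The matrix with given quaternionic coordinates. -/
def quatMat : EuclideanSpace ℝ (Fin 4) →ₗ[ℝ] Matrix (Fin 2) (Fin 2) ℂ where
  toFun v := !![⟨v 0, v 1⟩, ⟨-v 2, v 3⟩; ⟨v 2, v 3⟩, ⟨v 0, -v 1⟩]
  map_add' a b := by
    ext i j; fin_cases i <;> fin_cases j <;> simp [Complex.ext_iff] <;> ring
  map_smul' c a := by ext i j; fin_cases i <;> fin_cases j <;> simp [Complex.ext_iff]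

theorem quatMat_quatVec (a : SU2) : quatMat (quatVec a.1) = a.1 := by
  have h1 := SU2.apply_zero_one a
  have h2 := SU2.apply_one_one a
  ext i j; fin_cases i <;> fin_cases j <;> simp [quatMat, Complex.ext_iff, h1, h2]

/-- Left multiplication in quaternionic coordinates. -/
def quatMulLeft (a : SU2) : EuclideanSpace ℝ (Fin 4) →L[ℝ] EuclideanSpace ℝ (Fin 4) :=
  LinearMap.toContinuousLinearMap (quatVec ∘ₗ (LinearMap.mulLeft ℝ a.1) ∘ₗ quatMat)

theorem quatMulLeft_quatVec (a b : SU2) : quatMulLeft a (quatVec b.1) = quatVec (a * b).1 := by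
  change quatVec (a.1 * quatMat (quatVec b.1)) = quatVec (a.1 * b.1)
  rw [quatMat_quatVec]

/-! ### Smoothness of the action along smooth families of group elements. -/

section SmoothAction

variable {M : Type*} [TopologicalSpace M] [ChartedSpace E6 M] [MulAction SU2 M]

theorem IsSmoothAction.contMDiff_smul (h : IsSmoothAction M) (a : SU2) :
    ContMDiff (𝓡 6) (𝓡 6) ∞ (fun x : M => a • x) := by
  have : (fun x : M => a • x) =
      (fun p : USphere 3 × M => sphereToSU2 p.1 • p.2) ∘ fun x => (sphereOf a, x) := by
    funext x; simp [sphereToSU2_sphereOf]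
  rw [this]
  exact h.comp (contMDiff_const.prodMk contMDiff_id)

variable {E : Type*} [NormedAddCommGroup E] [NormedSpace ℝ E] {H : Type*} [TopologicalSpace H]
  {I : ModelWithCorners ℝ E H} {N : Type*} [TopologicalSpace N] [ChartedSpace H N]

theorem IsSmoothAction.contMDiffAt_gnomonic_smul (h : IsSmoothAction M) {p : N → Fin 3 → ℝ}
    {g : N → M} {y : N} (hp : ContMDiffAt I 𝓘(ℝ, Fin 3 → ℝ) ∞ p y)
    (hg : ContMDiffAt I (𝓡 6) ∞ g y) :
    ContMDiffAt I (𝓡 6) ∞ (fun z => gnomonic (p z) • g z) y := by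
  have h1 : ContMDiffAt I ((𝓡 3).prod (𝓡 6)) ∞ (fun z => (gnomonicSphere (p z), g z)) y :=
    (contMDiff_gnomonicSphere.contMDiffAt.comp y hp).prodMk hg
  exact (h.contMDiffAt (x := (gnomonicSphere (p y), g y))).comp y h1

/-- Left translation by the inverse of `a y` moves the family near 1, where gnomonic coordinates
apply; left translation is linear in quaternionic coordinates. Smoothness of a family in SU(2) can
thus be tested in ℝ⁴. -/
theorem IsSmoothAction.contMDiffAt_smul (h : IsSmoothAction M) {a : N → SU2} {g : N → M} {y : N}
    (ha : ContMDiffAt I 𝓘(ℝ, EuclideanSpace ℝ (Fin 4)) ∞ (fun z => quatVec (a z).1) y)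
    (hg : ContMDiffAt I (𝓡 6) ∞ g y) :
    ContMDiffAt I (𝓡 6) ∞ (fun z => a z • g z) y := by
  let b : N → SU2 := fun z => (a y)⁻¹ * a z
  have hb : ContMDiffAt I 𝓘(ℝ, EuclideanSpace ℝ (Fin 4)) ∞ (fun z => quatVec (b z).1) y := by
    have h1 := (quatMulLeft (a y)⁻¹).contDiff (n := ∞)
    have h2 := h1.contMDiff.contMDiffAt.comp y ha
    refine h2.congr_of_eventuallyEq (Filter.Eventually.of_forall fun z => ?_)
    exact (quatMulLeft_quatVec _ _).symm
  have hb1 : b y = 1 := inv_mul_cancel _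
  have hre : quatVec (b y).1 0 = 1 := by rw [hb1]; simp
  have hs : ContMDiffAt I 𝓘(ℝ, Fin 3 → ℝ) ∞ (fun z => gnomCoord (quatVec (b z).1)) y :=
    ((contDiffAt_gnomCoord (by rw [hre]; exact one_ne_zero)).contMDiffAt).comp y hb
  have hpos : ∀ᶠ z in 𝓝 y, 0 < ((b z).1 0 0).re := by
    have hc : ContinuousAt (fun z => quatVec (b z).1 0) y := by
      have h2 : Continuous (fun m : EuclideanSpace ℝ (Fin 4) => m 0) := by fun_prop
      exact h2.continuousAt.comp hb.continuousAt
    exact hc.eventually (lt_mem_nhds (by simp only [hre]; exact one_pos))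
  have := (h.contMDiff_smul (a y)).contMDiffAt.comp y (h.contMDiffAt_gnomonic_smul hs hg)
  refine this.congr_of_eventuallyEq ?_
  filter_upwards [hpos] with z hz
  have h3 : gnomonic (gnomCoord (quatVec (b z).1)) = (a y)⁻¹ * a z := gnomonic_gnomCoord hz
  simp only [Function.comp_apply, h3, smul_smul, mul_inv_cancel_left]

end SmoothAction

/-! ### One-parameter subgroups of `SU(2)` -/

/-- The coordinates `c` of `A ∈ 𝔰𝔲(2)`, so that `A` is the imaginary quaternion `c`. -/
def su2Coord : su2 ≃ₗ[ℝ] (Fin 3 → ℝ) where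
  toFun A := ![(A.1 0 0).im, (A.1 1 0).re, (A.1 1 0).im]
  map_add' a b := by ext i; fin_cases i <;> simp
  map_smul' c a := by ext i; fin_cases i <;> simp
  invFun c := ⟨!![⟨0, c 0⟩, ⟨-c 1, c 2⟩; ⟨c 1, c 2⟩, ⟨0, -c 0⟩], by
    constructor
    · ext i j; fin_cases i <;> fin_cases j <;> simp [Complex.ext_iff]
    · simp [Matrix.trace_fin_two, Complex.ext_iff]⟩
  left_inv A := by
    obtain ⟨h1, h2⟩ := A.2
    have h00 := congrFun (congrFun h1 0) 0
    have h01 := congrFun (congrFun h1 0) 1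
    have h11 := congrFun (congrFun h1 1) 1
    rw [Matrix.trace_fin_two] at h2
    simp [Matrix.conjTranspose_apply, Complex.ext_iff] at h00 h01 h11 h2
    ext i j
    fin_cases i <;> fin_cases j <;> simp [Complex.ext_iff] <;>
      (try constructor) <;> linarith
  right_inv c := by ext i; fin_cases i <;> simp

theorem su2Coord_symm_coe (c : Fin 3 → ℝ) : (su2Coord.symm c : Matrix (Fin 2) (Fin 2) ℂ) =
    !![⟨0, c 0⟩, ⟨-c 1, c 2⟩; ⟨c 1, c 2⟩, ⟨0, -c 0⟩] := rfl

theorem su2Coord_symm_sq (c : Fin 3 → ℝ) :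
    (su2Coord.symm c : Matrix (Fin 2) (Fin 2) ℂ) * (su2Coord.symm c : Matrix (Fin 2) (Fin 2) ℂ) =
      (-(c 0 ^ 2 + c 1 ^ 2 + c 2 ^ 2) : ℝ) • (1 : Matrix (Fin 2) (Fin 2) ℂ) := by
  rw [su2Coord_symm_coe]
  ext i j
  fin_cases i <;> fin_cases j <;> simp [Matrix.mul_apply, Fin.sum_univ_two, Complex.ext_iff, pow_two] <;>
    constructor <;> ring

section ExpFormula

attribute [local instance] Matrix.linftyOpNormedAddCommGroup Matrix.linftyOpNormedSpace
  Matrix.linftyOpNormedRing Matrix.linftyOpNormedAlgebra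

/-- The right-hand side solves y' = A y with y(0) = 1 because A² = -r². Hence exp(-tA) y(t) has zero
derivative and stays equal to 1. -/
theorem exp_smul_eq_of_sq {A : Matrix (Fin 2) (Fin 2) ℂ} {r : ℝ} (hr : r ≠ 0)
    (hA : A * A = (-(r ^ 2) : ℝ) • (1 : Matrix (Fin 2) (Fin 2) ℂ)) (t : ℝ) :
    NormedSpace.exp (t • A) =
      Real.cos (r * t) • (1 : Matrix (Fin 2) (Fin 2) ℂ) + (Real.sin (r * t) / r) • A := by
  let y : ℝ → Matrix (Fin 2) (Fin 2) ℂ := fun t =>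
    Real.cos (r * t) • (1 : Matrix (Fin 2) (Fin 2) ℂ) + (Real.sin (r * t) / r) • A
  have hy : ∀ t, HasDerivAt y (A * y t) t := by
    intro t
    have hl : HasDerivAt (fun t : ℝ => r * t) r t := by simpa using (hasDerivAt_id t).const_mul r
    have h1 := (hl.cos.smul_const (1 : Matrix (Fin 2) (Fin 2) ℂ)).add
      ((hl.sin.div_const r).smul_const A)
    refine h1.congr_deriv ?_
    simp only [y, mul_add, Algebra.mul_smul_comm, mul_one, hA, smul_smul]
    rw [add_comm, mul_div_cancel_right₀ _ hr]
    congr 2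
    field_simp
  have hE : ∀ t : ℝ, HasDerivAt (fun t : ℝ => NormedSpace.exp (t • -A))
      (NormedSpace.exp (t • -A) * -A) t := fun t => hasDerivAt_exp_smul_const (𝕂 := ℝ) (-A) t
  have hz : ∀ t, HasDerivAt (fun t => NormedSpace.exp (t • -A) * y t) 0 t := by
    intro t
    refine ((hE t).mul (hy t)).congr_deriv ?_
    simp [mul_assoc]
  have hconst : NormedSpace.exp (t • -A) * y t = NormedSpace.exp ((0 : ℝ) • -A) * y 0 :=
    is_const_of_deriv_eq_zero (fun t => (hz t).differentiableAt) (fun t => (hz t).deriv) t 0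
  have h0 : NormedSpace.exp ((0 : ℝ) • -A) * y 0 = 1 := by simp [y]
  have hmul : NormedSpace.exp (t • A) * NormedSpace.exp (t • -A) = 1 := by
    rw [← Matrix.exp_add_of_commute]
    · simp
    · simp
  calc NormedSpace.exp (t • A) = NormedSpace.exp (t • A) * (NormedSpace.exp (t • -A) * y t) := by
        rw [hconst, h0, mul_one]
    _ = y t := by rw [← mul_assoc, hmul, one_mul]

end ExpFormula

theorem expSU2_coe (ξ : su2) (t : ℝ) : (expSU2 (t • ξ)).1 =
    NormedSpace.exp (t • (ξ : Matrix (Fin 2) (Fin 2) ℂ)) := rfl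

theorem expSU2_zero_smul (ξ : su2) : expSU2 ((0 : ℝ) • ξ) = 1 := by
  apply Subtype.ext
  rw [expSU2_coe]; simp

theorem expSU2_add_smul (ξ : su2) (s t : ℝ) :
    expSU2 ((s + t) • ξ) = expSU2 (s • ξ) * expSU2 (t • ξ) := by
  apply Subtype.ext
  change (expSU2 ((s + t) • ξ)).1 = (expSU2 (s • ξ)).1 * (expSU2 (t • ξ)).1
  simp only [expSU2_coe]
  rw [add_smul, Matrix.exp_add_of_commute]
  exact ((Commute.refl _).smul_left _).smul_right _

theorem exp_su2_formula {ξ : su2} {r : ℝ} (hr : r ≠ 0)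
    (h : su2Coord ξ 0 ^ 2 + su2Coord ξ 1 ^ 2 + su2Coord ξ 2 ^ 2 = r ^ 2) (t : ℝ) :
    (expSU2 (t • ξ)).1 = Real.cos (r * t) • (1 : Matrix (Fin 2) (Fin 2) ℂ)
      + (Real.sin (r * t) / r) • (ξ : Matrix (Fin 2) (Fin 2) ℂ) := by
  rw [expSU2_coe]
  refine exp_smul_eq_of_sq hr ?_ t
  have := su2Coord_symm_sq (su2Coord ξ)
  rwa [su2Coord.symm_apply_apply, h] at this

theorem exists_su2_norm {ξ : su2} (hξ : ξ ≠ 0) : ∃ r : ℝ, 0 < r ∧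
    su2Coord ξ 0 ^ 2 + su2Coord ξ 1 ^ 2 + su2Coord ξ 2 ^ 2 = r ^ 2 := by
  have hpos : 0 < su2Coord ξ 0 ^ 2 + su2Coord ξ 1 ^ 2 + su2Coord ξ 2 ^ 2 := by
    by_contra hle
    apply hξ
    apply su2Coord.injective
    rw [map_zero]
    funext i
    fin_cases i <;> simp <;> nlinarith [sq_nonneg (su2Coord ξ 0), sq_nonneg (su2Coord ξ 1),
      sq_nonneg (su2Coord ξ 2)]
  exact ⟨_, Real.sqrt_pos.2 hpos, (Real.sq_sqrt hpos.le).symm⟩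

/-- The quaternionic coordinates of `exp(tξ)`. -/
theorem quatVec_expSU2 {ξ : su2} {r : ℝ} (hr : r ≠ 0)
    (h : su2Coord ξ 0 ^ 2 + su2Coord ξ 1 ^ 2 + su2Coord ξ 2 ^ 2 = r ^ 2) (t : ℝ) :
    quatVec (expSU2 (t • ξ)).1 = Real.cos (r * t) • quatVec 1
      + (Real.sin (r * t) / r) • quatVec (ξ : Matrix (Fin 2) (Fin 2) ℂ) := by
  rw [exp_su2_formula hr h, map_add, map_smul, map_smul]

theorem quatVec_su2 (ξ : su2) : quatVec (ξ : Matrix (Fin 2) (Fin 2) ℂ) =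
    !₂[0, su2Coord ξ 0, su2Coord ξ 1, su2Coord ξ 2] := by
  have h := su2Coord_symm_coe (su2Coord ξ)
  rw [su2Coord.symm_apply_apply] at h
  rw [h]
  ext i; fin_cases i <;> simp

theorem contDiff_quatVec_expSU2 (ξ : su2) {n : WithTop ℕ∞} :
    ContDiff ℝ n (fun t : ℝ => quatVec (expSU2 (t • ξ)).1) := by
  by_cases hξ : ξ = 0
  · subst hξ
    simp only [smul_zero]
    exact contDiff_const
  · obtain ⟨r, hr, h⟩ := exists_su2_norm hξ
    rw [funext (quatVec_expSU2 hr.ne' h)]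
    have h1 : ContDiff ℝ n fun t : ℝ => Real.cos (r * t) := by fun_prop
    have h2 : ContDiff ℝ n fun t : ℝ => Real.sin (r * t) / r := by fun_prop
    exact (h1.smul contDiff_const).add (h2.smul contDiff_const)

/-- In gnomonic coordinates exp(tξ) is (tan(rt)/r) times the coordinate vector of ξ, with derivative
that vector at 0. So `su2Coord` is the identification of the Lie algebra with the tangent space of
the chart at 1. -/
theorem hasDerivAt_gnomCoord_expSU2 (ξ : su2) :
    HasDerivAt (fun t : ℝ => gnomCoord (quatVec (expSU2 (t • ξ)).1)) (su2Coord ξ) 0 := by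
  by_cases hξ : ξ = 0
  · subst hξ
    simp only [smul_zero, map_zero]
    exact hasDerivAt_const _ _
  · obtain ⟨r, hr, h⟩ := exists_su2_norm hξ
    have hl : HasDerivAt (fun t : ℝ => r * t) r 0 := by simpa using (hasDerivAt_id (0:ℝ)).const_mul r
    have key : ∀ c : ℝ, HasDerivAt (fun t : ℝ => (Real.sin (r * t) / r * c) / Real.cos (r * t)) c 0 := by
      intro c
      have := ((hl.sin.div_const r).mul_const c).div hl.cos (by simp)
      refine this.congr_deriv ?_
      simp; field_simp
    have hq : (fun t : ℝ => gnomCoord (quatVec (expSU2 (t • ξ)).1)) = fun t i =>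
        (Real.sin (r * t) / r * su2Coord ξ i) / Real.cos (r * t) := by
      funext t i
      rw [quatVec_expSU2 hr.ne' h, quatVec_su2]
      fin_cases i <;> simp [gnomCoord]
    rw [hq, hasDerivAt_pi]
    exact fun i => key _

/-- Every element of `SU(2)` is on a one-parameter subgroup. -/
theorem exists_expSU2_eq (a : SU2) : ∃ ξ : su2, expSU2 ((1 : ℝ) • ξ) = a := by
  have hs := SU2.sq_sum a
  by_cases h0 : (a.1 0 0).im = 0 ∧ (a.1 1 0).re = 0 ∧ (a.1 1 0).im = 0
  · obtain ⟨h1, h2, h3⟩ := h0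
    rw [h1, h2, h3] at hs
    have : (a.1 0 0).re = 1 ∨ (a.1 0 0).re = -1 := by
      have : (a.1 0 0).re ^ 2 = 1 := by linarith
      rcases mul_eq_zero.1 (show ((a.1 0 0).re - 1) * ((a.1 0 0).re + 1) = 0 by linarith) with h | h
      · left; linarith
      · right; linarith
    rcases this with h | h
    · refine ⟨0, ?_⟩
      rw [smul_zero, ← zero_smul ℝ (0 : su2), expSU2_zero_smul]
      apply SU2.ext_col <;> apply Complex.ext <;> simp [h, h1, h2, h3]
    · refine ⟨su2Coord.symm ![Real.pi, 0, 0], ?_⟩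
      have hf := exp_su2_formula (ξ := su2Coord.symm ![Real.pi, 0, 0]) Real.pi_pos.ne' (by simp) 1
      apply SU2.ext_col <;> rw [hf] <;> apply Complex.ext <;>
        simp [h, h1, h2, h3, su2Coord_symm_coe]
  -- Away from ±1 the rotation angle is the arccosine of the real part, and the axis is the
  -- imaginary part, of norm `s` = sin θ, normalised.
  · set s := √(1 - (a.1 0 0).re ^ 2) with hsdef
    have hpos : 0 < 1 - (a.1 0 0).re ^ 2 := by
      by_contra hle
      exact h0 ⟨by nlinarith, by nlinarith, by nlinarith⟩
    have hspos : 0 < s := Real.sqrt_pos.2 hpos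
    have hss : s ^ 2 = 1 - (a.1 0 0).re ^ 2 := Real.sq_sqrt hpos.le
    have hre : -1 ≤ (a.1 0 0).re ∧ (a.1 0 0).re ≤ 1 := by constructor <;> nlinarith
    set θ := Real.arccos (a.1 0 0).re with hθ
    have hcos : Real.cos θ = (a.1 0 0).re := Real.cos_arccos hre.1 hre.2
    have hsin : Real.sin θ = s := Real.sin_arccos _
    have hθ0 : θ ≠ 0 := by
      intro h
      rw [h, Real.sin_zero] at hsin
      exact hspos.ne hsin
    refine ⟨su2Coord.symm ((θ / s) • ![(a.1 0 0).im, (a.1 1 0).re, (a.1 1 0).im]), ?_⟩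
    have hf := exp_su2_formula (r := θ)
      (ξ := su2Coord.symm ((θ / s) • ![(a.1 0 0).im, (a.1 1 0).re, (a.1 1 0).im])) hθ0 (by
        simp
        field_simp
        linarith) 1
    rw [mul_one, hcos, hsin] at hf
    apply SU2.ext_col <;> rw [hf] <;> apply Complex.ext <;>
        simp [su2Coord_symm_coe] <;> field_simp

/-! ### Fundamental vector fields -/

/-- The adjoint action of `SU(2)` on its Lie algebra. -/
def adSU2 (a : SU2) : su2 →ₗ[ℝ] su2 where
  toFun ξ := ⟨a.1 * ξ.1 * (a⁻¹).1, by
    obtain ⟨h1, h2⟩ := ξ.2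
    have hs : ∀ b : SU2, b.1.conjTranspose = (b⁻¹).1 := fun b => rfl
    have hi : (a⁻¹).1 * a.1 = 1 := congrArg Subtype.val (inv_mul_cancel a)
    constructor
    · rw [Matrix.conjTranspose_mul, Matrix.conjTranspose_mul, hs, hs, inv_inv, h1]
      simp [mul_assoc]
    · rw [Matrix.trace_mul_comm, ← mul_assoc, hi, one_mul, h2]⟩
  map_add' ξ η := by ext1; simp [mul_add, add_mul]
  map_smul' c ξ := by ext1; simp

theorem adSU2_coe (a : SU2) (ξ : su2) : (adSU2 a ξ).1 = a.1 * ξ.1 * (a⁻¹).1 := rfl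

theorem adSU2_mul (a b : SU2) (ξ : su2) : adSU2 (a * b) ξ = adSU2 a (adSU2 b ξ) := by
  ext1
  simp only [adSU2_coe, mul_inv_rev]
  change a.1 * b.1 * ξ.1 * ((b⁻¹).1 * (a⁻¹).1) = _
  simp only [mul_assoc]

theorem adSU2_one (ξ : su2) : adSU2 1 ξ = ξ := by
  ext1
  rw [adSU2_coe]
  simp

theorem expSU2_adSU2 (a : SU2) (ξ : su2) : expSU2 (adSU2 a ξ) = a * expSU2 ξ * a⁻¹ := by
  let U : (Matrix (Fin 2) (Fin 2) ℂ)ˣ := ⟨a.1, (a⁻¹).1,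
    congrArg Subtype.val (mul_inv_cancel a), congrArg Subtype.val (inv_mul_cancel a)⟩
  apply Subtype.ext
  exact Matrix.exp_units_conj U ξ.1

section

variable {M : Type*} [TopologicalSpace M] [ChartedSpace E6 M]

/-- The chain rule with the base point known up to a propositional equality. Values are read in the
model spaces, so no transport between tangent spaces occurs. -/
theorem mfderiv_comp_apply_of_base {E : Type*} [NormedAddCommGroup E] [NormedSpace ℝ E]
    {H : Type*} [TopologicalSpace H] {I : ModelWithCorners ℝ E H} {N : Type*} [TopologicalSpace N]
    [ChartedSpace H N] {E' : Type*} [NormedAddCommGroup E'] [NormedSpace ℝ E']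
    {H' : Type*} [TopologicalSpace H'] {I' : ModelWithCorners ℝ E' H'} {N' : Type*}
    [TopologicalSpace N'] [ChartedSpace H' N'] {g : M → N} {f : N' → M} {y : N'}
    {x : M} (hx : f y = x) (hg : MDifferentiableAt (𝓡 6) I g x)
    (hf : MDifferentiableAt I' (𝓡 6) f y) (v : E') :
    (mfderiv I' I (g ∘ f) y : E' →L[ℝ] E) v =
      (mfderiv (𝓡 6) I g x : E6 →L[ℝ] E) ((mfderiv I' (𝓡 6) f y : E' →L[ℝ] E6) v) := by
  subst hx
  rw [mfderiv_comp y hg hf]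
  rfl

/-- In a chart the curve has zero derivative on an interval, so it is locally constant;
connectedness of ℝ concludes. -/
theorem curve_const_of_mfderiv_eq_zero [IsManifold (𝓡 6) ∞ M] [T2Space M] {c : ℝ → M}
    (hc : ContMDiff 𝓘(ℝ, ℝ) (𝓡 6) ∞ c)
    (h : ∀ t, (mfderiv 𝓘(ℝ, ℝ) (𝓡 6) c t : ℝ →L[ℝ] E6) 1 = 0) (t : ℝ) : c t = c 0 := by
  have hl : IsLocallyConstant c := by
    rw [IsLocallyConstant.iff_eventually_eq]
    intro t₀
    set e := chartAt E6 (c t₀) with he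
    have hsrc : ∀ᶠ t in 𝓝 t₀, c t ∈ e.source :=
      DForm.eventually_mem_source hc.continuous.continuousAt (mem_chart_source E6 (c t₀))
    obtain ⟨ε, hε, hball⟩ := Metric.eventually_nhds_iff_ball.1 hsrc
    have hd : ∀ t ∈ Metric.ball t₀ ε, HasFDerivAt (fun t => e (c t)) (0 : ℝ →L[ℝ] E6) t := by
      intro t ht
      have h1 := DForm.contDiffAt_chart_comp (x₁ := c t₀) hc.contMDiffAt (hball t ht)
      have h2 : fderiv ℝ (fun t => e (c t)) t = 0 := by
        ext1
        rw [← mfderiv_eq_fderiv]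
        have h3 := mfderiv_comp_apply_of_base (I' := 𝓘(ℝ, ℝ)) (f := c) (y := t) (g := e) rfl
          ((mdifferentiable_chart (I := 𝓡 6) (c t₀)).mdifferentiableAt (hball t ht))
          (hc.mdifferentiable (by simp) t) 1
        exact h3.trans ((congrArg _ (h t)).trans (map_zero _))
      rw [← h2]
      exact (h1.differentiableAt (by simp)).hasFDerivAt
    filter_upwards [Metric.ball_mem_nhds t₀ hε] with t ht
    have hconst := Metric.isOpen_ball.is_const_of_fderiv_eq_zero (convex_ball t₀ ε).isPreconnected
      (fun t ht => (hd t ht).differentiableAt.differentiableWithinAt) (fun t ht => (hd t ht).fderiv)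
      ht (Metric.mem_ball_self hε)
    exact e.injOn (hball t ht) (hball t₀ (Metric.mem_ball_self hε)) hconst
  exact hl.apply_eq_of_preconnectedSpace t 0

end

section Fundamental

variable {M : Type*} [TopologicalSpace M] [ChartedSpace E6 M] [MulAction SU2 M]

/-- The differential at `p = 0` of `p ↦ gnomonic p • x`: the infinitesimal action in
coordinates. -/
def infAct (x : M) : (Fin 3 → ℝ) →L[ℝ] E6 :=
  mfderiv 𝓘(ℝ, Fin 3 → ℝ) (𝓡 6) (fun p => gnomonic p • x) 0

/-- The fundamental vector field, as a vector of the model space of the tangent space. -/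
def fundVec (ξ : su2) (x : M) : E6 := fundamentalField ξ x

/-- The differential of the action of `a`. -/
def actDeriv (a : SU2) (x : M) : E6 →L[ℝ] E6 := mfderiv (𝓡 6) (𝓡 6) (fun y : M => a • y) x

variable (h : IsSmoothAction M)
include h

theorem contMDiff_gnomonic_smul (x : M) :
    ContMDiff 𝓘(ℝ, Fin 3 → ℝ) (𝓡 6) ∞ (fun p => gnomonic p • x) :=
  fun _ => h.contMDiffAt_gnomonic_smul contMDiffAt_id contMDiffAt_const

theorem contMDiff_expSU2_smul (ξ : su2) (x : M) :
    ContMDiff 𝓘(ℝ, ℝ) (𝓡 6) ∞ (fun t : ℝ => expSU2 (t • ξ) • x) :=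
  fun _ => h.contMDiffAt_smul (contDiff_quatVec_expSU2 ξ).contMDiff.contMDiffAt contMDiffAt_const

theorem mdifferentiableAt_smul (a : SU2) (x : M) :
    MDifferentiableAt (𝓡 6) (𝓡 6) (fun y : M => a • y) x :=
  (h.contMDiff_smul a).mdifferentiable (by simp) x

/-- Near 0 the curve exp(tξ) factors through the gnomonic chart with initial velocity `su2Coord ξ`.
This makes the linearity of ξ ↦ K^ξ visible, which the definition by separate curves does not. -/
theorem fundVec_eq (ξ : su2) (x : M) :
    fundVec ξ x = infAct x (su2Coord ξ) := by
  let g : ℝ → Fin 3 → ℝ := fun t => gnomCoord (quatVec (expSU2 (t • ξ)).1)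
  have hg := hasDerivAt_gnomCoord_expSU2 ξ
  have hg0 : g 0 = 0 := by
    simp only [g, expSU2_zero_smul]
    funext i; fin_cases i <;> simp [gnomCoord]
  have hev : (fun t : ℝ => expSU2 (t • ξ) • x) =ᶠ[𝓝 0] (fun p => gnomonic p • x) ∘ g := by
    have hpos : ∀ᶠ t in 𝓝 (0 : ℝ), 0 < quatVec (expSU2 (t • ξ)).1 0 := by
      have hc : ContinuousAt (fun t : ℝ => quatVec (expSU2 (t • ξ)).1 0) 0 := by
        have h2 : Continuous (fun m : EuclideanSpace ℝ (Fin 4) => m 0) := by fun_prop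
        exact (h2.comp (contDiff_quatVec_expSU2 ξ (n := 0)).continuous).continuousAt
      refine hc.eventually (lt_mem_nhds ?_)
      simp only [expSU2_zero_smul]
      simp
    filter_upwards [hpos] with t ht
    simp only [Function.comp_apply, g]
    rw [gnomonic_gnomCoord ht]
  have hmg : HasMFDerivAt 𝓘(ℝ, ℝ) 𝓘(ℝ, Fin 3 → ℝ) g 0
      (ContinuousLinearMap.smulRight (1 : ℝ →L[ℝ] ℝ) (su2Coord ξ)) :=
    hg.hasFDerivAt.hasMFDerivAt
  have hm : MDifferentiableAt 𝓘(ℝ, Fin 3 → ℝ) (𝓡 6) (fun p => gnomonic p • x) (g 0) :=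
    (contMDiff_gnomonic_smul h x).mdifferentiable (by simp) _
  unfold fundVec fundamentalField infAct
  rw [hev.mfderiv_eq, mfderiv_comp (0 : ℝ) hm hmg.mdifferentiableAt, hmg.mfderiv, hg0]
  change mfderiv 𝓘(ℝ, Fin 3 → ℝ) (𝓡 6) (fun p => gnomonic p • x) 0
    ((1 : ℝ →L[ℝ] ℝ) 1 • (su2Coord ξ)) = _
  rw [one_apply_eq_self, one_smul]
  rfl

theorem fundVec_smul (c : ℝ) (ξ : su2) (x : M) :
    fundVec (c • ξ) x = c • fundVec ξ x := by
  simp only [fundVec_eq h, map_smul]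

/-- This is the derivative at 0 of exp(t Ad_a ξ) a x = a exp(tξ) x. -/
theorem fundVec_adSU2 (a : SU2) (ξ : su2) (x : M) :
    fundVec (adSU2 a ξ) (a • x) = actDeriv a x (fundVec ξ x) := by
  have h1 : (fun t : ℝ => expSU2 (t • adSU2 a ξ) • a • x) =
      (fun y : M => a • y) ∘ fun t : ℝ => expSU2 (t • ξ) • x := by
    funext t
    simp only [Function.comp_apply]
    rw [← map_smul, expSU2_adSU2, smul_smul, smul_smul, inv_mul_cancel_right]
  unfold fundVec fundamentalField actDeriv
  rw [h1]
  exact mfderiv_comp_apply_of_base (by simp only [expSU2_zero_smul, one_smul])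
    (mdifferentiableAt_smul h a x) ((contMDiff_expSU2_smul h ξ x).mdifferentiable (by simp) 0) 1

theorem actDeriv_mul (a b : SU2) (x : M) (v : E6) :
    actDeriv (a * b) x v = actDeriv a (b • x) (actDeriv b x v) := by
  unfold actDeriv
  have : (fun y : M => (a * b) • y) = (fun y : M => a • y) ∘ fun y : M => b • y := by
    funext y; simp [mul_smul]
  rw [this]
  exact mfderiv_comp_apply_of_base rfl (mdifferentiableAt_smul h a _) (mdifferentiableAt_smul h b x) v

omit h in
theorem actDeriv_one (x : M) (v : E6) : actDeriv 1 x v = v := by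
  unfold actDeriv
  have : (fun y : M => (1 : SU2) • y) = id := by funext y; simp
  rw [this, mfderiv_id]
  rfl

theorem actDeriv_inv (a : SU2) (x : M) (v : E6) :
    actDeriv a⁻¹ (a • x) (actDeriv a x v) = v := by
  rw [← actDeriv_mul h, inv_mul_cancel, actDeriv_one]

theorem actDeriv_injective (a : SU2) (x : M) : Function.Injective (actDeriv a x) :=
  fun v w hvw => by rw [← actDeriv_inv h a x v, ← actDeriv_inv h a x w, hvw]

/-- The flow of `K^ξ` is `exp(tξ)`. -/
theorem mfderiv_expSU2_smul (ξ : su2) (x : M) (t : ℝ) :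
    (mfderiv 𝓘(ℝ, ℝ) (𝓡 6) (fun t : ℝ => expSU2 (t • ξ) • x) t : ℝ →L[ℝ] E6) 1 =
      fundVec ξ (expSU2 (t • ξ) • x) := by
  have h1 : (fun s : ℝ => expSU2 (s • ξ) • x) =
      (fun s : ℝ => expSU2 (s • ξ) • expSU2 (t • ξ) • x) ∘ fun s : ℝ => s - t := by
    funext s
    simp only [Function.comp_apply]
    rw [smul_smul, ← expSU2_add_smul, sub_add_cancel]
  have hs : HasMFDerivAt 𝓘(ℝ, ℝ) 𝓘(ℝ, ℝ) (fun s : ℝ => s - t) t (ContinuousLinearMap.id ℝ ℝ) :=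
    ((hasFDerivAt_id t).sub_const t).hasMFDerivAt
  have hm := (contMDiff_expSU2_smul h ξ (expSU2 (t • ξ) • x)).mdifferentiable (by simp)
  rw [h1, mfderiv_comp t (hm _) hs.mdifferentiableAt, hs.mfderiv]
  change (mfderiv 𝓘(ℝ, ℝ) (𝓡 6) _ (t - t) : ℝ →L[ℝ] E6) 1 = _
  rw [sub_self]
  rfl

omit h in
theorem adSU2_expSU2_self (ξ : su2) (t : ℝ) : adSU2 (expSU2 (t • ξ)) ξ = ξ := by
  have hc : Commute (expSU2 (t • ξ)).1 ξ.1 := by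
    rw [expSU2_coe]
    exact ((Commute.refl ξ.1).smul_left t).exp_left
  ext1
  rw [adSU2_coe, hc.eq, mul_assoc]
  have : (expSU2 (t • ξ)).1 * ((expSU2 (t • ξ))⁻¹).1 = 1 := 
    congrArg Subtype.val (mul_inv_cancel (expSU2 (t • ξ)))
  rw [this, mul_one]

/-- Since Ad of exp(tξ) fixes ξ, the field K^ξ is carried to itself by its own flow. A zero at `x`
thus stays a zero along the orbit curve, whose velocity vanishes identically. -/
theorem expSU2_smul_eq_of_fundVec_eq_zero [IsManifold (𝓡 6) ∞ M] [T2Space M] {ξ : su2}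
    {x : M} (hx : fundVec ξ x = 0) (t : ℝ) : expSU2 (t • ξ) • x = x := by
  have h0 := curve_const_of_mfderiv_eq_zero (contMDiff_expSU2_smul h ξ x) (fun t => by
    rw [mfderiv_expSU2_smul h]
    have := fundVec_adSU2 h (expSU2 (t • ξ)) ξ x
    rw [hx, adSU2_expSU2_self] at this
    rw [this]
    exact map_zero _) t
  rw [h0, expSU2_zero_smul, one_smul]

end Fundamental

/-! ### Contraction, Lie derivative and Cartan's formula -/

theorem contDiff_curryLeft {E F : Type*} [NormedAddCommGroup E] [NormedSpace ℝ E]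
    [NormedAddCommGroup F] [NormedSpace ℝ F] {k : ℕ} {n : WithTop ℕ∞} :
    ContDiff ℝ n (fun f : E [⋀^Fin (k + 1)]→L[ℝ] F => f.curryLeft) :=
  ContinuousLinearMap.contDiff (𝕜 := ℝ) (E := E [⋀^Fin (k + 1)]→L[ℝ] F)
    (F := E →L[ℝ] E [⋀^Fin k]→L[ℝ] F)
    (ContinuousAlternatingMap.curryLeftLI (𝕜 := ℝ) (E := E) (F := F)
      (n := k)).toContinuousLinearMap

namespace DForm

section

variable {M : Type*} [TopologicalSpace M] [ChartedSpace E6 M]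
  {F : Type*} [NormedAddCommGroup F] [NormedSpace ℝ F] {k : ℕ}

/-- The value of a form at `x`, on the model space of the tangent space. -/
def ev (α : DForm M F k) (x : M) : E6 [⋀^Fin k]→L[ℝ] F := α x

theorem exists_chart_point (x : M) : ∃ x₀ : M, ∃ y ∈ (chartAt E6 x₀).target,
    (chartAt E6 x₀).symm y = x :=
  ⟨x, chartAt E6 x x, mem_chart_target E6 x, (chartAt E6 x).left_inv (mem_chart_source E6 x)⟩

theorem mfderiv_chart_symm_surjective [IsManifold (𝓡 6) ∞ M] {x₀ : M} {y : E6}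
    (hy : y ∈ (chartAt E6 x₀).target) :
    Function.Surjective (mfderiv (𝓡 6) (𝓡 6) (chartAt E6 x₀).symm y) :=
  (mdifferentiable_chart (I := 𝓡 6) x₀).symm.mfderiv_surjective hy

theorem exists_chart_frame [IsManifold (𝓡 6) ∞ M] {x₀ : M} {y : E6}
    (hy : y ∈ (chartAt E6 x₀).target) (v : Fin k → E6) :
    ∃ w : Fin k → E6, v = fun i =>
      (mfderiv (𝓡 6) (𝓡 6) (chartAt E6 x₀).symm y : E6 →L[ℝ] E6) (w i) := by
  choose w hw using fun i => mfderiv_chart_symm_surjective hy (v i)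
  exact ⟨w, funext fun i => (hw i).symm⟩

theorem ext_inChart [IsManifold (𝓡 6) ∞ M] {α β : DForm M F k}
    (h : ∀ x₀ : M, ∀ y ∈ (chartAt E6 x₀).target, α.inChart x₀ y = β.inChart x₀ y) : α = β := by
  funext x
  obtain ⟨x₀, y, hy, rfl⟩ := exists_chart_point x
  ext v
  obtain ⟨w, rfl⟩ := exists_chart_frame hy v
  exact congrArg (fun A => A w) (h x₀ y hy)

end

section

variable {M : Type*} [TopologicalSpace M] [ChartedSpace E6 M] [MulAction SU2 M]
  {F : Type*} [NormedAddCommGroup F] [NormedSpace ℝ F] {k : ℕ}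
  {P : Type*} [NormedAddCommGroup P] [NormedSpace ℝ P]

/-- The contraction of a form with the fundamental vector field of `ξ`. -/
def iota (ξ : su2) (α : DForm M F (k + 1)) : DForm M F k := fun x =>
  ContinuousAlternatingMap.curryLeft (α.ev x) (fundVec ξ x)

/-- The pullback of a form under the action of `a`. -/
def actPull (a : SU2) (α : DForm M F k) : DForm M F k := fun x =>
  (α.ev (a • x)).compContinuousLinearMap (actDeriv a x)

theorem iota_apply (ξ : su2) (α : DForm M F (k + 1)) (x : M) (v : Fin k → E6) :
    (iota ξ α).ev x v =
      α.ev x (Fin.cons (fundVec ξ x) v) := rfl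

theorem actPull_apply (a : SU2) (α : DForm M F k) (x : M) (v : Fin k → E6) :
    (actPull a α).ev x v =
      (α.ev (a • x)) (fun i => actDeriv a x (v i)) := rfl

variable (h : IsSmoothAction M)
include h

theorem pb_smul_eq (a : SU2) (α : DForm M F k) {u : P → M} {y : P}
    (hu : MDifferentiableAt 𝓘(ℝ, P) (𝓡 6) u y) :
    pb (fun z => a • u z) α y = pb u (actPull a α) y := by
  have h1 : mfderiv 𝓘(ℝ, P) (𝓡 6) (fun z => a • u z) y =
      (actDeriv a (u y)).comp (mfderiv 𝓘(ℝ, P) (𝓡 6) u y) :=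
    mfderiv_comp y (mdifferentiableAt_smul h a (u y)) hu
  unfold pb
  rw [h1]
  rfl

theorem contMDiffAt_flow (ξ : su2) {u : P → M} {y : P} (hu : ContMDiffAt 𝓘(ℝ, P) (𝓡 6) ∞ u y)
    (t : ℝ) : ContMDiffAt 𝓘(ℝ, ℝ × P) (𝓡 6) ∞
      (fun p : ℝ × P => expSU2 (p.1 • ξ) • u p.2) (t, y) := by
  refine h.contMDiffAt_smul ?_ ?_
  · exact ((contDiff_quatVec_expSU2 ξ).comp contDiff_fst).contMDiff.contMDiffAt
  · exact ContMDiffAt.comp (t, y) (g := u) (f := Prod.snd) hu contDiff_snd.contMDiff.contMDiffAt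

theorem mfderiv_flow_inr (ξ : su2) {u : P → M} {y : P} (hu : ContMDiffAt 𝓘(ℝ, P) (𝓡 6) ∞ u y)
    (t : ℝ) (v : P) :
    (mfderiv 𝓘(ℝ, ℝ × P) (𝓡 6) (fun p : ℝ × P => expSU2 (p.1 • ξ) • u p.2) (t, y) :
      (ℝ × P) →L[ℝ] E6) (0, v) =
    (mfderiv 𝓘(ℝ, P) (𝓡 6) (fun z => expSU2 (t • ξ) • u z) y : P →L[ℝ] E6) v := by
  have h1 : HasMFDerivAt 𝓘(ℝ, P) 𝓘(ℝ, ℝ × P) (fun z : P => (t, z)) y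
      (ContinuousLinearMap.inr ℝ ℝ P) := (hasFDerivAt_prodMk_right t y).hasMFDerivAt
  have h2 := mfderiv_comp y ((contMDiffAt_flow h ξ hu t).mdifferentiableAt (by simp))
    h1.mdifferentiableAt
  rw [h1.mfderiv] at h2
  exact (congrArg (fun L : P →L[ℝ] E6 => L v) h2).symm

theorem mfderiv_flow_inl (ξ : su2) {u : P → M} {y : P} (hu : ContMDiffAt 𝓘(ℝ, P) (𝓡 6) ∞ u y)
    (t : ℝ) :
    (mfderiv 𝓘(ℝ, ℝ × P) (𝓡 6) (fun p : ℝ × P => expSU2 (p.1 • ξ) • u p.2) (t, y) :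
      (ℝ × P) →L[ℝ] E6) (1, 0) = fundVec ξ (expSU2 (t • ξ) • u y) := by
  have h1 : HasMFDerivAt 𝓘(ℝ, ℝ) 𝓘(ℝ, ℝ × P) (fun s : ℝ => (s, y)) t
      (ContinuousLinearMap.inl ℝ ℝ P) := (hasFDerivAt_prodMk_left t y).hasMFDerivAt
  have h2 := mfderiv_comp t ((contMDiffAt_flow h ξ hu t).mdifferentiableAt (by simp))
    h1.mdifferentiableAt
  rw [h1.mfderiv] at h2
  have h3 := congrArg (fun L : ℝ →L[ℝ] E6 => L 1) h2
  exact h3.symm.trans (mfderiv_expSU2_smul h ξ (u y) t)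

theorem pb_flow_inr (ξ : su2) (α : DForm M F k) {u : P → M} {y : P}
    (hu : ContMDiffAt 𝓘(ℝ, P) (𝓡 6) ∞ u y) (t : ℝ) :
    (pb (fun p : ℝ × P => expSU2 (p.1 • ξ) • u p.2) α (t, y)).compContinuousLinearMap
      (ContinuousLinearMap.inr ℝ ℝ P) = pb (fun z => expSU2 (t • ξ) • u z) α y := by
  ext v
  have := fun i => mfderiv_flow_inr h ξ hu t (v i)
  exact congrArg (α.ev (expSU2 (t • ξ) • u y)) (funext this)

/-- The flow map (t, z) ↦ exp(tξ) u(z) sends ∂ₜ to K^ξ. Contraction on `M` therefore becomes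
contraction with the constant vector ∂ₜ on ℝ × P, which is the mechanism behind smoothness of ι and
Cartan's formula. -/
theorem pb_flow_iota (ξ : su2) (α : DForm M F (k + 1)) {u : P → M} {y : P}
    (hu : ContMDiffAt 𝓘(ℝ, P) (𝓡 6) ∞ u y) (t : ℝ) :
    ((pb (fun p : ℝ × P => expSU2 (p.1 • ξ) • u p.2) α (t, y)).curryLeft
      (1, 0)).compContinuousLinearMap (ContinuousLinearMap.inr ℝ ℝ P) =
      pb (fun z => expSU2 (t • ξ) • u z) (iota ξ α) y := by
  ext v
  have h1 := fun i => mfderiv_flow_inr h ξ hu t (v i)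
  have h2 := mfderiv_flow_inl h ξ hu t
  refine congrArg (α.ev (expSU2 (t • ξ) • u y)) (funext fun i => ?_)
  refine Fin.cases ?_ (fun j => ?_) i
  · exact h2
  · exact h1 j

variable [IsManifold (𝓡 6) ∞ M]

theorem contDiffAt_pb_flow (ξ : su2) {α : DForm M F k} (hα : α.IsSmooth) {x₀ : M} {y : E6}
    (hy : y ∈ (chartAt E6 x₀).target) (t : ℝ) :
    ContDiffAt ℝ ∞ (fun p : ℝ × E6 => (actPull (expSU2 (p.1 • ξ)) α).inChart x₀ p.2) (t, y) := by
  have h1 := hα.contDiffAt_pb (contMDiffAt_flow h ξ (contMDiffAt_chart_symm hy) t)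
  have h2 := h1.compAlternating (contDiffAt_const (c := ContinuousLinearMap.inr ℝ ℝ E6))
  refine h2.congr_of_eventuallyEq ?_
  have hev : ∀ᶠ p : ℝ × E6 in 𝓝 (t, y), p.2 ∈ (chartAt E6 x₀).target :=
    continuousAt_snd.eventually ((chartAt E6 x₀).open_target.mem_nhds hy)
  filter_upwards [hev] with p hp
  rw [pb_flow_inr h ξ α (contMDiffAt_chart_symm hp) p.1,
    pb_smul_eq h _ _ ((contMDiffAt_chart_symm hp).mdifferentiableAt (by simp))]
  rfl

theorem inChart_iota_eq (ξ : su2) (α : DForm M F (k + 1)) {x₀ : M} {y : E6}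
    (hy : y ∈ (chartAt E6 x₀).target) : (iota ξ α).inChart x₀ y =
      ((pb (fun p : ℝ × E6 => expSU2 (p.1 • ξ) • (chartAt E6 x₀).symm p.2) α (0, y)).curryLeft
      (1, 0)).compContinuousLinearMap (ContinuousLinearMap.inr ℝ ℝ E6) := by
  rw [pb_flow_iota h ξ α (contMDiffAt_chart_symm hy) 0]
  have : (fun z => expSU2 ((0 : ℝ) • ξ) • (chartAt E6 x₀).symm z) = (chartAt E6 x₀).symm := by
    funext z; rw [expSU2_zero_smul, one_smul]
  rw [this]
  rfl

theorem IsSmooth.iota (ξ : su2) {α : DForm M F (k + 1)} (hα : α.IsSmooth) :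
    (iota ξ α).IsSmooth := fun x₀ => by
  intro y hy
  have h1 := (hα.contDiffAt_pb (contMDiffAt_flow h ξ (contMDiffAt_chart_symm hy) 0)).comp y
    (contDiffAt_const.prodMk contDiffAt_id : ContDiffAt ℝ ∞ (fun z : E6 => ((0 : ℝ), z)) y)
  have h2 := (contDiff_curryLeft.contDiffAt (n := ∞)).comp y h1
  have h3 := (h2.clm_apply (contDiffAt_const (c := ((1 : ℝ), (0 : E6))))).compAlternating
    (contDiffAt_const (c := ContinuousLinearMap.inr ℝ ℝ E6))
  refine h3.contDiffWithinAt.congr (fun z hz => inChart_iota_eq h ξ α hz) (inChart_iota_eq h ξ α hy)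

theorem inChart_actPull (a : SU2) (α : DForm M F k) {x₀ : M} {y : E6}
    (hy : y ∈ (chartAt E6 x₀).target) : (actPull a α).inChart x₀ y =
      pb (fun z => a • (chartAt E6 x₀).symm z) α y := by
  rw [pb_smul_eq h _ _ ((contMDiffAt_chart_symm hy).mdifferentiableAt (by simp))]
  rfl

theorem IsSmooth.actPull (a : SU2) {α : DForm M F k} (hα : α.IsSmooth) :
    (actPull a α).IsSmooth := fun x₀ => by
  intro y hy
  have h1 := hα.contDiffAt_pb ((h.contMDiff_smul a).contMDiffAt.comp y (contMDiffAt_chart_symm hy))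
  exact h1.contDiffWithinAt.congr (fun z hz => inChart_actPull h a α hz) (inChart_actPull h a α hy)

theorem d_actPull (a : SU2) {α : DForm M F k} (hα : α.IsSmooth) :
    (DForm.actPull a α).d = DForm.actPull a α.d := by
  refine ext_inChart fun x₀ y hy => ?_
  have h1 : (DForm.actPull a α).inChart x₀ =ᶠ[𝓝 y]
      pb (fun z => a • (chartAt E6 x₀).symm z) α := by
    filter_upwards [(chartAt E6 x₀).open_target.mem_nhds hy] with z hz
      using inChart_actPull h a α hz
  rw [← (hα.actPull h a).extDeriv_inChart hy, h1.extDeriv_eq, inChart_actPull h a _ hy]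
  exact hα.extDeriv_pb ((h.contMDiff_smul a).contMDiffAt.comp y (contMDiffAt_chart_symm hy))

/-- Cartan's formula. -/
theorem hasDerivAt_actPull_inChart (ξ : su2) {α : DForm M F (k + 1)} (hα : α.IsSmooth) {x₀ : M}
    {y : E6} (hy : y ∈ (chartAt E6 x₀).target) (t : ℝ) (v : Fin (k + 1) → E6) :
    HasDerivAt (fun s : ℝ => (DForm.actPull (expSU2 (s • ξ)) α).inChart x₀ y v)
      ((DForm.actPull (expSU2 (t • ξ)) ((DForm.iota ξ α).d + DForm.iota ξ α.d)).inChart x₀ y v)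
      t := by
  set u := (chartAt E6 x₀).symm with hu_def
  have hu : ContMDiffAt 𝓘(ℝ, E6) (𝓡 6) ∞ u y := contMDiffAt_chart_symm hy
  set β : ℝ × E6 → (ℝ × E6) [⋀^Fin (k + 1)]→L[ℝ] F :=
    pb (fun p : ℝ × E6 => expSU2 (p.1 • ξ) • u p.2) α with hβ
  have hflow := contMDiffAt_flow h ξ hu t
  have hd : extDeriv β (t, y) = _ := hα.extDeriv_pb hflow
  have hdiff : DifferentiableAt ℝ β (t, y) := (hα.contDiffAt_pb hflow).differentiableAt (by simp)
  have hnear : ∀ᶠ z in 𝓝 y, z ∈ (chartAt E6 x₀).target :=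
    (chartAt E6 x₀).open_target.mem_nhds hy
  -- Evaluate the exterior derivative of the flow pullback on (∂ₜ, v). The summand of index 0 is the
  -- sought time derivative, and the remaining summands differentiate the contracted form in the
  -- directions of `v`.
  let w : Fin (k + 2) → ℝ × E6 := Fin.cons (1, 0) fun i => (0, v i)
  have hR : extDeriv β (t, y) w =
      (DForm.actPull (expSU2 (t • ξ)) (DForm.iota ξ α.d)).inChart x₀ y v := by
    rw [hd, inChart_actPull h _ _ hy, ← pb_flow_iota h ξ α.d hu t]
    rfl
  have hL := extDeriv_apply hdiff w
  rw [hR, Fin.sum_univ_succ] at hL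
  have happ : ∀ m : Fin (k + 1) → ℝ × E6, HasFDerivAt (fun p => β p m)
      (fderiv ℝ (fun p => β p m) (t, y)) (t, y) := fun m =>
    (hdiff.continuousAlternatingMap_apply_const m).hasFDerivAt
  have h0 : HasDerivAt (fun s : ℝ => (DForm.actPull (expSU2 (s • ξ)) α).inChart x₀ y v)
      (fderiv ℝ (fun p => β p fun i => (0, v i)) (t, y) (1, 0)) t := by
    have h1 := (happ fun i => (0, v i)).comp_hasDerivAt t
      ((hasFDerivAt_prodMk_left (𝕜 := ℝ) t y).hasDerivAt)
    refine h1.congr_of_eventuallyEq (Filter.Eventually.of_forall fun s => ?_)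
    beta_reduce
    rw [inChart_actPull h _ _ hy, ← pb_flow_inr h ξ α hu s]
    rfl
  have hj : ∀ j : Fin (k + 1),
      fderiv ℝ (fun p => β p (j.succ.removeNth w)) (t, y) (w j.succ) =
      fderiv ℝ (fun z => (DForm.actPull (expSU2 (t • ξ)) (DForm.iota ξ α)).inChart x₀ z
        (j.removeNth v)) y (v j) := by
    intro j
    have h1 := (happ (j.succ.removeNth w)).comp y (hasFDerivAt_prodMk_right (𝕜 := ℝ) t y)
    have h2 : (fun z => (DForm.actPull (expSU2 (t • ξ)) (DForm.iota ξ α)).inChart x₀ z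
        (j.removeNth v)) =ᶠ[𝓝 y] (fun p => β p (j.succ.removeNth w)) ∘ fun z => (t, z) := by
      filter_upwards [hnear] with z hz
      rw [inChart_actPull h _ _ hz, ← pb_flow_iota h ξ α (contMDiffAt_chart_symm hz) t]
      refine congrArg (β (t, z)) (funext fun i => ?_)
      refine Fin.cases ?_ (fun l => ?_) i
      · rfl
      · simp [Fin.removeNth, w]
    rw [h2.fderiv_eq, h1.fderiv]
    rfl
  have hι := (hα.iota h ξ).actPull h (expSU2 (t • ξ))
  have hdι := extDeriv_apply ((hι.contDiffAt_inChart hy).differentiableAt (by simp)) v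
  rw [hι.extDeriv_inChart hy, d_actPull h _ (hα.iota h ξ)] at hdι
  refine h0.congr_deriv ?_
  -- Placing ∂ₜ in front shifts every index by one, whence the minus sign in front of d(ι α).
  have hsum : ∑ j : Fin (k + 1), (-1 : ℤ) ^ (j.succ : ℕ) •
      fderiv ℝ (fun p => β p (j.succ.removeNth w)) (t, y) (w j.succ) =
      - (DForm.actPull (expSU2 (t • ξ)) (DForm.iota ξ α).d).inChart x₀ y v := by
    rw [hdι, ← Finset.sum_neg_distrib]
    refine Finset.sum_congr rfl fun j _ => ?_
    rw [hj j, Fin.val_succ, pow_succ]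
    simp
  rw [hsum] at hL
  change _ = (DForm.actPull (expSU2 (t • ξ)) (DForm.iota ξ α).d).inChart x₀ y v +
    (DForm.actPull (expSU2 (t • ξ)) (DForm.iota ξ α.d)).inChart x₀ y v
  rw [hL]
  have hw : Fin.removeNth 0 w = fun i => (0, v i) := by
    funext i; simp [Fin.removeNth, w]
  simp only [Fin.val_zero, pow_zero, one_smul, hw]
  have hw0 : w 0 = (1, 0) := rfl
  rw [hw0]
  abel

end

end DForm

/-- The Lie bracket of `𝔰𝔲(2)`. -/
def su2Bracket (ξ η : su2) : su2 := ⟨⁅ξ.1, η.1⁆, by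
  obtain ⟨h1, h2⟩ := ξ.2
  obtain ⟨h3, h4⟩ := η.2
  constructor
  · rw [Ring.lie_def, Matrix.conjTranspose_sub, Matrix.conjTranspose_mul, Matrix.conjTranspose_mul,
      h1, h3]
    simp
  · rw [Ring.lie_def, Matrix.trace_sub, Matrix.trace_mul_comm, sub_self]⟩

/-- The closed formula for exp makes the curve a quadratic expression in cos and sin. At 0 only the
mixed term contributes, with value ζξ - ξζ. -/
theorem hasDerivAt_adSU2_inv (ξ ζ : su2) :
    HasDerivAt (fun t : ℝ => su2Coord (adSU2 (expSU2 (t • ξ))⁻¹ ζ)) (-su2Coord (su2Bracket ξ ζ))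
      0 := by
  by_cases hξ : ξ = 0
  · subst hξ
    have h0 : su2Bracket 0 ζ = 0 := by
      ext1; exact (Ring.lie_def 0 ζ.1).trans (by simp)
    have h1 : (fun t : ℝ => su2Coord (adSU2 (expSU2 (t • (0 : su2)))⁻¹ ζ)) =
        fun _ => su2Coord ζ := by
      funext t
      rw [smul_zero, ← zero_smul ℝ (0 : su2), expSU2_zero_smul, inv_one, adSU2_one]
    rw [h0, h1]
    simpa using hasDerivAt_const (0 : ℝ) (su2Coord ζ)
  obtain ⟨r, hr, h⟩ := exists_su2_norm hξ
  -- A linear extension of `su2Coord` to all matrices, needed because the separate products in the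
  -- expansion need not lie in the Lie algebra.
  let m : Matrix (Fin 2) (Fin 2) ℂ →ₗ[ℝ] (Fin 3 → ℝ) :=
    { toFun := fun A => ![(A 0 0).im, (A 1 0).re, (A 1 0).im]
      map_add' := fun a b => by ext i; fin_cases i <;> simp
      map_smul' := fun c a => by ext i; fin_cases i <;> simp }
  have hm : ∀ A : su2, su2Coord A = m A.1 := fun A => rfl
  have hinv : ∀ t : ℝ, (expSU2 (t • ξ))⁻¹ = expSU2 ((-t) • ξ) := fun t => by
    rw [inv_eq_iff_mul_eq_one, ← expSU2_add_smul, add_neg_cancel, expSU2_zero_smul]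
  have hf : (fun t : ℝ => su2Coord (adSU2 (expSU2 (t • ξ))⁻¹ ζ)) = fun t =>
      (Real.cos (r * t) ^ 2) • m ζ.1 + (Real.cos (r * t) * (Real.sin (r * t) / r)) •
        m (ζ.1 * ξ.1 - ξ.1 * ζ.1) - ((Real.sin (r * t) / r) ^ 2) • m (ξ.1 * ζ.1 * ξ.1) := by
    funext t
    rw [hm, adSU2_coe, inv_inv, hinv, exp_su2_formula hr.ne' h, exp_su2_formula hr.ne' h,
      ← map_smul, ← map_smul, ← map_smul, ← map_add, ← map_sub]
    congr 1
    simp only [mul_neg, Real.cos_neg, Real.sin_neg, neg_div, add_mul, mul_add, smul_mul_assoc,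
      mul_smul_comm, one_mul, mul_one, smul_sub, neg_mul, neg_smul]
    module
  have hl : HasDerivAt (fun t : ℝ => r * t) r 0 := by simpa using (hasDerivAt_id (0:ℝ)).const_mul r
  rw [hf]
  have hc := hl.cos
  have hs := hl.sin.div_const r
  refine ((((hc.pow 2).smul_const (m ζ.1)).add ((hc.mul hs).smul_const _)).sub
    ((hs.pow 2).smul_const _)).congr_deriv ?_
  have hb : su2Coord (su2Bracket ξ ζ) = m (ξ.1 * ζ.1 - ζ.1 * ξ.1) := rfl
  rw [hb, ← map_neg, neg_sub]
  simp [hr.ne']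

theorem extDeriv_zeroForm_apply {E F : Type*} [NormedAddCommGroup E] [NormedSpace ℝ E]
    [NormedAddCommGroup F] [NormedSpace ℝ F] {β : E → E [⋀^Fin 0]→L[ℝ] F} {y : E}
    (hβ : DifferentiableAt ℝ β y) (w : E) :
    extDeriv β y ![w] = fderiv ℝ (fun z => β z ![]) y w := by
  rw [extDeriv_apply hβ, Fin.sum_univ_one, Fin.val_zero, pow_zero, one_smul]
  have h5 : Fin.removeNth 0 ![w] = ![] := Subsingleton.elim _ _
  rw [h5]
  rfl

namespace DForm

section

variable {M : Type*} [TopologicalSpace M] [ChartedSpace E6 M]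
  {F : Type*} [NormedAddCommGroup F] [NormedSpace ℝ F] {k : ℕ}

theorem ev_neg (α : DForm M F k) (x : M) : (-α).ev x = -α.ev x := rfl

theorem ext_ev {α β : DForm M F k} (h : ∀ x v, α.ev x v = β.ev x v) : α = β := by
  funext x
  exact ContinuousAlternatingMap.ext (h x)

/-- The function underlying a `0`-form. -/
def toFun (α : DForm M F 0) (x : M) : F := α.ev x ![]

theorem IsSmooth.eventually_toFun_eq (α : DForm M F 0) (x : M) :
    toFun α =ᶠ[𝓝 x] (fun y => α.inChart x y ![]) ∘ chartAt E6 x := by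
  filter_upwards [(chartAt E6 x).open_source.mem_nhds (mem_chart_source E6 x)] with z hz
  have h1 : ∀ z' w (_ : z' = z), α.ev z ![] = α.ev z' w := by
    rintro _ w rfl
    exact congrArg _ (Subsingleton.elim _ _)
  exact h1 _ _ ((chartAt E6 x).left_inv hz)

variable [IsManifold (𝓡 6) ∞ M]

theorem IsSmooth.contMDiff_toFun {α : DForm M F 0} (hα : α.IsSmooth) :
    ContMDiff (𝓡 6) 𝓘(ℝ, F) ∞ (toFun α) := fun x => by
  have h1 := hα.contDiffAt_inChart (mem_chart_target E6 x)
  have h2 : ContDiffAt ℝ ∞ (fun y => α.inChart x y ![]) (chartAt E6 x x) :=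
    (ContinuousAlternatingMap.apply ℝ E6 F ![]).contDiff.contDiffAt.comp _ h1
  have h3 : ContMDiffAt (𝓡 6) (𝓡 6) ∞ (chartAt E6 x) x :=
    contMDiffAt_of_mem_maximalAtlas (IsManifold.chart_mem_maximalAtlas x) (mem_chart_source E6 x)
  exact (h2.contMDiffAt.comp x h3).congr_of_eventuallyEq (IsSmooth.eventually_toFun_eq α x)

theorem IsSmooth.mfderiv_toFun {α : DForm M F 0} (hα : α.IsSmooth) (x : M) (v : E6) :
    (mfderiv (𝓡 6) 𝓘(ℝ, F) (toFun α) x : E6 →L[ℝ] F) v = α.d.ev x ![v] := by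
  have h1 := hα.differentiableAt x
  have h2 : DifferentiableAt ℝ (fun y => α.inChart x y ![]) (chartAt E6 x x) :=
    h1.continuousAlternatingMap_apply_const ![]
  have h3 : MDifferentiableAt (𝓡 6) (𝓡 6) (chartAt E6 x) x :=
    (mdifferentiable_chart (I := 𝓡 6) x).mdifferentiableAt (mem_chart_source E6 x)
  set w : E6 := (mfderiv (𝓡 6) (𝓡 6) (chartAt E6 x) x : E6 →L[ℝ] E6) v with hw
  have h4 : α.d.ev x ![v] = extDeriv (α.inChart x) (chartAt E6 x x) ![w] := by
    refine congrArg (extDeriv (α.inChart x) (chartAt E6 x x)) (funext fun i => ?_)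
    fin_cases i; rfl
  rw [h4, extDeriv_zeroForm_apply h1, ← mfderiv_eq_fderiv,
    (IsSmooth.eventually_toFun_eq α x).mfderiv_eq]
  exact mfderiv_comp_apply_of_base rfl h2.mdifferentiableAt h3 v

end

section

variable {M : Type*} [TopologicalSpace M] [ChartedSpace E6 M] [MulAction SU2 M]
  {F : Type*} [NormedAddCommGroup F] [NormedSpace ℝ F] {k : ℕ}

theorem iota_iota_self (ξ : su2) (α : DForm M F (k + 2)) : iota ξ (iota ξ α) = 0 := by
  refine ext_ev fun x v => ?_
  rw [iota_apply, iota_apply]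
  exact (α.ev x).map_eq_zero_of_eq _ (i := 0) (j := 1) (by simp) (by simp)

theorem iota_add (ξ : su2) (α β : DForm M F (k + 1)) :
    iota ξ (α + β) = iota ξ α + iota ξ β := rfl

theorem iota_neg (ξ : su2) (α : DForm M F (k + 1)) : iota ξ (-α) = -iota ξ α := rfl

theorem iota_zero (ξ : su2) : iota ξ (0 : DForm M F (k + 1)) = 0 := rfl

variable (h : IsSmoothAction M)
include h

theorem fundVec_eq_sum (ξ : su2) (x : M) : (fundVec ξ x) =
    ∑ i, su2Coord ξ i • (fundVec (su2Coord.symm (Pi.single i 1)) x : E6) := by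
  simp only [fundVec_eq h, LinearEquiv.apply_symm_apply]
  conv_lhs => rw [pi_eq_sum_univ' (su2Coord ξ)]
  rw [map_sum]
  refine Finset.sum_congr rfl fun i _ => ?_
  rw [map_smul]

theorem iota_neg_left (ξ : su2) (α : DForm M F (k + 1)) : iota (-ξ) α = -iota ξ α := by
  funext x
  have : (fundVec (-ξ) x) = -fundVec ξ x := by
    rw [fundVec_eq h, fundVec_eq h, map_neg, map_neg]
  refine ContinuousAlternatingMap.ext fun v => ?_
  change (α.ev x).curryLeft (fundVec (-ξ) x) v = _
  rw [this, map_neg]; rfl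

theorem actPull_iota (a : SU2) (ζ : su2) (α : DForm M F (k + 1)) :
    actPull a (iota ζ α) = iota (adSU2 a⁻¹ ζ) (actPull a α) := by
  refine ext_ev fun x v => ?_
  rw [actPull_apply, iota_apply, iota_apply, actPull_apply]
  refine congrArg (α.ev (a • x)) (funext fun i => ?_)
  refine Fin.cases ?_ (fun j => ?_) i
  · simp only [Fin.cons_zero]
    rw [← fundVec_adSU2 h, ← adSU2_mul, mul_inv_cancel, adSU2_one]
  · rfl

variable [IsManifold (𝓡 6) ∞ M]

/-- At a fixed chart point the contraction is a linear combination of three evaluations, with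
coefficients linear in ζ and vectors independent of ζ and α. This reduces the Leibniz rule for the
Lie derivative to the product rule for finite sums. -/
theorem iota_inChart_sum {x₀ : M} {y : E6}
    (hy : y ∈ (chartAt E6 x₀).target) : ∃ w : Fin 3 → E6, ∀ (α : DForm M F (k + 1)) (ζ : su2)
      (v : Fin k → E6), (iota ζ α).inChart x₀ y v =
        ∑ i, su2Coord ζ i • α.inChart x₀ y (Fin.cons (w i) v) := by
  choose w hw using fun i : Fin 3 => mfderiv_chart_symm_surjective hy
    (fundVec (su2Coord.symm (Pi.single i 1)) ((chartAt E6 x₀).symm y) : E6)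
  refine ⟨w, fun α ζ v => ?_⟩
  let D : E6 →L[ℝ] E6 := mfderiv (𝓡 6) (𝓡 6) (chartAt E6 x₀).symm y
  have h1 : (iota ζ α).inChart x₀ y v = (α.ev ((chartAt E6 x₀).symm y)).curryLeft
    (fundVec ζ ((chartAt E6 x₀).symm y) : E6) (fun i => D (v i)) := rfl
  rw [h1, fundVec_eq_sum h, map_sum, ContinuousAlternatingMap.sum_apply]
  refine Finset.sum_congr rfl fun i _ => ?_
  rw [map_smul, ContinuousAlternatingMap.smul_apply]
  congr 1
  refine congrArg (α.ev ((chartAt E6 x₀).symm y)) (funext fun j => ?_)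
  refine Fin.cases ?_ (fun j => ?_) j
  · exact (hw i).symm
  · rfl

/-- `γ` is the Lie derivative of `α` in the direction of the fundamental vector field of `ξ`. -/
def HasLieDeriv (ξ : su2) (α γ : DForm M F k) : Prop :=
  ∀ x₀ : M, ∀ y ∈ (chartAt E6 x₀).target, ∀ v : Fin k → E6,
    HasDerivAt (fun t : ℝ => (actPull (expSU2 (t • ξ)) α).inChart x₀ y v) (γ.inChart x₀ y v) 0

omit h [IsManifold (𝓡 6) ∞ M] in
theorem hasLieDeriv_of_invariant {α : DForm M F k} (hα : ∀ a : SU2, actPull a α = α) (ξ : su2) :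
    HasLieDeriv ξ α 0 := fun x₀ y _ v => by
  simp only [hα]
  exact hasDerivAt_const _ _

omit h [IsManifold (𝓡 6) ∞ M] in
theorem actPull_one (α : DForm M F k) : actPull 1 α = α := by
  refine ext_ev fun x v => ?_
  rw [actPull_apply]
  have h1 : ∀ (z : M) (_ : z = x) (w : Fin k → E6), w = v → α.ev z w = α.ev x v := by
    rintro z rfl w rfl; rfl
  exact h1 _ (one_smul _ x) _ (funext fun i => actDeriv_one x (v i))

/-- Pulling ι_ζ α back by exp(tξ) gives the contraction with Ad of exp(-tξ) applied to ζ. Its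
derivative is -[ξ, ζ]; the sign reflects that fundamental fields of a left action form an
anti-homomorphism. -/
theorem HasLieDeriv.iota {ξ : su2} {α γ : DForm M F (k + 1)} (hα : HasLieDeriv ξ α γ) (ζ : su2) :
    HasLieDeriv ξ (iota ζ α) (DForm.iota ζ γ - DForm.iota (su2Bracket ξ ζ) α) := fun x₀ y hy v => by
  obtain ⟨w, hw⟩ := iota_inChart_sum (F := F) (k := k) h hy
  have h1 : (fun t : ℝ => (actPull (expSU2 (t • ξ)) (DForm.iota ζ α)).inChart x₀ y v) =
      fun t => ∑ i, su2Coord (adSU2 (expSU2 (t • ξ))⁻¹ ζ) i •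
        (actPull (expSU2 (t • ξ)) α).inChart x₀ y (Fin.cons (w i) v) := by
    funext t
    rw [actPull_iota h, hw]
  rw [h1]
  have h2 : (DForm.iota ζ γ - DForm.iota (su2Bracket ξ ζ) α).inChart x₀ y v =
    (DForm.iota ζ γ).inChart x₀ y v - (DForm.iota (su2Bracket ξ ζ) α).inChart x₀ y v := rfl
  rw [h2, hw, hw, ← Finset.sum_sub_distrib]
  refine HasDerivAt.fun_sum fun i _ => ?_
  have h3 := (hasDerivAt_pi.1 (hasDerivAt_adSU2_inv ξ ζ) i).smul (hα x₀ y hy (Fin.cons (w i) v))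
  refine h3.congr_deriv ?_
  rw [expSU2_zero_smul, inv_one, adSU2_one, actPull_one, Pi.neg_apply, neg_smul, sub_eq_add_neg]

theorem HasLieDeriv.eq_cartan {ξ : su2} {α γ : DForm M F (k + 1)} (hα : α.IsSmooth)
    (hγ : HasLieDeriv ξ α γ) : γ = (DForm.iota ξ α).d + DForm.iota ξ α.d := by
  refine ext_inChart fun x₀ y hy => ContinuousAlternatingMap.ext fun v => ?_
  have h1 := hasDerivAt_actPull_inChart h ξ hα hy 0 v
  rw [expSU2_zero_smul, actPull_one] at h1
  exact (hγ x₀ y hy v).unique h1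

theorem HasLieDeriv.eq_iota_d {ξ : su2} {α γ : DForm M F 0} (hα : α.IsSmooth)
    (hγ : HasLieDeriv ξ α γ) : γ = DForm.iota ξ α.d := by
  refine ext_inChart fun x₀ y hy => ContinuousAlternatingMap.ext fun v => ?_
  have hu : ContMDiffAt 𝓘(ℝ, E6) (𝓡 6) ∞ (chartAt E6 x₀).symm y := contMDiffAt_chart_symm hy
  have hflow := contMDiffAt_flow h ξ hu 0
  have hd := hα.extDeriv_pb hflow
  have hdiff := (hα.contDiffAt_pb hflow).differentiableAt (by simp)
  refine (hγ x₀ y hy v).unique ?_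
  have h1 := (hdiff.continuousAlternatingMap_apply_const ![]).hasFDerivAt.comp_hasDerivAt (0 : ℝ)
      ((hasFDerivAt_prodMk_left (𝕜 := ℝ) 0 y).hasDerivAt)
  have h2 := extDeriv_zeroForm_apply hdiff ((1 : ℝ), (0 : E6))
  rw [hd] at h2
  refine (h1.congr_of_eventuallyEq (Filter.Eventually.of_forall fun s => ?_)).congr_deriv ?_
  · beta_reduce
    rw [inChart_actPull h _ _ hy, ← pb_flow_inr h ξ α hu s]
    exact congrArg (pb (fun p : ℝ × E6 => expSU2 (p.1 • ξ) • (chartAt E6 x₀).symm p.2) α (s, y))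
      (Subsingleton.elim _ _)
  · rw [inChart_iota_eq h ξ _ hy]
    refine Eq.trans h2.symm ?_
    refine congrArg (pb (fun p : ℝ × E6 => expSU2 (p.1 • ξ) • (chartAt E6 x₀).symm p.2) α.d (0, y))
      (funext fun i => ?_)
    fin_cases i; rfl

end

end DForm

/-! ### Invariant forms -/

namespace DForm

section

variable {M : Type*} [TopologicalSpace M] [ChartedSpace E6 M] [MulAction SU2 M]
  [IsManifold (𝓡 6) ∞ M] {F : Type*} [NormedAddCommGroup F] [NormedSpace ℝ F] {k : ℕ}
  (h : IsSmoothAction M)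
include h

theorem d_iota_of_invariant {β : DForm M F (k + 1)} (hβ : β.IsSmooth)
    (hinv : ∀ a : SU2, actPull a β = β) (ξ : su2) : (iota ξ β).d = -iota ξ β.d :=
  eq_neg_of_add_eq_zero_left (HasLieDeriv.eq_cartan h hβ (hasLieDeriv_of_invariant hinv ξ)).symm

theorem hasLieDeriv_iota_of_invariant {β : DForm M F (k + 1)}
    (hinv : ∀ a : SU2, actPull a β = β) (ξ ζ : su2) :
    HasLieDeriv ξ (iota ζ β) (-iota (su2Bracket ξ ζ) β) := by
  have := HasLieDeriv.iota h (hasLieDeriv_of_invariant hinv ξ) ζ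
  rwa [iota_zero, zero_sub] at this

/-- Cartan's formula for ι_ζ β, whose Lie derivative is -ι_[ξ,ζ] β and whose differential is -ι_ζ
dβ. -/
theorem d_iota_iota_of_invariant {β : DForm M F (k + 2)} (hβ : β.IsSmooth)
    (hinv : ∀ a : SU2, actPull a β = β) (ξ ζ : su2) :
    (iota ξ (iota ζ β)).d = -iota (su2Bracket ξ ζ) β + iota ξ (iota ζ β.d) := by
  have h1 := HasLieDeriv.eq_cartan h (hβ.iota h ζ) (hasLieDeriv_iota_of_invariant h hinv ξ ζ)
  rw [d_iota_of_invariant h hβ hinv, iota_neg] at h1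
  rw [h1, neg_add_cancel_right]

variable {ξ : Module.Basis (Fin 3) ℝ su2} (hξ : IsStandardBasis ξ)
include hξ

omit h in
theorem su2Bracket_standard : su2Bracket (ξ 1) (ξ 0) = ξ 2 ∧ su2Bracket (ξ 2) (ξ 0) = -ξ 1 ∧
    su2Bracket (ξ 2) (ξ 1) = ξ 0 := by
  have h0 : ⁅(ξ 0).1, (ξ 1).1⁆ = -(ξ 2).1 := hξ 0
  have h1 : ⁅(ξ 1).1, (ξ 2).1⁆ = -(ξ 0).1 := hξ 1
  have h2 : ⁅(ξ 2).1, (ξ 0).1⁆ = -(ξ 1).1 := hξ 2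
  refine ⟨Subtype.ext ?_, Subtype.ext h2, Subtype.ext ?_⟩
  · change ⁅(ξ 1).1, (ξ 0).1⁆ = _
    rw [Ring.lie_def] at h0 ⊢
    rw [← neg_sub, h0, neg_neg]
  · change ⁅(ξ 2).1, (ξ 1).1⁆ = _
    rw [Ring.lie_def] at h1 ⊢
    rw [← neg_sub, h1, neg_neg]

/-- The brackets [ξ₂,ξ₀] = -ξ₁ and [ξ₂,ξ₁] = ξ₀ make each correction term contract twice with the
same field. -/
theorem hasLieDeriv_iota_iota_standard {β : DForm M F (k + 2)}
    (hinv : ∀ a : SU2, actPull a β = β) :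
    HasLieDeriv (ξ 2) (iota (ξ 1) (iota (ξ 0) β)) 0 := by
  obtain ⟨-, h20, h21⟩ := su2Bracket_standard hξ
  have h1 := HasLieDeriv.iota h (hasLieDeriv_iota_of_invariant h hinv (ξ 2) (ξ 0)) (ξ 1)
  rw [h20, h21, iota_neg_left h, neg_neg, iota_iota_self, iota_iota_self, sub_zero] at h1
  exact h1

/-- The function ι₁ι₀β is constant along K₂, and the correction in its differential is a contraction
with [ξ₁,ξ₀] = ξ₂, killed by another ι₂. Applied to ω this gives Re ψ(K₀,K₁,K₂) = 0. -/
theorem iota_three_d_eq_zero {β : DForm M F 2} (hβ : β.IsSmooth)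
    (hinv : ∀ a : SU2, actPull a β = β) :
    iota (ξ 2) (iota (ξ 1) (iota (ξ 0) β.d)) = 0 := by
  have h1 := HasLieDeriv.eq_iota_d h ((hβ.iota h (ξ 0)).iota h (ξ 1))
    (hasLieDeriv_iota_iota_standard h hξ hinv)
  rw [d_iota_iota_of_invariant h hβ hinv, (su2Bracket_standard hξ).1, iota_add, iota_neg,
    iota_iota_self, neg_zero, zero_add] at h1
  exact h1.symm

/-- The same cancellation in positive degree, through Cartan's formula. Applied to Im ψ it computes
dν. -/
theorem d_iota_three {β : DForm M F (k + 3)} (hβ : β.IsSmooth)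
    (hinv : ∀ a : SU2, actPull a β = β) :
    (iota (ξ 2) (iota (ξ 1) (iota (ξ 0) β))).d =
      -iota (ξ 2) (iota (ξ 1) (iota (ξ 0) β.d)) := by
  have h1 := HasLieDeriv.eq_cartan h ((hβ.iota h (ξ 0)).iota h (ξ 1))
    (hasLieDeriv_iota_iota_standard h hξ hinv)
  rw [d_iota_iota_of_invariant h hβ hinv, (su2Bracket_standard hξ).1, iota_add, iota_neg,
    iota_iota_self, neg_zero, zero_add] at h1
  exact eq_neg_of_add_eq_zero_left h1.symm

end

end DForm

/-! ### The functions `μ` and `ν` -/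

namespace NearlyKahler

variable {M : Type*} [TopologicalSpace M] [ChartedSpace E6 M] [IsManifold (𝓡 6) ∞ M]
  (S : NearlyKahler M)

/-- The almost complex structure, on the model space of the tangent space. -/
def jMap (x : M) : E6 →L[ℝ] E6 := S.J x

/-- In a unitary frame ω(u,v) = Re⟨iu,v⟩ = Im⟨u,v⟩ for the Hermitian form conjugate-linear in the
first argument. -/
theorem exists_frame (x : M) : ∃ e : E6 ≃ₗ[ℝ] (Fin 3 → ℂ),
    (∀ u v : E6, S.omega.ev x ![u, v] = (∑ i, (starRingEnd ℂ) (e u i) * e v i).im) ∧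
    (∀ u, e (S.jMap x u) = Complex.I • e u) ∧
    (∀ v : Fin 3 → E6, S.psi.ev x v = Matrix.det (Matrix.of fun i j => e (v i) j)) := by
  obtain ⟨e, hg, hJ, hψ⟩ := S.su3 x
  refine ⟨e, fun u v => ?_, hJ, hψ⟩
  have h1 : S.omega.ev x ![u, v] =
      (∑ i, (starRingEnd ℂ) (e (S.J x u) i) * e v i).re := (S.omega_eq x u v).trans (hg _ _)
  refine h1.trans ?_
  have h2 : ∀ i, e (S.J x u) i = Complex.I * e u i := fun i => congrFun (hJ u) i
  have h3 : ∀ a b : ℂ, ((starRingEnd ℂ) (Complex.I * a) * b).re = ((starRingEnd ℂ) a * b).im := by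
    intro a b; simp; ring
  rw [Complex.re_sum, Complex.im_sum]
  exact Finset.sum_congr rfl fun i _ =>
    (congrArg (fun z => ((starRingEnd ℂ) z * e v i).re) (h2 i)).trans (h3 _ _)

/-- The form `Im ψ`. -/
def imPsi : DForm M ℝ 3 := fun y => Complex.imCLM.compContinuousAlternatingMap (S.psi y)

theorem smooth_imPsi : S.imPsi.IsSmooth := fun x₀ => by
  have h1 := S.smooth_psi x₀
  exact (ContinuousLinearMap.compContinuousAlternatingMapCLM ℝ E6 ℂ ℝ
    (Fin 3) Complex.imCLM).contDiff.comp_contDiffOn h1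

theorem omega_sum_left {ι : Type*} [Fintype ι] (x : M) (c : ι → ℝ) (v : ι → E6) (w : E6) :
    S.omega.ev x ![∑ i, c i • v i, w] = ∑ i, c i * S.omega.ev x ![v i, w] := by
  have h2 : (S.omega.ev x).curryLeft (∑ i, c i • v i) ![w] =
      (∑ i, c i • (S.omega.ev x).curryLeft (v i)) ![w] := by
    rw [map_sum]; simp only [map_smul]
  refine h2.trans ?_
  rw [ContinuousAlternatingMap.sum_apply]
  rfl

theorem omega_self (x : M) (u : E6) : S.omega.ev x ![u, u] = 0 :=
  (S.omega.ev x).map_eq_zero_of_eq _ (i := 0) (j := 1) rfl (by simp)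

theorem omega_swap (x : M) (u w : E6) : S.omega.ev x ![u, w] = -S.omega.ev x ![w, u] := by
  have := (S.omega.ev x).toAlternatingMap.map_swap ![w, u] (i := 0) (j := 1) (by simp)
  refine Eq.trans (congrArg (S.omega.ev x) ?_) this
  ext i; fin_cases i <;> rfl

/-- Vectors that are independent and isotropic are independent over `ℂ`. -/
theorem eq_zero_of_isotropic {ι : Type*} [Fintype ι] {x : M} {e : E6 ≃ₗ[ℝ] (Fin 3 → ℂ)}
    (hω : ∀ u v : E6, S.omega.ev x ![u, v] = (∑ i, (starRingEnd ℂ) (e u i) * e v i).im)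
    {v : ι → E6} (hv : LinearIndependent ℝ v) (hiso : ∀ i j, S.omega.ev x ![v i, v j] = 0)
    {c : ι → ℂ} (hc' : ∀ j, ∑ i, c i * e (v i) j = 0) : c = 0 := by
  -- Separating real and imaginary parts of the coefficients turns the relation into p = -iq with p,
  -- q in the isotropic real span. Then 0 = ω(p,q) = |q|², so both vanish and real independence
  -- finishes.
  set p : E6 := ∑ i, (c i).re • v i with hp
  set q : E6 := ∑ i, (c i).im • v i with hq
  have hpq : ∀ j, e p j = -Complex.I * e q j := fun j => by
    have h1 := hc' j
    rw [hp, hq, map_sum, map_sum, Finset.sum_apply, Finset.sum_apply]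
    simp only [map_smul, Pi.smul_apply, Complex.real_smul]
    rw [Finset.mul_sum, ← sub_eq_zero, ← Finset.sum_sub_distrib, ← h1]
    refine Finset.sum_congr rfl fun i _ => ?_
    conv_rhs => rw [← Complex.re_add_im (c i)]
    ring
  have hz : S.omega.ev x ![p, q] = 0 := by
    rw [hp, omega_sum_left]
    refine Finset.sum_eq_zero fun i _ => ?_
    rw [omega_swap, hq, omega_sum_left]
    simp [hiso]
  have hn : ∑ j, Complex.normSq (e q j) = 0 := by
    rw [hω] at hz
    rw [← hz, Complex.im_sum]
    refine Finset.sum_congr rfl fun j _ => ?_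
    rw [hpq, Complex.normSq_apply]
    simp
    ring
  have hq0 : q = 0 := by
    apply e.injective
    rw [map_zero]
    funext j
    have := (Finset.sum_eq_zero_iff_of_nonneg fun j _ => Complex.normSq_nonneg _).1 hn j
      (Finset.mem_univ j)
    exact Complex.normSq_eq_zero.1 this
  have hp0 : p = 0 := by
    apply e.injective
    rw [map_zero]
    funext j
    rw [hpq, hq0, map_zero]; simp
  have h1 := Fintype.linearIndependent_iff.1 hv _ hp0
  have h2 := Fintype.linearIndependent_iff.1 hv _ hq0
  exact funext fun i => Complex.ext (h1 i) (h2 i)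

/-- An isotropic independent triple has nonzero complex volume. -/
theorem psi_ne_zero_of_isotropic {x : M} {v : Fin 3 → E6} (hv : LinearIndependent ℝ v)
    (hiso : ∀ i j, S.omega.ev x ![v i, v j] = 0) : S.psi.ev x v ≠ 0 := by
  obtain ⟨e, hω, -, hψ⟩ := S.exists_frame x
  intro h0
  rw [hψ] at h0
  obtain ⟨c, hc0, hc⟩ := Matrix.exists_vecMul_eq_zero_iff.2 h0
  exact hc0 (S.eq_zero_of_isotropic hω hv hiso fun j => congrFun hc j)

/-- Test against v = Ju, for which ω(u, Ju) = |u|². -/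
theorem omega_nondegenerate {x : M} {u : E6} (hu : ∀ v, S.omega.ev x ![u, v] = 0) : u = 0 := by
  obtain ⟨e, hω, -, -⟩ := S.exists_frame x
  have h1 := hu (e.symm (Complex.I • e u))
  rw [hω, LinearEquiv.apply_symm_apply, Complex.im_sum] at h1
  have h2 : ∀ j, ((starRingEnd ℂ) (e u j) * (Complex.I • e u) j).im = Complex.normSq (e u j) := by
    intro j
    rw [Complex.normSq_apply]
    simp
  simp only [h2] at h1
  apply e.injective
  rw [map_zero]
  funext j
  exact Complex.normSq_eq_zero.1 ((Finset.sum_eq_zero_iff_of_nonneg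
    fun j _ => Complex.normSq_nonneg _).1 h1 j (Finset.mem_univ j))

theorem linearIndependent_of_psi_ne_zero {x : M} {v : Fin 3 → E6} (hv : S.psi.ev x v ≠ 0) :
    LinearIndependent ℝ v := by
  by_contra hcon
  exact hv ((S.psi.ev x).toAlternatingMap.map_linearDependent v hcon)

variable [MulAction SU2 M] {S} (hact : S.IsAutomorphicAction)
include hact

open DForm in
theorem actPull_omega (a : SU2) : actPull a S.omega = S.omega := by
  refine ext_ev fun x v => ?_
  obtain ⟨u, w, rfl⟩ : ∃ u w : E6, v = ![u, w] := ⟨v 0, v 1, by ext i; fin_cases i <;> rfl⟩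
  rw [actPull_apply]
  have h1 : (fun i => actDeriv a x (![u, w] i)) = ![actDeriv a x u, actDeriv a x w] := by
    ext i; fin_cases i <;> rfl
  rw [h1]
  refine (S.omega_eq (a • x) (actDeriv a x u) (actDeriv a x w)).trans ?_
  refine Eq.trans ?_ (S.omega_eq x u w).symm
  refine Eq.trans ?_ (hact.map_g a x (S.J x u) w)
  exact congrArg (fun z => S.g.inner (a • x) z (actDeriv a x w)) (hact.map_J a x u)

open DForm in
theorem actPull_psi (a : SU2) : actPull a S.psi = S.psi :=
  ext_ev fun x v => hact.map_psi a x v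

open DForm in
theorem actPull_imPsi (a : SU2) : actPull a S.imPsi = S.imPsi :=
  ext_ev fun x v => congrArg Complex.im (hact.map_psi a x v)

variable {ξ : Module.Basis (Fin 3) ℝ su2}

omit hact in
theorem nu_eq (x : M) : S.nu ξ x =
    (S.psi.ev x ![fundVec (ξ 0) x, fundVec (ξ 1) x, fundVec (ξ 2) x]).im := rfl

omit hact in
theorem cons_three {α : Type*} (a b c : α) (v : Fin 0 → α) :
    (Fin.cons a (Fin.cons b (Fin.cons c v)) : Fin 3 → α) = ![a, b, c] := by
  ext i; fin_cases i <;> rfl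

omit hact in
theorem nu_eq_toFun : S.nu ξ =
    (DForm.iota (ξ 2) (DForm.iota (ξ 1) (DForm.iota (ξ 0) S.imPsi))).toFun := by
  funext x
  rw [DForm.toFun, DForm.iota_apply, DForm.iota_apply, DForm.iota_apply, cons_three]
  rfl

theorem smooth_iota_imPsi :
    (DForm.iota (ξ 2) (DForm.iota (ξ 1) (DForm.iota (ξ 0) S.imPsi))).IsSmooth :=
  ((S.smooth_imPsi.iota hact.smooth _).iota hact.smooth _).iota hact.smooth _

theorem contMDiff_nu : ContMDiff (𝓡 6) 𝓘(ℝ, ℝ) ∞ (S.nu ξ) := by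
  rw [nu_eq_toFun]
  exact DForm.IsSmooth.contMDiff_toFun (smooth_iota_imPsi hact)

variable (hξ : IsStandardBasis ξ)
include hξ

theorem re_psi_fundVec (x : M) :
    (S.psi.ev x ![fundVec (ξ 0) x, fundVec (ξ 1) x, fundVec (ξ 2) x]).re = 0 := by
  have h1 := DForm.iota_three_d_eq_zero hact.smooth hξ S.smooth_omega (actPull_omega hact)
  have h2 : (DForm.iota (ξ 2) (DForm.iota (ξ 1) (DForm.iota (ξ 0) S.omega.d))).ev x ![] = 0 := by
    rw [h1]; rfl
  rw [DForm.iota_apply, DForm.iota_apply, DForm.iota_apply, cons_three] at h2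
  have h3 := (S.d_omega x ![fundVec (ξ 0) x, fundVec (ξ 1) x, fundVec (ξ 2) x]).symm.trans h2
  exact (mul_eq_zero.1 h3).resolve_left (by norm_num)

/-- The minus sign of `d_iota_three` meets d Im ψ = -2 ω∧ω, and ω∧ω on four vectors carries another
factor 2, which gives the constant 4. -/
theorem mfderiv_nu (x : M) (v : E6) :
    (mfderiv (𝓡 6) 𝓘(ℝ, ℝ) (S.nu ξ) x : E6 →L[ℝ] ℝ) v =
      4 * ∑ i, S.mu ξ x i * S.omega.ev x ![fundVec (ξ i) x, v] := by
  rw [nu_eq_toFun, DForm.IsSmooth.mfderiv_toFun (smooth_iota_imPsi hact),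
    DForm.d_iota_three hact.smooth hξ S.smooth_imPsi (actPull_imPsi hact), DForm.ev_neg,
    ContinuousAlternatingMap.neg_apply, DForm.iota_apply, DForm.iota_apply, DForm.iota_apply]
  have h1 := S.d_im_psi x (Fin.cons (fundVec (ξ 0) x) (Fin.cons (fundVec (ξ 1) x)
    (Fin.cons (fundVec (ξ 2) x) ![v])) : Fin 4 → E6)
  refine (congrArg Neg.neg h1).trans ?_
  have h3 : wedgeSq (S.omega x) (Fin.cons (fundVec (ξ 0) x) (Fin.cons (fundVec (ξ 1) x)
      (Fin.cons (fundVec (ξ 2) x) ![v])) : Fin 4 → E6) =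
      2 * (S.omega.ev x ![fundVec (ξ 0) x, fundVec (ξ 1) x] * S.omega.ev x ![fundVec (ξ 2) x, v]
      - S.omega.ev x ![fundVec (ξ 0) x, fundVec (ξ 2) x] * S.omega.ev x ![fundVec (ξ 1) x, v]
      + S.omega.ev x ![fundVec (ξ 0) x, v] * S.omega.ev x ![fundVec (ξ 1) x, fundVec (ξ 2) x]) :=
    rfl
  have h4 : ∑ i, S.mu ξ x i * S.omega.ev x ![fundVec (ξ i) x, v] =
      S.omega.ev x ![fundVec (ξ 1) x, fundVec (ξ 2) x] * S.omega.ev x ![fundVec (ξ 0) x, v] +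
      S.omega.ev x ![fundVec (ξ 2) x, fundVec (ξ 0) x] * S.omega.ev x ![fundVec (ξ 1) x, v] +
      S.omega.ev x ![fundVec (ξ 0) x, fundVec (ξ 1) x] * S.omega.ev x ![fundVec (ξ 2) x, v] :=
    Fin.sum_univ_three _
  rw [h3, h4, S.omega_swap x (fundVec (ξ 0) x) (fundVec (ξ 2) x)]
  generalize S.omega.ev x ![fundVec (ξ 1) x, fundVec (ξ 2) x] = a
  generalize S.omega.ev x ![fundVec (ξ 2) x, fundVec (ξ 0) x] = b
  generalize S.omega.ev x ![fundVec (ξ 0) x, fundVec (ξ 1) x] = c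
  generalize S.omega.ev x ![fundVec (ξ 0) x, v] = a'
  generalize S.omega.ev x ![fundVec (ξ 1) x, v] = b'
  generalize S.omega.ev x ![fundVec (ξ 2) x, v] = c'
  change -(-2 * (2 * (c * c' - -b * b' + a' * a))) = 4 * (a * a' + b * b' + c * c')
  ring

theorem nu_eq_zero_iff (x : M) : S.nu ξ x = 0 ↔
    S.psi.ev x ![fundVec (ξ 0) x, fundVec (ξ 1) x, fundVec (ξ 2) x] = 0 := by
  rw [nu_eq, Complex.ext_iff]
  simp [re_psi_fundVec hact hξ x]

omit hξ hact [IsManifold (𝓡 6) ∞ M] in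
theorem ofFn_fundVec (x : M) :
    (fun i => fundVec (ξ i) x) = ![fundVec (ξ 0) x, fundVec (ξ 1) x, fundVec (ξ 2) x] := by
  ext i : 1; fin_cases i <;> rfl

theorem linearIndependent_of_nu_ne_zero {x : M} (hx : S.nu ξ x ≠ 0) :
    LinearIndependent ℝ fun i => fundVec (ξ i) x := by
  rw [ofFn_fundVec]
  exact S.linearIndependent_of_psi_ne_zero fun h0 => hx ((nu_eq_zero_iff hact hξ x).2 h0)

omit hξ hact in
theorem omega_basis_eq_zero {x : M} (hμ : S.mu ξ x = 0) (i j : Fin 3) :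
    S.omega.ev x ![fundVec (ξ i) x, fundVec (ξ j) x] = 0 := by
  have h0 : S.omega.ev x ![fundVec (ξ 1) x, fundVec (ξ 2) x] = 0 := congrFun hμ 0
  have h1 : S.omega.ev x ![fundVec (ξ 2) x, fundVec (ξ 0) x] = 0 := congrFun hμ 1
  have h2 : S.omega.ev x ![fundVec (ξ 0) x, fundVec (ξ 1) x] = 0 := congrFun hμ 2
  fin_cases i <;> fin_cases j
  · exact S.omega_self _ _
  · exact h2
  · exact (S.omega_swap _ _ _).trans (neg_eq_zero.2 h1)
  · exact (S.omega_swap _ _ _).trans (neg_eq_zero.2 h2)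
  · exact S.omega_self _ _
  · exact h0
  · exact h1
  · exact (S.omega_swap _ _ _).trans (neg_eq_zero.2 h0)
  · exact S.omega_self _ _

theorem nu_ne_zero_of_isotropic {x : M} (hx : LinearIndependent ℝ fun i => fundVec (ξ i) x)
    (hμ : S.mu ξ x = 0) : S.nu ξ x ≠ 0 := by
  intro h0
  rw [nu_eq_zero_iff hact hξ, ← ofFn_fundVec] at h0
  exact S.psi_ne_zero_of_isotropic hx (omega_basis_eq_zero hμ) h0

/-- By the formula for dν the vector ∑ μᵢKᵢ is ω-orthogonal to everything, hence zero. -/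
theorem mu_eq_zero_of_mfderiv_nu {x : M} (hx : LinearIndependent ℝ fun i => fundVec (ξ i) x)
    (hν : mfderiv (𝓡 6) 𝓘(ℝ, ℝ) (S.nu ξ) x = 0) : S.mu ξ x = 0 := by
  have h1 : ∑ i, S.mu ξ x i • fundVec (ξ i) x = 0 := by
    refine S.omega_nondegenerate (x := x) fun v => ?_
    have h2 := mfderiv_nu hact hξ x v
    rw [hν] at h2
    have h5 : (0 : ℝ) = 4 * ∑ i, S.mu ξ x i * S.omega.ev x ![fundVec (ξ i) x, v] := h2
    rw [omega_sum_left]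
    exact (mul_eq_zero.1 h5.symm).resolve_left (by norm_num)
  exact funext (Fintype.linearIndependent_iff.1 hx _ h1)

theorem mfderiv_nu_eq_zero_iff {x : M} (hx : S.nu ξ x ≠ 0) :
    mfderiv (𝓡 6) 𝓘(ℝ, ℝ) (S.nu ξ) x = 0 ↔ S.mu ξ x = 0 := by
  refine ⟨mu_eq_zero_of_mfderiv_nu hact hξ (linearIndependent_of_nu_ne_zero hact hξ hx),
    fun hμ => ?_⟩
  refine ContinuousLinearMap.ext fun v => ?_
  refine (mfderiv_nu hact hξ x v).trans ?_
  change (4 : ℝ) * _ = (0 : ℝ)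
  rw [hμ]
  simp

/-- If ν were identically zero, then dν = 0 would give μ = 0 at a point with independent Kᵢ, and the
isotropic triple there would have ν ≠ 0. -/
theorem exists_nu_ne_zero (hdim : HasThreeDimPrincipalOrbits M) : ∃ x : M, S.nu ξ x ≠ 0 := by
  by_contra! hcon
  obtain ⟨x, -, hx⟩ := hdim
  have h0 : S.nu ξ = fun _ => (0 : ℝ) := funext hcon
  have hind : LinearIndependent ℝ fun i => fundVec (ξ i) x := by
    have hrange : (Set.range fun η : su2 => (fundVec η x)) = Set.range
        ((infAct x).toLinearMap ∘ₗ su2Coord.toLinearMap) := by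
      exact congrArg Set.range (funext fun η => fundVec_eq hact.smooth η x)
    have hspan : Submodule.span ℝ (Set.range fun η : su2 => (fundVec η x)) =
        Submodule.span ℝ (Set.range fun i => fundVec (ξ i) x) := by
      apply le_antisymm
      · rw [hrange, Submodule.span_le]
        rintro _ ⟨η, rfl⟩
        rw [← ξ.sum_repr η, map_sum]
        refine Submodule.sum_mem _ fun i _ => ?_
        rw [map_smul]
        refine Submodule.smul_mem _ _ (Submodule.subset_span ⟨i, ?_⟩)
        exact fundVec_eq hact.smooth _ _
      · refine Submodule.span_mono ?_
        rintro _ ⟨i, rfl⟩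
        exact ⟨ξ i, rfl⟩
    rw [linearIndependent_iff_card_eq_finrank_span, Set.finrank, ← hspan]
    exact hx.symm
  refine nu_ne_zero_of_isotropic hact hξ hind ?_ (hcon x)
  refine mu_eq_zero_of_mfderiv_nu hact hξ hind ?_
  rw [h0]
  exact mfderiv_const

/-- A function that is not identically zero has a nonzero maximum or a nonzero minimum, and that
point is critical. -/
theorem exists_nu_ne_zero_and_mu_eq_zero [CompactSpace M]
    (hdim : HasThreeDimPrincipalOrbits M) : ∃ x : M, S.nu ξ x ≠ 0 ∧ S.mu ξ x = 0 := by
  obtain ⟨x₁, hx₁⟩ := exists_nu_ne_zero hact hξ hdim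
  have : Nonempty M := ⟨x₁⟩
  have hc : Continuous (S.nu ξ) := (contMDiff_nu hact).continuous
  have hd : ∀ x, MDifferentiableAt (𝓡 6) 𝓘(ℝ, ℝ) (S.nu ξ) x := fun x =>
    (contMDiff_nu hact).mdifferentiable (by simp) x
  have key : ∀ x, IsLocalExtr (S.nu ξ) x → S.nu ξ x ≠ 0 → S.mu ξ x = 0 := by
    intro x hx hne
    refine (mfderiv_nu_eq_zero_iff hact hξ hne).1 ?_
    refine (if_pos (hd x)).trans ?_
    have h1 : IsLocalExtr (writtenInExtChartAt (𝓡 6) 𝓘(ℝ, ℝ) x (S.nu ξ)) (extChartAt (𝓡 6) x x) := by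
      have h2 : Filter.Tendsto (extChartAt (𝓡 6) x).symm (𝓝 (extChartAt (𝓡 6) x x)) (𝓝 x) := by
        have h3 := (continuousAt_extChartAt_symm (I := 𝓡 6) x).tendsto
        rwa [extChartAt_to_inv] at h3
      refine IsExtrFilter.comp_tendsto (f := S.nu ξ) (l := 𝓝 x) (g := (extChartAt (𝓡 6) x).symm) ?_ ?_
      · rw [extChartAt_to_inv]; exact hx
      · exact h2
    rw [modelWithCornersSelf_coe, Set.range_id, fderivWithin_univ]
    exact h1.fderiv_eq_zero
  obtain ⟨p, hp⟩ := hc.exists_forall_ge_of_hasCompactSupport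
    (HasCompactSupport.of_compactSpace _)
  obtain ⟨q, hq⟩ := hc.exists_forall_le_of_hasCompactSupport
    (HasCompactSupport.of_compactSpace _)
  by_cases hp0 : S.nu ξ p = 0
  · have hq0 : S.nu ξ q ≠ 0 := fun hq0 => hx₁ (le_antisymm ((hp x₁).trans hp0.le)
      (hq0.symm.le.trans (hq x₁)))
    exact ⟨q, hq0, key q (Or.inl (Filter.Eventually.of_forall hq)) hq0⟩
  · exact ⟨p, hp0, key p (Or.inr (Filter.Eventually.of_forall hp)) hp0⟩

end NearlyKahler

/-! ### Invariance of the isotropy conditions along orbits -/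

section

variable {M : Type*} [TopologicalSpace M] [ChartedSpace E6 M] [MulAction SU2 M]

/-- The infinitesimal action at `x`. -/
def fundLin (x : M) : su2 →ₗ[ℝ] E6 := (infAct x).toLinearMap ∘ₗ su2Coord.toLinearMap

theorem fundLin_apply (h : IsSmoothAction M) (x : M) (η : su2) : fundLin x η = fundVec η x :=
  (fundVec_eq h η x).symm

end

namespace NearlyKahler

variable {M : Type*} [TopologicalSpace M] [ChartedSpace E6 M] [IsManifold (𝓡 6) ∞ M]
  [MulAction SU2 M] {S : NearlyKahler M} (hact : S.IsAutomorphicAction)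
  {ξ : Module.Basis (Fin 3) ℝ su2}
include hact

/-- The basis-free form of μ = 0. It is stable under translation along the orbit, where the adjoint
action mixes the basis fields. -/
theorem mu_eq_zero_iff (x : M) : S.mu ξ x = 0 ↔
    ∀ η ζ : su2, S.omega.ev x ![fundVec η x, fundVec ζ x] = 0 := by
  refine ⟨fun hμ η ζ => ?_, fun h => funext fun i => h _ _⟩
  have h1 : ∀ η : su2, fundVec η x = ∑ i, ξ.repr η i • fundVec (ξ i) x := fun η => by
    conv_lhs => rw [← ξ.sum_repr η, ← fundLin_apply hact.smooth, map_sum]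
    exact Finset.sum_congr rfl fun i _ => by rw [map_smul, fundLin_apply hact.smooth]
  rw [h1 η, omega_sum_left]
  refine Finset.sum_eq_zero fun i _ => ?_
  rw [h1 ζ, S.omega_swap, omega_sum_left]
  simp [omega_basis_eq_zero hμ]

/-- Pulled back to the Lie algebra, the map is an alternating 3-form on a three-dimensional space
and is determined by its value on one basis. -/
theorem alternating_fundVec_eq_zero {x : M} {F : Type*} [AddCommGroup F] [Module ℝ F]
    (α : E6 [⋀^Fin 3]→ₗ[ℝ] F) (h0 : α (fun i => fundVec (ξ i) x) = 0) (η : Fin 3 → su2) :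
    α (fun i => fundVec (η i) x) = 0 := by
  have h1 : α.compLinearMap (fundLin x) = 0 := by
    refine ξ.ext_alternating fun v hv => ?_
    have hb : Function.Bijective v := Finite.injective_iff_bijective.1 hv
    have h2 := (α.compLinearMap (fundLin x)).map_perm (fun i => ξ i) (Equiv.ofBijective v hb)
    refine h2.trans ?_
    have h3 : α.compLinearMap (fundLin x) (fun i => ξ i) = 0 := by
      rw [← h0, AlternatingMap.compLinearMap_apply]
      exact congrArg α (funext fun i => fundLin_apply hact.smooth x _)
    rw [h3, smul_zero]; rfl
  have h4 := congrArg (fun f => f η) h1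
  rw [AlternatingMap.compLinearMap_apply] at h4
  rw [← show α _ = 0 from h4]
  exact congrArg α (funext fun i => (fundLin_apply hact.smooth x _).symm)

variable (hξ : IsStandardBasis ξ)
include hξ

theorem re_psi_fundVec_eq_zero (x : M) (η : Fin 3 → su2) :
    (S.psi.ev x fun i => fundVec (η i) x).re = 0 := by
  refine alternating_fundVec_eq_zero hact (ξ := ξ) (x := x)
    (Complex.reLm.compAlternatingMap (S.psi.ev x).toAlternatingMap) ?_ η
  rw [ofFn_fundVec]
  exact re_psi_fundVec hact hξ x

theorem nu_eq_zero_iff_forall (x : M) : S.nu ξ x = 0 ↔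
    ∀ η : Fin 3 → su2, S.psi.ev x (fun i => fundVec (η i) x) = 0 := by
  rw [nu_eq_zero_iff hact hξ, ← ofFn_fundVec]
  exact ⟨fun h η => alternating_fundVec_eq_zero hact (S.psi.ev x).toAlternatingMap h η,
    fun h => h _⟩

omit hξ in
theorem mu_smul_eq_zero (a : SU2) {x : M} (hμ : S.mu ξ x = 0) : S.mu ξ (a • x) = 0 := by
  rw [mu_eq_zero_iff hact] at hμ ⊢
  intro η ζ
  have h1 : ∀ η : su2, fundVec η (a • x) = actDeriv a x (fundVec (adSU2 a⁻¹ η) x) := fun η => by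
    rw [← fundVec_adSU2 hact.smooth, ← adSU2_mul, mul_inv_cancel, adSU2_one]
  have h2 := congrArg (fun α => DForm.ev α x ![fundVec (adSU2 a⁻¹ η) x, fundVec (adSU2 a⁻¹ ζ) x])
    (actPull_omega hact a)
  simp only [DForm.actPull_apply] at h2
  rw [hμ] at h2
  rw [← h2, h1, h1]
  refine congrArg (S.omega.ev (a • x)) ?_
  ext i : 1; fin_cases i <;> rfl

theorem nu_smul_eq_zero (a : SU2) {x : M} (hν : S.nu ξ x = 0) : S.nu ξ (a • x) = 0 := by
  rw [nu_eq_zero_iff_forall hact hξ] at hν ⊢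
  intro η
  have h1 : ∀ η : su2, fundVec η (a • x) = actDeriv a x (fundVec (adSU2 a⁻¹ η) x) := fun η => by
    rw [← fundVec_adSU2 hact.smooth, ← adSU2_mul, mul_inv_cancel, adSU2_one]
  have h2 := congrArg (fun α => DForm.ev α x fun i => fundVec (adSU2 a⁻¹ (η i)) x)
    (actPull_psi hact a)
  simp only [DForm.actPull_apply] at h2
  rw [hν] at h2
  rw [← h2]
  exact congrArg (S.psi.ev (a • x)) (funext fun i => h1 _)

omit hξ in
theorem infAct_injective_iff (x : M) : Function.Injective (infAct x) ↔
    LinearIndependent ℝ fun i => fundVec (ξ i) x := by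
  have h1 : (fun i => fundVec (ξ i) x) = fundLin x ∘ ξ :=
    funext fun i => (fundLin_apply hact.smooth x _).symm
  rw [h1]
  have h2 : Function.Injective (infAct x) ↔ Function.Injective (fundLin x) := by
    constructor
    · exact fun h => h.comp su2Coord.injective
    · intro h a b hab
      apply su2Coord.symm.injective
      apply h
      change infAct x (su2Coord (su2Coord.symm a)) = infAct x (su2Coord (su2Coord.symm b))
      rw [su2Coord.apply_symm_apply, su2Coord.apply_symm_apply, hab]
  rw [h2]
  constructor
  · exact fun h => ξ.linearIndependent.map' _ (LinearMap.ker_eq_bot.2 h)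
  · intro h
    rw [← LinearMap.ker_eq_bot, LinearMap.ker_eq_bot']
    intro η hη
    rw [← ξ.sum_repr η, map_sum] at hη
    simp only [map_smul] at hη
    have := Fintype.linearIndependent_iff.1 h _ hη
    exact ξ.repr.injective (Finsupp.ext fun i => by simpa using this i)

end NearlyKahler

/-! ### Slice charts along orbits -/

/-- The inverse function theorem, with the domain shrunk to the open set where the differential is
invertible, so that the local inverse is smooth on its whole target. -/
theorem exists_openPartialHomeomorph_of_contDiffOn {E : Type*} [NormedAddCommGroup E]
    [NormedSpace ℝ E] [CompleteSpace E] {G : E → E} {s : Set E} (hs : IsOpen s)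
    (hG : ContDiffOn ℝ ∞ G s) {x : E} (hx : x ∈ s)
    (h' : HasFDerivAt G (ContinuousLinearMap.id ℝ E) x) :
    ∃ Φ : OpenPartialHomeomorph E E, x ∈ Φ.source ∧ Φ.source ⊆ s ∧ (Φ : E → E) = G ∧
      ContDiffOn ℝ ∞ Φ.symm Φ.target := by
  have hGx := hG.contDiffAt (hs.mem_nhds hx)
  have h1 : HasFDerivAt G ((ContinuousLinearEquiv.refl ℝ E : E ≃L[ℝ] E) : E →L[ℝ] E) x := h'
  let Φ₀ := hGx.toOpenPartialHomeomorph G h1 (by simp)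
  have hΦ₀ : (Φ₀ : E → E) = G := rfl
  have hx₀ : x ∈ Φ₀.source := ContDiffAt.mem_toOpenPartialHomeomorph_source hGx h1 (by simp)
  let t : Set E := s ∩ fderiv ℝ G ⁻¹' Set.range ContinuousLinearEquiv.toContinuousLinearMap
  have ht : IsOpen t := ((hG.continuousOn_fderiv_of_isOpen hs (by simp))).isOpen_inter_preimage hs
    ContinuousLinearEquiv.isOpen
  have hxt : x ∈ t := ⟨hx, ContinuousLinearEquiv.refl ℝ E, h1.fderiv.symm⟩
  refine ⟨Φ₀.restrOpen t ht, ⟨hx₀, hxt⟩, fun z hz => hz.2.1, rfl, fun z hz => ?_⟩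
  have hz' := (Φ₀.restrOpen t ht).map_target hz
  obtain ⟨hzs, L, hL⟩ : (Φ₀.restrOpen t ht).symm z ∈ t := hz'.2
  have hd := (hG.contDiffAt (hs.mem_nhds hzs))
  refine (OpenPartialHomeomorph.contDiffAt_symm (Φ₀.restrOpen t ht) (f₀' := L) hz ?_ hd).contDiffWithinAt
  rw [hL]
  exact (hd.differentiableAt (by simp)).hasFDerivAt

theorem mem_maximalAtlas_mdifferentiable {M : Type*} [TopologicalSpace M] [ChartedSpace E6 M]
    [IsManifold (𝓡 6) ∞ M] {φ : OpenPartialHomeomorph M E6}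
    (hφ : φ ∈ IsManifold.maximalAtlas (𝓡 6) ∞ M) :
    OpenPartialHomeomorph.MDifferentiable (𝓡 6) (𝓡 6) φ :=
  ⟨(contMDiffOn_of_mem_maximalAtlas hφ).mdifferentiableOn (by simp),
    (contMDiffOn_symm_of_mem_maximalAtlas hφ).mdifferentiableOn (by simp)⟩

theorem isOpen_setOf_mul_mem_gnomonic (s : SU2) {V : Set (Fin 3 → ℝ)} (hV : IsOpen V) :
    IsOpen {q : USphere 3 | ∃ c ∈ V, sphereToSU2 q * s = gnomonic c} := by
  let f : USphere 3 → EuclideanSpace ℝ (Fin 4) := fun q =>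
    LinearMap.toContinuousLinearMap (quatVec ∘ₗ (LinearMap.mulRight ℝ s.1) ∘ₗ quatMat) q.1
  have hf : Continuous f := ContinuousLinearMap.continuous _ |>.comp continuous_subtype_val
  have hfq : ∀ q, f q = quatVec (sphereToSU2 q * s).1 := fun q => by
    have h1 : quatVec (sphereToSU2 q).1 = q.1 := by ext i; fin_cases i <;> rfl
    change quatVec (quatMat q.1 * s.1) = quatVec ((sphereToSU2 q).1 * s.1)
    rw [← h1, quatMat_quatVec]
  have h1 : {q : USphere 3 | ∃ c ∈ V, sphereToSU2 q * s = gnomonic c} =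
      f ⁻¹' ({v | 0 < v 0} ∩ gnomCoord ⁻¹' V) := by
    ext q
    change _ ↔ 0 < f q 0 ∧ gnomCoord (f q) ∈ V
    rw [hfq]
    constructor
    · rintro ⟨c, hc, hq⟩
      rw [hq, gnomCoord_gnomonic]
      exact ⟨gnomonic_re_pos c, hc⟩
    · rintro ⟨h1, h2⟩
      exact ⟨_, h2, (gnomonic_gnomCoord h1).symm⟩
  rw [h1]
  refine IsOpen.preimage hf ?_
  have ho : IsOpen {v : EuclideanSpace ℝ (Fin 4) | 0 < v 0} :=
    isOpen_lt continuous_const (by fun_prop)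
  refine ContinuousOn.isOpen_inter_preimage (fun v hv => ?_) ho hV
  exact (contDiffAt_gnomCoord (n := 0) (ne_of_gt hv)).continuousAt.continuousWithinAt

section Orbits

variable {M : Type*} [TopologicalSpace M] [ChartedSpace E6 M] [MulAction SU2 M]
  (h : IsSmoothAction M)
include h

/-- Near `p`, the orbit of `p` consists of points `gnomonic c • p` with `c` small. -/
theorem eventually_smul_eq_gnomonic_smul [T2Space M] (p : M) {V : Set (Fin 3 → ℝ)} (hV : IsOpen V)
    (h0 : (0 : Fin 3 → ℝ) ∈ V) :
    ∀ᶠ y in 𝓝 p, y ∈ MulAction.orbit SU2 p → ∃ c ∈ V, gnomonic c • p = y := by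
  -- `O` is the union of right translates of the small gnomonic neighbourhood by stabiliser
  -- elements. Its complement is compact, so the image of the complement is closed and misses `p`;
  -- orbit points off that image come from `O` and hence from small parameters.
  let O : Set (USphere 3) :=
    ⋃ s ∈ MulAction.stabilizer SU2 p, {q | ∃ c ∈ V, sphereToSU2 q * s = gnomonic c}
  have hO : IsOpen O := isOpen_biUnion fun s _ => isOpen_setOf_mul_mem_gnomonic s hV
  have hc : Continuous fun q : USphere 3 => sphereToSU2 q • p :=
    h.continuous.comp (continuous_id.prodMk continuous_const)
  have hK : IsClosed ((fun q : USphere 3 => sphereToSU2 q • p) '' Oᶜ) :=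
    ((hO.isClosed_compl).isCompact.image hc).isClosed
  have hp : p ∉ (fun q : USphere 3 => sphereToSU2 q • p) '' Oᶜ := by
    rintro ⟨q, hq, hqp⟩
    refine hq (Set.mem_biUnion (x := (sphereToSU2 q)⁻¹) ?_ ⟨0, h0, ?_⟩)
    · exact inv_mem (MulAction.mem_stabilizer_iff.2 hqp)
    · rw [mul_inv_cancel, gnomonic_zero]
  filter_upwards [hK.isOpen_compl.mem_nhds hp] with y hy
  rintro ⟨a, rfl⟩
  have hq : sphereOf a ∈ O := by
    by_contra hq
    refine hy ⟨_, hq, ?_⟩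
    simp only [sphereToSU2_sphereOf]
  obtain ⟨s, hs, c, hcV, hq⟩ := Set.mem_iUnion₂.1 hq
  refine ⟨c, hcV, ?_⟩
  rw [← hq, sphereToSU2_sphereOf, mul_smul, MulAction.mem_stabilizer_iff.1 hs]

variable [IsManifold (𝓡 6) ∞ M]

/-- An orbit on which the infinitesimal action is injective is an embedded submanifold. -/
theorem exists_sliceChart_orbit [T2Space M] {p : M} (hinj : Function.Injective (infAct p)) :
    ∃ φ W, IsSliceChart (MulAction.orbit SU2 p) p φ W ∧ Module.finrank ℝ W = 3 ∧
      ∀ u ∈ sliceTangent p φ W, ∃ η : su2, u = fundVec η p := by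
  let e := chartAt E6 p
  let y₀ : E6 := e p
  have hy₀ : y₀ ∈ e.target := mem_chart_target E6 p
  have hes : e.symm y₀ = p := e.left_inv (mem_chart_source E6 p)
  have hem := mdifferentiable_chart (I := 𝓡 6) p
  -- the map in coordinates
  let H : (Fin 3 → ℝ) × E6 → M := fun q => gnomonic q.1 • e.symm (y₀ + q.2)
  let κ : (Fin 3 → ℝ) →L[ℝ] E6 := fderiv ℝ (fun c => e (gnomonic c • p)) 0
  have hesmooth : ∀ y ∈ e.source, ContMDiffAt (𝓡 6) (𝓡 6) ∞ e y := fun y hy =>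
    contMDiffAt_of_mem_maximalAtlas (IsManifold.chart_mem_maximalAtlas p) hy
  have hHsmooth : ∀ q : (Fin 3 → ℝ) × E6, y₀ + q.2 ∈ e.target →
      ContMDiffAt 𝓘(ℝ, (Fin 3 → ℝ) × E6) (𝓡 6) ∞ H q := fun q hq => by
    refine h.contMDiffAt_gnomonic_smul contDiff_fst.contMDiff.contMDiffAt ?_
    have h1 : ContMDiffAt 𝓘(ℝ, E6) (𝓡 6) ∞ e.symm (y₀ + q.2) :=
      contMDiffOn_chart_symm.contMDiffAt (e.open_target.mem_nhds hq)
    exact h1.comp q (contDiff_const.add contDiff_snd).contMDiff.contMDiffAt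
  have hH0 : H (0, 0) = p := by
    simp only [H, gnomonic_zero, one_smul, add_zero, hes]
  have hHc : ∀ c : Fin 3 → ℝ, H (c, 0) = gnomonic c • p := fun c => by
    simp only [H, add_zero, hes]
  have heH : ContDiffAt ℝ ∞ (e ∘ H) (0, 0) := by
    rw [← contMDiffAt_iff_contDiffAt]
    refine ContMDiffAt.comp (0, 0) ?_ (hHsmooth (0, 0) (by simpa using hy₀))
    rw [hH0]
    exact hesmooth p (mem_chart_source E6 p)
  have heHd := (heH.differentiableAt (by simp)).hasFDerivAt
  set A := fderiv ℝ (e ∘ H) ((0 : Fin 3 → ℝ), (0 : E6))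
  have hA1 : ∀ c, A (c, 0) = κ c := fun c => by
    have h1 := heHd.comp (0 : Fin 3 → ℝ) (hasFDerivAt_prodMk_left (𝕜 := ℝ) (0 : Fin 3 → ℝ) (0 : E6))
    have h2 : (e ∘ H) ∘ (fun c : Fin 3 → ℝ => (c, (0 : E6))) = fun c => e (gnomonic c • p) :=
      funext fun c => congrArg e (hHc c)
    rw [h2] at h1
    change A (c, 0) = fderiv ℝ (fun c => e (gnomonic c • p)) 0 c
    rw [h1.fderiv]; rfl
  have hA2 : ∀ w, A (0, w) = w := fun w => by
    have h1 := heHd.comp (0 : E6) (hasFDerivAt_prodMk_right (𝕜 := ℝ) (0 : Fin 3 → ℝ) (0 : E6))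
    have h2 : (e ∘ H) ∘ (fun w : E6 => ((0 : Fin 3 → ℝ), w)) =ᶠ[𝓝 0] fun w => y₀ + w := by
      have h3 : ∀ᶠ w in 𝓝 (0 : E6), y₀ + w ∈ e.target := by
        have : Continuous fun w : E6 => y₀ + w := by fun_prop
        exact this.continuousAt.eventually_mem (e.open_target.mem_nhds (by simpa using hy₀))
      filter_upwards [h3] with w hw
      simp only [Function.comp_apply, H, gnomonic_zero, one_smul]
      exact e.right_inv hw
    have h4 := (h1.congr_of_eventuallyEq h2.symm).unique ((hasFDerivAt_id (0 : E6)).const_add y₀)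
    exact congrArg (fun L : E6 →L[ℝ] E6 => L w) h4
  have hκ : ∀ c, κ c = (mfderiv (𝓡 6) (𝓡 6) e p : E6 →L[ℝ] E6) (infAct p c) := fun c => by
    have h1 := mfderiv_comp_apply_of_base (g := e) (f := fun c : Fin 3 → ℝ => gnomonic c • p)
      (y := 0) (x := p) (by simp [gnomonic_zero])
      (hem.mdifferentiableAt (mem_chart_source E6 p))
      ((contMDiff_gnomonic_smul h p).mdifferentiable (by simp) 0) c
    refine Eq.trans ?_ h1
    change fderiv ℝ (fun c => e (gnomonic c • p)) 0 c = _
    rw [← mfderiv_eq_fderiv]; rfl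
  have hκi : Function.Injective κ := fun a b hab => by
    rw [hκ, hκ] at hab
    exact hinj (hem.mfderiv_injective (mem_chart_source E6 p) hab)
  -- `P` is a left inverse of κ and `Q` = id - κP projects along the tangent space of the orbit.
  -- Moving transversally by `Q z` and then acting with parameter `P z` gives `G`, whose derivative
  -- at 0 is κP + Q = id; on the range of κ it traces the orbit.
  obtain ⟨P₀, hP₀⟩ := LinearMap.exists_leftInverse_of_injective κ.toLinearMap
    (LinearMap.ker_eq_bot.2 hκi)
  let P : E6 →L[ℝ] (Fin 3 → ℝ) := LinearMap.toContinuousLinearMap P₀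
  have hP : ∀ c, P (κ c) = c := fun c => congrArg (fun f => f c) hP₀
  let Q : E6 →L[ℝ] E6 := ContinuousLinearMap.id ℝ E6 - κ.comp P
  have hQ : ∀ z, Q z = z - κ (P z) := fun z => rfl
  have hQκ : ∀ c, Q (κ c) = 0 := fun c => by rw [hQ, hP, sub_self]
  let m : E6 → M := fun z => H (P z, Q z)
  let G : E6 → E6 := e ∘ m
  let t : Set E6 := (fun z => y₀ + Q z) ⁻¹' e.target
  have ht : IsOpen t := e.open_target.preimage (by fun_prop)
  have hm : ContMDiffOn 𝓘(ℝ, E6) (𝓡 6) ∞ m t := fun z hz =>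
    ((hHsmooth (P z, Q z) hz).comp z (P.contDiff.prodMk Q.contDiff).contMDiff.contMDiffAt).contMDiffWithinAt
  let s : Set E6 := t ∩ m ⁻¹' e.source
  have hs : IsOpen s := hm.continuousOn.isOpen_inter_preimage ht e.open_source
  have hm0 : m 0 = p := by
    change H (P 0, Q 0) = p
    rw [map_zero, map_zero, hH0]
  have h0s : (0 : E6) ∈ s := by
    refine ⟨?_, ?_⟩
    · change y₀ + Q 0 ∈ e.target
      rw [map_zero, add_zero]; exact hy₀
    · change m 0 ∈ e.source
      rw [hm0]; exact mem_chart_source E6 p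
  have hG : ContDiffOn ℝ ∞ G s := fun z hz => by
    refine ContDiffAt.contDiffWithinAt ?_
    rw [← contMDiffAt_iff_contDiffAt]
    exact (hesmooth _ hz.2).comp z (hm.contMDiffAt (ht.mem_nhds hz.1))
  have hGd : HasFDerivAt G (ContinuousLinearMap.id ℝ E6) 0 := by
    have h1 : HasFDerivAt (fun z : E6 => (P z, Q z)) (P.prod Q) 0 := (P.prod Q).hasFDerivAt
    have h2 : HasFDerivAt (e ∘ H) A (P 0, Q 0) := by rw [map_zero, map_zero]; exact heHd
    refine (h2.comp (0 : E6) h1).congr_fderiv (ContinuousLinearMap.ext fun z => ?_)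
    change A (P z, Q z) = z
    have h3 : ((P z, Q z) : (Fin 3 → ℝ) × E6) = (P z, 0) + (0, Q z) := by simp
    rw [h3, map_add, hA1, hA2, hQ]
    abel
  obtain ⟨Φ, h0Φ, hΦs, hΦG, hΦsm⟩ := exists_openPartialHomeomorph_of_contDiffOn hs hG h0s hGd
  have hG0 : G 0 = y₀ := congrArg e hm0
  -- small parameters
  let V : Set (Fin 3 → ℝ) := κ ⁻¹' Φ.source
  have hV : IsOpen V := Φ.open_source.preimage κ.continuous
  have h0V : (0 : Fin 3 → ℝ) ∈ V := by
    change κ 0 ∈ Φ.source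
    rw [map_zero]; exact h0Φ
  have hmκ : ∀ c, m (κ c) = gnomonic c • p := fun c => by
    change H (P (κ c), Q (κ c)) = _
    rw [hP, hQκ, hHc]
  -- Shrinking to `U` excludes other returns of the orbit to the chart: orbit points in `U` have
  -- parameters in `V`, so they lie in the slice.
  obtain ⟨U, hUsub, hU, hpU⟩ := mem_nhds_iff.1 (eventually_smul_eq_gnomonic_smul h p hV h0V)
  let φ : OpenPartialHomeomorph M E6 := (e.trans Φ.symm).restrOpen U hU
  have hφsrc : ∀ y, y ∈ φ.source ↔ (y ∈ e.source ∧ e y ∈ Φ.target) ∧ y ∈ U := fun y => Iff.rfl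
  have hy₀Φ : y₀ ∈ Φ.target := by
    rw [← hG0, ← hΦG]; exact Φ.map_source h0Φ
  have hΦy₀ : Φ.symm y₀ = 0 := by
    rw [← hG0, ← hΦG]; exact Φ.left_inv h0Φ
  have hpφ : p ∈ φ.source := (hφsrc p).2 ⟨⟨mem_chart_source E6 p, hy₀Φ⟩, hpU⟩
  have hφp : φ p = 0 := hΦy₀
  have hφat : φ ∈ IsManifold.maximalAtlas (𝓡 6) ∞ M := by
    refine OpenPartialHomeomorph.mem_maximalAtlas_of_contMDiffOn φ (fun y hy => ?_) fun z hz => ?_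
    · have h1 : ContMDiffAt (𝓡 6) (𝓡 6) ∞ Φ.symm (e y) :=
        (hΦsm.contDiffAt (Φ.open_target.mem_nhds hy.1.2)).contMDiffAt
      exact (h1.comp y (hesmooth y hy.1.1)).contMDiffWithinAt
    · have hz1 : z ∈ Φ.source ∧ Φ z ∈ e.target := hz.1
      have h1 : ContMDiffAt (𝓡 6) (𝓡 6) ∞ Φ z := by
        rw [hΦG]
        exact (hG.contDiffAt (hs.mem_nhds (hΦs hz1.1))).contMDiffAt
      have h2 : ContMDiffAt (𝓡 6) (𝓡 6) ∞ e.symm (Φ z) :=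
        contMDiffOn_chart_symm.contMDiffAt (e.open_target.mem_nhds hz1.2)
      exact (h2.comp z h1).contMDiffWithinAt
  have hφm : ∀ z ∈ Φ.source, φ (m z) = z := fun z hz => by
    change Φ.symm (G z) = z
    rw [← hΦG]; exact Φ.left_inv hz
  have hφκ : ∀ c ∈ V, φ (gnomonic c • p) = κ c := fun c hc => by
    rw [← hmκ]; exact hφm _ hc
  have hφd := mem_maximalAtlas_mdifferentiable hφat
  refine ⟨φ, LinearMap.range κ.toLinearMap, ⟨hφat, hpφ, fun y hy => ?_⟩, ?_, fun u hu => ?_⟩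
  · rw [hφp, sub_zero]
    constructor
    · intro hyo
      obtain ⟨c, hc, rfl⟩ := hUsub hy.2 hyo
      rw [hφκ c hc]
      exact ⟨c, rfl⟩
    · rintro ⟨c, hc⟩
      have hc' : κ c = φ y := hc
      have hcV : c ∈ V := by
        change κ c ∈ Φ.source
        rw [hc']
        exact Φ.map_target hy.1.2
      have h1 : e y = G (κ c) := by
        rw [hc', ← hΦG]
        exact (Φ.right_inv hy.1.2).symm
      have h2 : y = gnomonic c • p := by
        rw [← hmκ]
        exact e.injOn hy.1.1 (hΦs hcV).2 h1
      exact ⟨gnomonic c, h2.symm⟩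
  · rw [LinearMap.finrank_range_of_inj hκi]
    simp
  · obtain ⟨c, hc⟩ := hu
    have hc' : κ c = (mfderiv (𝓡 6) (𝓡 6) φ p : E6 →L[ℝ] E6) u := hc
    refine ⟨su2Coord.symm c, ?_⟩
    rw [fundVec_eq h, su2Coord.apply_symm_apply]
    refine hφd.mfderiv_injective hpφ ?_
    refine hc'.symm.trans ?_
    have h1 := mfderiv_comp_apply_of_base (g := φ) (f := fun c : Fin 3 → ℝ => gnomonic c • p)
      (y := 0) (x := p) (by simp [gnomonic_zero]) (hφd.mdifferentiableAt hpφ)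
      ((contMDiff_gnomonic_smul h p).mdifferentiable (by simp) 0) c
    refine Eq.trans ?_ h1
    have h2 : φ ∘ (fun c : Fin 3 → ℝ => gnomonic c • p) =ᶠ[𝓝 0] κ := by
      filter_upwards [hV.mem_nhds h0V] with c hc using hφκ c hc
    rw [h2.mfderiv_eq, mfderiv_eq_fderiv, κ.fderiv]
    rfl


omit [IsManifold (𝓡 6) ∞ M] [TopologicalSpace M] [ChartedSpace E6 M] [MulAction SU2 M] h in
theorem contDiff_quatVec_gnomonic :
    ContDiff ℝ ∞ (fun c : Fin 3 → ℝ => quatVec (gnomonic c).1) := by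
  have : Fact (Module.finrank ℝ (WithLp 2 (Fin 4 → ℝ)) = 3 + 1) := ⟨by
    rw [finrank_euclideanSpace_fin]⟩
  have h1 : ContMDiff 𝓘(ℝ, Fin 3 → ℝ) 𝓘(ℝ, EuclideanSpace ℝ (Fin 4)) ∞
      (fun c => (gnomonicSphere c : EuclideanSpace ℝ (Fin 4))) :=
    (contMDiff_coe_sphere (n := 3) (m := ∞)).comp contMDiff_gnomonicSphere
  rw [contMDiff_iff_contDiff] at h1
  have h2 : (fun c : Fin 3 → ℝ => quatVec (gnomonic c).1) =
      fun c => (gnomonicSphere c : EuclideanSpace ℝ (Fin 4)) := by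
    funext c; ext i; fin_cases i <;> rfl
  rwa [h2]

omit [IsManifold (𝓡 6) ∞ M] [TopologicalSpace M] [ChartedSpace E6 M] [MulAction SU2 M] h in
/-- The curve `gnomonic c * exp(tη)` in gnomonic coordinates. -/
theorem exists_gnomonic_curve (c : Fin 3 → ℝ) {η : su2} (hη : η ≠ 0) :
    ∃ (γ : ℝ → Fin 3 → ℝ) (w : Fin 3 → ℝ), γ 0 = c ∧ HasDerivAt γ w 0 ∧ w ≠ 0 ∧
      ∀ᶠ t in 𝓝 0, gnomonic (γ t) = gnomonic c * expSU2 (t • η) := by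
  let a := gnomonic c
  let f : ℝ → EuclideanSpace ℝ (Fin 4) := fun t => quatMulLeft a (quatVec (expSU2 (t • η)).1)
  have hf : ContDiff ℝ 1 f := (quatMulLeft a).contDiff.comp (contDiff_quatVec_expSU2 η)
  have hfa : ∀ t, f t = quatVec (a * expSU2 (t • η)).1 := fun t => quatMulLeft_quatVec _ _
  have hf0 : f 0 = quatVec a.1 := by rw [hfa, expSU2_zero_smul, mul_one]
  have hpos : 0 < f 0 0 := by rw [hf0]; exact gnomonic_re_pos c
  let γ : ℝ → Fin 3 → ℝ := fun t => gnomCoord (f t)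
  have hγ0 : γ 0 = c := by
    change gnomCoord (f 0) = c
    rw [hf0]; exact gnomCoord_gnomonic c
  have hγd : DifferentiableAt ℝ γ 0 :=
    ((contDiffAt_gnomCoord (n := 1) hpos.ne').differentiableAt (by simp)).comp (0 : ℝ)
      (hf.differentiable (by simp) 0)
  have hev : ∀ᶠ t in 𝓝 0, gnomonic (γ t) = a * expSU2 (t • η) := by
    have hc : Continuous fun t => f t 0 := by
      have h2 : Continuous (fun m : EuclideanSpace ℝ (Fin 4) => m 0) := by fun_prop
      exact h2.comp hf.continuous
    filter_upwards [hc.continuousAt.eventually (lt_mem_nhds hpos)] with t ht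
    rw [hfa] at ht
    change gnomonic (gnomCoord (f t)) = _
    rw [hfa]
    exact gnomonic_gnomCoord ht
  refine ⟨γ, deriv γ 0, hγ0, hγd.hasDerivAt, fun hw => hη ?_, hev⟩
  -- `R` undoes the translation by `a`. Were the velocity zero, the curve exp(tη) would have zero
  -- velocity in gnomonic coordinates, whereas that velocity is `su2Coord η`.
  let R : (Fin 3 → ℝ) → Fin 3 → ℝ := fun c' =>
    gnomCoord (quatMulLeft a⁻¹ (quatVec (gnomonic c').1))
  have hRd : DifferentiableAt ℝ R (γ 0) := by
    have h1 : ContDiff ℝ 1 fun c' => quatMulLeft a⁻¹ (quatVec (gnomonic c').1) :=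
      (quatMulLeft a⁻¹).contDiff.comp (contDiff_quatVec_gnomonic.of_le (by simp))
    refine ((contDiffAt_gnomCoord (n := 1) ?_).differentiableAt (by simp)).comp (γ 0)
      (h1.differentiable (by simp) _)
    rw [quatMulLeft_quatVec, hγ0, inv_mul_cancel]
    simp
  have h1 := hRd.hasFDerivAt.comp_hasDerivAt (0 : ℝ) hγd.hasDerivAt
  rw [hw, map_zero] at h1
  have h2 : R ∘ γ =ᶠ[𝓝 0] fun t => gnomCoord (quatVec (expSU2 (t • η)).1) := by
    filter_upwards [hev] with t ht
    simp only [Function.comp_apply, R]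
    rw [quatMulLeft_quatVec, ht, inv_mul_cancel_left]
  have h3 := (h1.congr_of_eventuallyEq h2.symm).unique (hasDerivAt_gnomCoord_expSU2 η)
  exact su2Coord.injective (h3.symm.trans (map_zero _).symm)

open MeasureTheory in
/-- If the orbit is an embedded three-dimensional submanifold then the infinitesimal action is
injective, and its values are tangent to the orbit. -/
theorem infAct_injective_of_sliceChart [T2Space M] {p : M} {φ : OpenPartialHomeomorph M E6}
    {W : Submodule ℝ E6} (hφ : IsSliceChart (MulAction.orbit SU2 p) p φ W)
    (hW : Module.finrank ℝ W = 3) :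
    Function.Injective (infAct p) ∧ ∀ η : su2, fundVec η p ∈ sliceTangent p φ W := by
  obtain ⟨hat, hp, hsl⟩ := hφ
  have hφd := mem_maximalAtlas_mdifferentiable hat
  have hgs := contMDiff_gnomonic_smul h p
  let V : Set (Fin 3 → ℝ) := (fun c => gnomonic c • p) ⁻¹' φ.source
  have hV : IsOpen V := φ.open_source.preimage hgs.continuous
  have h0V : (0 : Fin 3 → ℝ) ∈ V := by
    change gnomonic 0 • p ∈ φ.source
    rw [gnomonic_zero, one_smul]; exact hp
  let f : (Fin 3 → ℝ) → E6 := fun c => φ (gnomonic c • p) - φ p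
  have hfW : ∀ c ∈ V, f c ∈ W := fun c hc => (hsl _ hc).1 ⟨_, rfl⟩
  have hfd : ∀ c ∈ V, DifferentiableAt ℝ f c := fun c hc => by
    refine DifferentiableAt.sub_const ?_ _
    rw [← mdifferentiableAt_iff_differentiableAt]
    exact (hφd.mdifferentiableAt hc).comp c (hgs.mdifferentiable (by simp) c)
  obtain ⟨π₀, hπ₀⟩ := LinearMap.exists_leftInverse_of_injective W.subtype
    (LinearMap.ker_eq_bot.2 W.injective_subtype)
  have hπ : ∀ w (hw : w ∈ W), π₀ w = ⟨w, hw⟩ := fun w hw => congrArg (fun f => f ⟨w, hw⟩) hπ₀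
  let L : W ≃ₗ[ℝ] (Fin 3 → ℝ) := LinearEquiv.ofFinrankEq _ _ (by simpa using hW)
  let Λ : E6 →L[ℝ] (Fin 3 → ℝ) := LinearMap.toContinuousLinearMap (L.toLinearMap ∘ₗ π₀)
  let ι : (Fin 3 → ℝ) →L[ℝ] E6 :=
    LinearMap.toContinuousLinearMap (W.subtype ∘ₗ L.symm.toLinearMap)
  have hιW : ∀ z, ι z ∈ W := fun z => (L.symm z).2
  have hΛι : ∀ z, Λ (ι z) = z := fun z => by
    change L (π₀ (L.symm z : W)) = z
    rw [hπ _ (L.symm z).2]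
    simp
  have hιΛ : ∀ w ∈ W, ι (Λ w) = w := fun w hw => by
    change ((L.symm (L (π₀ w)) : W) : E6) = w
    rw [hπ w hw]; simp
  refine ⟨?_, fun η => ?_⟩
  · by_contra hcon
    rw [← ContinuousLinearMap.coe_coe, ← LinearMap.ker_eq_bot, LinearMap.ker_eq_bot'] at hcon
    push Not at hcon
    obtain ⟨v, hv, hv0⟩ := hcon
    have hη : su2Coord.symm v ≠ 0 := fun h0 => hv0 (by simpa using congrArg su2Coord h0)
    have hfix := expSU2_smul_eq_of_fundVec_eq_zero h (ξ := su2Coord.symm v) (x := p)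
      (by rw [fundVec_eq h, su2Coord.apply_symm_apply]; exact hv)
    -- `F` is the orbit map read inside the slice. A one-parameter group fixing `p` makes it
    -- constant along the curves c·exp(tη), so its determinant vanishes on `V` and its image is
    -- null. Yet the image is a neighbourhood of 0, because the slice is filled near `p` by orbit
    -- points with parameters in `V`.
    let F : (Fin 3 → ℝ) → Fin 3 → ℝ := fun c => Λ (f c)
    have hFd : ∀ c ∈ V, HasFDerivAt F (fderiv ℝ F c) c := fun c hc =>
      (Λ.differentiableAt.comp c (hfd c hc)).hasFDerivAt
    have hdet : ∀ c ∈ V, (fderiv ℝ F c).det = 0 := fun c hc => by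
      obtain ⟨γ, w, hγ0, hγ, hw, hev⟩ := exists_gnomonic_curve c hη
      have h1 : HasDerivAt (F ∘ γ) (fderiv ℝ F c w) 0 :=
        HasFDerivAt.comp_hasDerivAt (0 : ℝ) (by rw [hγ0]; exact hFd c hc) hγ
      have h2 : F ∘ γ =ᶠ[𝓝 0] fun _ => F c := by
        filter_upwards [hev] with t ht
        simp only [Function.comp_apply, F, f]
        rw [ht, mul_smul, hfix]
      have h3 : fderiv ℝ F c w = 0 :=
        (h1.congr_of_eventuallyEq h2.symm).unique (hasDerivAt_const _ _)
      by_contra hd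
      have h4 := (LinearMap.equivOfDetNeZero (fderiv ℝ F c).toLinearMap hd).injective
      refine hw (h4 (h3.trans (map_zero _).symm))
    have h0 : volume (F '' V) = 0 :=
      addHaar_image_eq_zero_of_det_fderivWithin_eq_zero volume
        (fun c hc => (hFd c hc).hasFDerivWithinAt) hdet
    have hnh : F '' V ∈ 𝓝 (0 : Fin 3 → ℝ) := by
      have hc : ContinuousAt (fun z : Fin 3 → ℝ => φ p + ι z) 0 := by fun_prop
      have hp0 : φ p + ι 0 = φ p := by rw [map_zero, add_zero]
      have h1 : ∀ᶠ z in 𝓝 (0 : Fin 3 → ℝ), φ p + ι z ∈ φ.target :=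
        hc.eventually_mem (by rw [hp0]; exact φ.open_target.mem_nhds (φ.map_source hp))
      have hc2 : Filter.Tendsto (fun z : Fin 3 → ℝ => φ.symm (φ p + ι z)) (𝓝 0) (𝓝 p) := by
        have h2 : Filter.Tendsto φ.symm (𝓝 (φ p)) (𝓝 p) := by
          have := (φ.continuousAt_symm (φ.map_source hp)).tendsto
          rwa [φ.left_inv hp] at this
        have h3 := hc.tendsto
        rw [hp0] at h3
        exact h2.comp h3
      filter_upwards [h1, hc2.eventually (eventually_smul_eq_gnomonic_smul h p hV h0V)] with z hz hz2
      have hsrc := φ.map_target hz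
      have hval : φ (φ.symm (φ p + ι z)) - φ p = ι z := by
        rw [φ.right_inv hz, add_sub_cancel_left]
      obtain ⟨c, hc, hcz⟩ := hz2 ((hsl _ hsrc).2 (by rw [hval]; exact hιW z))
      refine ⟨c, hc, ?_⟩
      change Λ (φ (gnomonic c • p) - φ p) = z
      rw [hcz, hval, hΛι]
    exact (Measure.measure_pos_of_mem_nhds volume hnh).ne' h0
  · have h1 := mfderiv_comp_apply_of_base (g := φ) (f := fun c : Fin 3 → ℝ => gnomonic c • p)
      (y := 0) (x := p) (by simp [gnomonic_zero]) (hφd.mdifferentiableAt hp)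
      (hgs.mdifferentiable (by simp) 0) (su2Coord η)
    have h2 : fderiv ℝ f 0 (su2Coord η) =
        (mfderiv (𝓡 6) (𝓡 6) φ p : E6 →L[ℝ] E6) (fundVec η p) := by
      rw [fundVec_eq h]
      refine Eq.trans ?_ h1
      have h3 : fderiv ℝ f 0 = fderiv ℝ (φ ∘ fun c : Fin 3 → ℝ => gnomonic c • p) 0 :=
        fderiv_sub_const _
      rw [h3, ← mfderiv_eq_fderiv]; rfl
    change (mfderiv (𝓡 6) (𝓡 6) φ p : E6 →L[ℝ] E6) (fundVec η p) ∈ W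
    rw [← h2]
    -- The map `f` takes values in `W` near 0, so composing with the projection ιΛ onto `W` changes
    -- nothing; hence its derivative also lies in `W`.
    have h4 : f =ᶠ[𝓝 0] (ι.comp Λ) ∘ f := by
      filter_upwards [hV.mem_nhds h0V] with c hc using (hιΛ _ (hfW c hc)).symm
    have h5 : fderiv ℝ f 0 = (ι.comp Λ).comp (fderiv ℝ f 0) := by
      conv_lhs => rw [h4.fderiv_eq]
      exact ((ι.comp Λ).hasFDerivAt.comp (0 : Fin 3 → ℝ) (hfd 0 h0V).hasFDerivAt).fderiv
    rw [h5]
    exact hιW _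

end Orbits

/-! ### The special Lagrangian orbits. -/

namespace NearlyKahler

variable {M : Type*} [TopologicalSpace M] [ChartedSpace E6 M] [IsManifold (𝓡 6) ∞ M] [T2Space M]
  [MulAction SU2 M] {S : NearlyKahler M} (hact : S.IsAutomorphicAction)
  {ξ : Module.Basis (Fin 3) ℝ su2} (hξ : IsStandardBasis ξ)
include hact hξ

/-- An embedded three-dimensional orbit has the fundamental fields as independent tangent vectors,
so isotropy gives μ = 0 and ν ≠ 0. Conversely ν ≠ 0 gives independence and a slice chart; both
vanishing conditions spread along the orbit by invariance, and Re ψ vanishes on fundamental fields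
everywhere. -/
theorem isSpecialLagrangian_orbit_iff (x : M) :
    S.IsSpecialLagrangian (MulAction.orbit SU2 x) ↔ S.nu ξ x ≠ 0 ∧ S.mu ξ x = 0 := by
  constructor
  · intro hL
    obtain ⟨φ, W, hφ, hW, hω, -⟩ := hL x (MulAction.mem_orbit_self x)
    obtain ⟨hinj, htan⟩ := infAct_injective_of_sliceChart hact.smooth hφ hW
    have hμ : S.mu ξ x = 0 := (mu_eq_zero_iff hact x).2 fun η ζ => hω _ (htan η) _ (htan ζ)
    exact ⟨nu_ne_zero_of_isotropic hact hξ ((infAct_injective_iff hact x).1 hinj) hμ, hμ⟩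
  · rintro ⟨hν, hμ⟩ p ⟨a, rfl⟩
    have hν' : S.nu ξ (a • x) ≠ 0 := fun h0 => hν (by
      simpa using nu_smul_eq_zero hact hξ a⁻¹ h0)
    have hμ' := mu_smul_eq_zero hact a hμ
    obtain ⟨φ, W, hφ, hW, htan⟩ := exists_sliceChart_orbit hact.smooth
      ((infAct_injective_iff hact (a • x)).2 (linearIndependent_of_nu_ne_zero hact hξ hν'))
    have ho : MulAction.orbit SU2 (a • x) = MulAction.orbit SU2 x := MulAction.orbit_smul a x
    rw [ho] at hφ
    refine ⟨φ, W, hφ, hW, fun u hu v hv => ?_, fun u hu v hv w hw => ?_⟩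
    · obtain ⟨η, rfl⟩ := htan u hu
      obtain ⟨ζ, rfl⟩ := htan v hv
      exact (mu_eq_zero_iff hact _).1 hμ' η ζ
    · obtain ⟨η, rfl⟩ := htan u hu
      obtain ⟨ζ, rfl⟩ := htan v hv
      obtain ⟨θ, rfl⟩ := htan w hw
      refine Eq.trans ?_ (re_psi_fundVec_eq_zero hact hξ (a • x) ![η, ζ, θ])
      refine congrArg (fun v => (S.psi.ev (a • x) v).re) ?_
      ext i : 1; fin_cases i <;> rfl

end NearlyKahler

/-! ### The Hopf map -/

/-- The generator `diag(i, -i)` of the diagonal torus. -/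
def diagSU2 : su2 := su2Coord.symm ![1, 0, 0]

/-- The matrix `(0, -1; 1, 0)`. -/
def weylSU2 : SU2 := expSU2 ((Real.pi / 2) • su2Coord.symm ![0, 1, 0])

theorem expSU2_pi_div_two {η : su2}
    (h : su2Coord η 0 ^ 2 + su2Coord η 1 ^ 2 + su2Coord η 2 ^ 2 = 1) :
    (expSU2 ((Real.pi / 2) • η)).1 = η.1 := by
  rw [exp_su2_formula one_ne_zero (by rw [h]; norm_num)]
  simp

theorem weylSU2_coe : weylSU2.1 = !![0, -1; 1, 0] := by
  rw [weylSU2, expSU2_pi_div_two (by simp), su2Coord_symm_coe]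
  ext i j; fin_cases i <;> fin_cases j <;> simp [Complex.ext_iff]

theorem expSU2_diag (t : ℝ) : (expSU2 (t • diagSU2)).1 =
    !![⟨Real.cos t, Real.sin t⟩, 0; 0, ⟨Real.cos t, -Real.sin t⟩] := by
  rw [exp_su2_formula one_ne_zero (by simp [diagSU2]), diagSU2, su2Coord_symm_coe]
  ext i j; fin_cases i <;> fin_cases j <;>
    simp [Complex.ext_iff, -Complex.ofReal_cos, -Complex.ofReal_sin]

theorem SU2.inv_coe (a : SU2) : (a⁻¹).1 = a.1.conjTranspose := rfl

theorem SU2.inv_mul_zero_zero (a b : SU2) : (a⁻¹ * b).1 0 0 =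
    starRingEnd ℂ (a.1 0 0) * b.1 0 0 + starRingEnd ℂ (a.1 1 0) * b.1 1 0 := by
  change ((a⁻¹).1 * b.1) 0 0 = _
  rw [SU2.inv_coe, Matrix.mul_apply, Fin.sum_univ_two]; rfl

theorem SU2.inv_mul_one_zero (a b : SU2) : (a⁻¹ * b).1 1 0 =
    a.1 0 0 * b.1 1 0 - a.1 1 0 * b.1 0 0 := by
  change ((a⁻¹).1 * b.1) 1 0 = _
  rw [SU2.inv_coe, Matrix.mul_apply, Fin.sum_univ_two, Matrix.conjTranspose_apply,
    Matrix.conjTranspose_apply, SU2.apply_zero_one, SU2.apply_one_one]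
  simp
  ring

theorem exists_expSU2_diag {s : SU2} (hs : s.1 1 0 = 0) : ∃ t : ℝ, s = expSU2 (t • diagSU2) := by
  have h1 := SU2.sq_sum s
  rw [hs] at h1
  have hn : ‖s.1 0 0‖ = 1 := by
    rw [← sq_eq_sq₀ (norm_nonneg _) zero_le_one, Complex.sq_norm, Complex.normSq_apply]
    simp at h1
    linarith
  have h2 := Complex.norm_mul_exp_arg_mul_I (s.1 0 0)
  rw [hn, Complex.ofReal_one, one_mul] at h2
  refine ⟨Complex.arg (s.1 0 0), SU2.ext_col ?_ ?_⟩
  · rw [expSU2_diag, ← h2]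
    apply Complex.ext
    · rw [Complex.exp_ofReal_mul_I_re, h2]; simp
    · rw [Complex.exp_ofReal_mul_I_im, h2]; simp
  · rw [expSU2_diag, hs]; simp

/-- The Hopf map `SU(2) → S²`, `(a, b) ↦ (|a|² - |b|², 2 ā b)`. -/
def hopf (a : SU2) : USphere 2 :=
  ⟨!₂[(a.1 0 0).re ^ 2 + (a.1 0 0).im ^ 2 - (a.1 1 0).re ^ 2 - (a.1 1 0).im ^ 2,
    2 * ((a.1 0 0).re * (a.1 1 0).re + (a.1 0 0).im * (a.1 1 0).im),
    2 * ((a.1 0 0).re * (a.1 1 0).im - (a.1 0 0).im * (a.1 1 0).re)], by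
    have h := SU2.sq_sum a
    rw [mem_sphere_zero_iff_norm, EuclideanSpace.norm_eq, Real.sqrt_eq_one, Fin.sum_univ_three]
    simp only [Real.norm_eq_abs, sq_abs, Matrix.cons_val_zero, Matrix.cons_val_one,
      Matrix.cons_val]
    generalize (a.1 0 0).re = q0 at *
    generalize (a.1 0 0).im = q1 at *
    generalize (a.1 1 0).re = q2 at *
    generalize (a.1 1 0).im = q3 at *
    linear_combination (q0 ^ 2 + q1 ^ 2 + q2 ^ 2 + q3 ^ 2 + 1) * h⟩

theorem hopf_mul_diag (a : SU2) (t : ℝ) : hopf (a * expSU2 (t • diagSU2)) = hopf a := by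
  have h0 : (a * expSU2 (t • diagSU2)).1 0 0 = a.1 0 0 * ⟨Real.cos t, Real.sin t⟩ := by
    change (a.1 * (expSU2 (t • diagSU2)).1) 0 0 = _
    rw [expSU2_diag, Matrix.mul_apply, Fin.sum_univ_two]; simp
  have h1 : (a * expSU2 (t • diagSU2)).1 1 0 = a.1 1 0 * ⟨Real.cos t, Real.sin t⟩ := by
    change (a.1 * (expSU2 (t • diagSU2)).1) 1 0 = _
    rw [expSU2_diag, Matrix.mul_apply, Fin.sum_univ_two]; simp
  have hcs := Real.cos_sq_add_sin_sq t
  apply Subtype.ext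
  ext i
  simp only [hopf, h0, h1, Complex.mul_re, Complex.mul_im]
  generalize (a.1 0 0).re = q0
  generalize (a.1 0 0).im = q1
  generalize (a.1 1 0).re = q2
  generalize (a.1 1 0).im = q3
  fin_cases i
  · change _ = q0 ^ 2 + q1 ^ 2 - q2 ^ 2 - q3 ^ 2
    simp only [Fin.zero_eta, Matrix.cons_val_zero]
    linear_combination (q0 ^ 2 + q1 ^ 2 - q2 ^ 2 - q3 ^ 2) * hcs
  · change _ = 2 * (q0 * q2 + q1 * q3)
    simp only [Fin.mk_one, Matrix.cons_val_one, Matrix.cons_val_zero]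
    linear_combination 2 * (q0 * q2 + q1 * q3) * hcs
  · change _ = 2 * (q0 * q3 - q1 * q2)
    simp only [Fin.reduceFinMk, Matrix.cons_val]
    linear_combination 2 * (q0 * q3 - q1 * q2) * hcs

theorem mul_weyl_zero_zero (a : SU2) : (a * weylSU2).1 0 0 = -starRingEnd ℂ (a.1 1 0) := by
  change (a.1 * weylSU2.1) 0 0 = _
  rw [weylSU2_coe, Matrix.mul_apply, Fin.sum_univ_two, SU2.apply_zero_one]
  simp

theorem mul_weyl_one_zero (a : SU2) : (a * weylSU2).1 1 0 = starRingEnd ℂ (a.1 0 0) := by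
  change (a.1 * weylSU2.1) 1 0 = _
  rw [weylSU2_coe, Matrix.mul_apply, Fin.sum_univ_two, SU2.apply_one_one]
  simp

theorem hopf_mul_weyl (a : SU2) : hopf (a * weylSU2) = -hopf a := by
  apply Subtype.ext
  ext i
  simp only [hopf, mul_weyl_zero_zero, mul_weyl_one_zero]
  fin_cases i
  · change _ = -((a.1 0 0).re ^ 2 + (a.1 0 0).im ^ 2 - (a.1 1 0).re ^ 2 - (a.1 1 0).im ^ 2)
    simp; ring
  · change _ = -(2 * ((a.1 0 0).re * (a.1 1 0).re + (a.1 0 0).im * (a.1 1 0).im))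
    simp; ring
  · change _ = -(2 * ((a.1 0 0).re * (a.1 1 0).im - (a.1 0 0).im * (a.1 1 0).re))
    simp; ring

theorem hopf_eq_iff (a b : SU2) : hopf a = hopf b ↔ (a⁻¹ * b).1 1 0 = 0 := by
  constructor
  · intro h
    rw [SU2.inv_mul_one_zero, Complex.ext_iff]
    have ha := SU2.sq_sum a
    have hb := SU2.sq_sum b
    rw [Subtype.ext_iff] at h
    simp only [Complex.sub_re, Complex.mul_re, Complex.sub_im, Complex.mul_im, Complex.zero_re,
      Complex.zero_im]
    have h0 : (a.1 0 0).re ^ 2 + (a.1 0 0).im ^ 2 - (a.1 1 0).re ^ 2 - (a.1 1 0).im ^ 2 =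
        (b.1 0 0).re ^ 2 + (b.1 0 0).im ^ 2 - (b.1 1 0).re ^ 2 - (b.1 1 0).im ^ 2 :=
      congrArg (fun v => v.ofLp 0) h
    have h1 : 2 * ((a.1 0 0).re * (a.1 1 0).re + (a.1 0 0).im * (a.1 1 0).im) =
        2 * ((b.1 0 0).re * (b.1 1 0).re + (b.1 0 0).im * (b.1 1 0).im) :=
      congrArg (fun v => v.ofLp 1) h
    have h2 : 2 * ((a.1 0 0).re * (a.1 1 0).im - (a.1 0 0).im * (a.1 1 0).re) =
        2 * ((b.1 0 0).re * (b.1 1 0).im - (b.1 0 0).im * (b.1 1 0).re) :=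
      congrArg (fun v => v.ofLp 2) h
    generalize (a.1 0 0).re = q0 at *
    generalize (a.1 0 0).im = q1 at *
    generalize (a.1 1 0).re = q2 at *
    generalize (a.1 1 0).im = q3 at *
    generalize (b.1 0 0).re = r0 at *
    generalize (b.1 0 0).im = r1 at *
    generalize (b.1 1 0).re = r2 at *
    generalize (b.1 1 0).im = r3 at *
    -- The left side is |a₀b₁ - a₁b₀|², the squared modulus of the lower left entry of a⁻¹b. Its
    -- expansion involves only |a₀|², |a₁|² and ā₀a₁ and the same quantities for b, all of which the
    -- Hopf map determines.
    have key : (q0 * r2 - q1 * r3 - (q2 * r0 - q3 * r1)) ^ 2 +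
        (q0 * r3 + q1 * r2 - (q2 * r1 + q3 * r0)) ^ 2 = 0 := by
      have e1 : q0 ^ 2 + q1 ^ 2 = r0 ^ 2 + r1 ^ 2 := by linarith
      have e2 : q2 ^ 2 + q3 ^ 2 = r2 ^ 2 + r3 ^ 2 := by linarith
      have e3 : q0 * q2 + q1 * q3 = r0 * r2 + r1 * r3 := by linarith
      have e4 : q0 * q3 - q1 * q2 = r0 * r3 - r1 * r2 := by linarith
      linear_combination (r2 ^ 2 + r3 ^ 2) * e1 + (r0 ^ 2 + r1 ^ 2) * e2
        - 2 * (r0 * r2 + r1 * r3) * e3 - 2 * (r0 * r3 - r1 * r2) * e4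
    constructor <;> nlinarith
  · intro h
    obtain ⟨t, ht⟩ := exists_expSU2_diag h
    rw [← mul_inv_cancel_left a b, ht, hopf_mul_diag]

/-- Right multiplication by the Weyl element is the antipodal map on S², so this is the coset
criterion after one Weyl translation. -/
theorem hopf_eq_neg_iff (a b : SU2) : hopf b = -hopf a ↔ (a⁻¹ * b).1 0 0 = 0 := by
  rw [eq_comm, neg_eq_iff_eq_neg, ← hopf_mul_weyl, hopf_eq_iff, ← mul_assoc, mul_weyl_one_zero,
    map_eq_zero]

/-- The stereographic parametrisation `w ↦ (1, w) / |(1, w)|` of the cosets of the torus. -/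
def stereoSU2 (w : ℂ) : SU2 := gnomonic ![0, w.re, w.im]

theorem stereoSU2_zero_zero (w : ℂ) :
    (stereoSU2 w).1 0 0 = ((√(1 + w.re ^ 2 + w.im ^ 2))⁻¹ : ℝ) := by
  rw [stereoSU2, gnomonic_zero_zero]
  apply Complex.ext <;> simp

theorem stereoSU2_one_zero (w : ℂ) :
    (stereoSU2 w).1 1 0 = ((√(1 + w.re ^ 2 + w.im ^ 2))⁻¹ : ℝ) * w := by
  rw [stereoSU2, gnomonic_one_zero]
  apply Complex.ext <;> simp

/-- The inverse of the stereographic projection. -/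
def stereoVec (w : ℂ) : EuclideanSpace ℝ (Fin 3) :=
  !₂[(1 - w.re ^ 2 - w.im ^ 2) / (1 + w.re ^ 2 + w.im ^ 2),
    2 * w.re / (1 + w.re ^ 2 + w.im ^ 2), 2 * w.im / (1 + w.re ^ 2 + w.im ^ 2)]

theorem hopf_stereoSU2 (w : ℂ) : (hopf (stereoSU2 w)).1 = stereoVec w := by
  have h0 : 0 < 1 + w.re ^ 2 + w.im ^ 2 := by positivity
  have h1 : (√(1 + w.re ^ 2 + w.im ^ 2))⁻¹ ^ 2 = (1 + w.re ^ 2 + w.im ^ 2)⁻¹ := by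
    rw [inv_pow, Real.sq_sqrt h0.le]
  simp only [hopf, stereoVec, stereoSU2_zero_zero, stereoSU2_one_zero, Complex.ofReal_re,
    Complex.ofReal_im, Complex.re_ofReal_mul, Complex.im_ofReal_mul]
  generalize (√(1 + w.re ^ 2 + w.im ^ 2))⁻¹ = c at *
  rw [div_eq_mul_inv, div_eq_mul_inv, div_eq_mul_inv, ← h1]
  ext i; fin_cases i
  · simp; ring
  · simp; ring
  · simp; ring

/-- The stereographic projection. -/
def stereoCoord (v : EuclideanSpace ℝ (Fin 3)) : ℂ := ⟨v 1 / (1 + v 0), v 2 / (1 + v 0)⟩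

theorem sphere_two_eq (p : USphere 2) : p.1 0 ^ 2 + p.1 1 ^ 2 + p.1 2 ^ 2 = 1 := by
  have h' : ‖p.1‖ = 1 := mem_sphere_zero_iff_norm.mp p.2
  have h2 := EuclideanSpace.real_norm_sq_eq p.1
  rw [h', Fin.sum_univ_three] at h2
  linarith

theorem stereoVec_stereoCoord {p : USphere 2} (hp : p.1 0 ≠ -1) :
    stereoVec (stereoCoord p.1) = p.1 := by
  have h := sphere_two_eq p
  have h1 : 1 + p.1 0 ≠ 0 := fun h => hp (by linarith)
  have h2 : 1 + (stereoCoord p.1).re ^ 2 + (stereoCoord p.1).im ^ 2 = 2 / (1 + p.1 0) := by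
    simp only [stereoCoord]
    field_simp
    linarith
  have h3 : 1 - (stereoCoord p.1).re ^ 2 - (stereoCoord p.1).im ^ 2 = 2 * p.1 0 / (1 + p.1 0) := by
    simp only [stereoCoord]
    field_simp
    linarith
  rw [stereoVec, h2, h3]
  ext i; fin_cases i
  · simp; field_simp
  · simp [stereoCoord]; field_simp
  · simp [stereoCoord]; field_simp

/-- The half-turn of the sphere induced by the Weyl element. -/
def halfTurn : EuclideanSpace ℝ (Fin 3) →L[ℝ] EuclideanSpace ℝ (Fin 3) :=
  LinearMap.toContinuousLinearMap
    { toFun := fun v => !₂[-v 0, -v 1, v 2]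
      map_add' := fun a b => by ext i; fin_cases i <;> simp [add_comm]
      map_smul' := fun c a => by ext i; fin_cases i <;> simp }

theorem halfTurn_apply (v : EuclideanSpace ℝ (Fin 3)) : halfTurn v = !₂[-v 0, -v 1, v 2] := rfl

theorem halfTurn_halfTurn (v : EuclideanSpace ℝ (Fin 3)) : halfTurn (halfTurn v) = v := by
  ext i; fin_cases i <;> simp [halfTurn_apply]

/-- Left translation by the Weyl element rotates S² and interchanges the poles, so it carries the
stereographic chart to a second one around the missing point. -/
theorem hopf_weyl_mul (a : SU2) : (hopf (weylSU2 * a)).1 = halfTurn (hopf a).1 := by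
  have h0 : (weylSU2 * a).1 0 0 = -a.1 1 0 := by
    change (weylSU2.1 * a.1) 0 0 = _
    rw [weylSU2_coe, Matrix.mul_apply, Fin.sum_univ_two]; simp
  have h1 : (weylSU2 * a).1 1 0 = a.1 0 0 := by
    change (weylSU2.1 * a.1) 1 0 = _
    rw [weylSU2_coe, Matrix.mul_apply, Fin.sum_univ_two]; simp
  rw [halfTurn_apply]
  simp only [hopf, h0, h1]
  ext i; fin_cases i
  · simp; ring
  · simp; ring
  · simp; ring

theorem hopf_stereo_of_ne {p : USphere 2} (hp : p.1 0 ≠ -1) :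
    hopf (stereoSU2 (stereoCoord p.1)) = p :=
  Subtype.ext ((hopf_stereoSU2 _).trans (stereoVec_stereoCoord hp))

theorem halfTurn_mem (p : USphere 2) : halfTurn p.1 ∈ Metric.sphere (0 : EuclideanSpace ℝ (Fin 3)) 1 := by
  have h := sphere_two_eq p
  rw [mem_sphere_zero_iff_norm, EuclideanSpace.norm_eq, Real.sqrt_eq_one, Fin.sum_univ_three,
    halfTurn_apply]
  simpa using h

theorem hopf_weyl_stereo_of_ne {p : USphere 2} (hp : p.1 0 ≠ 1) :
    hopf (weylSU2 * stereoSU2 (stereoCoord (halfTurn p.1))) = p := by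
  have h1 : (⟨halfTurn p.1, halfTurn_mem p⟩ : USphere 2).1 0 ≠ -1 := by
    change (halfTurn p.1) 0 ≠ -1
    rw [halfTurn_apply]
    simpa using hp
  apply Subtype.ext
  rw [hopf_weyl_mul]
  have h2 := congrArg Subtype.val (hopf_stereo_of_ne h1)
  exact (congrArg halfTurn h2).trans (halfTurn_halfTurn p.1)

theorem hopf_surjective : Function.Surjective hopf := fun p => by
  by_cases hp : p.1 0 = -1
  · exact ⟨_, hopf_weyl_stereo_of_ne (p := p) (by rw [hp]; norm_num)⟩
  · exact ⟨_, hopf_stereo_of_ne hp⟩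

/-- Every element of `𝔰𝔲(2)` is conjugate to a diagonal one. -/
theorem exists_adSU2_eq_diag {η : su2} (hη : η ≠ 0) :
    ∃ (a : SU2) (r : ℝ), r ≠ 0 ∧ adSU2 a η = r • diagSU2 := by
  obtain ⟨r, hr, h⟩ := exists_su2_norm hη
  have key : ∀ c : Fin 3 → ℝ, c 0 ^ 2 + c 1 ^ 2 + c 2 ^ 2 = 1 → c 0 ≠ -1 →
      ∃ a : SU2, adSU2 a (su2Coord.symm c) = diagSU2 := by
    intro c hc hc0
    have h1 : 0 < 1 + c 0 := by
      rcases lt_or_gt_of_ne hc0 with h1 | h1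
      · nlinarith [sq_nonneg (c 1), sq_nonneg (c 2)]
      · linarith
    -- `b` is the unit bisector of c and the first axis, and |c + e₀|² = 2(1 + c₀). Since exp(πb/2)
    -- = b, conjugation is the half-turn about the bisector, which exchanges c and e₀. Only c = -e₀
    -- has no such bisector; there a negative multiple of the generator is used.
    let n : ℝ := √(2 * (1 + c 0))
    have hn : n ^ 2 = 2 * (1 + c 0) := Real.sq_sqrt (by linarith)
    have hn0 : n ≠ 0 := (Real.sqrt_pos.2 (by linarith)).ne'
    let b : su2 := n⁻¹ • su2Coord.symm ![1 + c 0, c 1, c 2]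
    have hb : su2Coord b 0 ^ 2 + su2Coord b 1 ^ 2 + su2Coord b 2 ^ 2 = 1 := by
      simp only [b, map_smul, LinearEquiv.apply_symm_apply, Pi.smul_apply, smul_eq_mul,
        Matrix.cons_val_zero, Matrix.cons_val_one, Matrix.cons_val]
      field_simp
      rw [hn]
      linear_combination hc
    refine ⟨expSU2 ((Real.pi / 2) • b), Subtype.ext ?_⟩
    rw [adSU2_coe]
    have h2 : (expSU2 ((Real.pi / 2) • b)).1 * (su2Coord.symm c).1 =
        diagSU2.1 * (expSU2 ((Real.pi / 2) • b)).1 := by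
      rw [expSU2_pi_div_two hb]
      have hcc : (c 0 : ℂ) ^ 2 + (c 1 : ℂ) ^ 2 + (c 2 : ℂ) ^ 2 = 1 := by exact_mod_cast hc
      change (n⁻¹ • (su2Coord.symm ![1 + c 0, c 1, c 2]).1) * _ =
        _ * (n⁻¹ • (su2Coord.symm ![1 + c 0, c 1, c 2]).1)
      rw [smul_mul_assoc, mul_smul_comm]
      congr 1
      rw [diagSU2, su2Coord_symm_coe, su2Coord_symm_coe, su2Coord_symm_coe]
      ext i j
      fin_cases i <;> fin_cases j <;>
        simp [Matrix.mul_apply, Fin.sum_univ_two, Complex.ext_iff] <;> constructor <;>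
        first | linear_combination -hc | linear_combination hc | ring
    rw [h2, mul_assoc]
    have h3 : (expSU2 ((Real.pi / 2) • b)).1 * ((expSU2 ((Real.pi / 2) • b))⁻¹).1 = 1 :=
      congrArg Subtype.val (mul_inv_cancel (expSU2 ((Real.pi / 2) • b)))
    rw [h3, mul_one]
  have hunit : (su2Coord η 0 / r) ^ 2 + (su2Coord η 1 / r) ^ 2 + (su2Coord η 2 / r) ^ 2 = 1 := by
    field_simp
    exact h
  by_cases hc : su2Coord η 0 / r = -1
  · refine ⟨1, -r, neg_ne_zero.2 hr.ne', ?_⟩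
    rw [adSU2_one]
    apply su2Coord.injective
    rw [hc] at hunit
    have h1 : su2Coord η 1 / r = 0 := by nlinarith [sq_nonneg (su2Coord η 1 / r), sq_nonneg (su2Coord η 2 / r)]
    have h2 : su2Coord η 2 / r = 0 := by nlinarith [sq_nonneg (su2Coord η 1 / r), sq_nonneg (su2Coord η 2 / r)]
    rw [div_eq_iff hr.ne'] at hc h1 h2
    ext i
    fin_cases i
    · simp [diagSU2, hc]
    · simp [diagSU2, h1]
    · simp [diagSU2, h2]
  · obtain ⟨a, ha⟩ := key ![su2Coord η 0 / r, su2Coord η 1 / r, su2Coord η 2 / r] hunit hc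
    refine ⟨a, r, hr.ne', ?_⟩
    rw [← ha, ← map_smul]
    congr 1
    apply su2Coord.injective
    ext i
    fin_cases i <;> simp <;> field_simp

/-! ### Automorphisms fixing an isotropic plane -/

namespace NearlyKahler

variable {M : Type*} [TopologicalSpace M] [ChartedSpace E6 M] [IsManifold (𝓡 6) ∞ M]
  [MulAction SU2 M] {S : NearlyKahler M} (hact : S.IsAutomorphicAction)
include hact

/-- The differential D is a complex linear involution preserving ψ and fixing k₀, k₁. A vector u =
Dw - w satisfies Du = -u, so ψ(k₀,k₁,u) equals its own negative and vanishes. As k₀, k₁ are complex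
independent by isotropy, u lies in their complex span, on which D is the identity; hence u = 0. -/
theorem actDeriv_eq_self_of_isotropic {x : M} {a : SU2} (hx : a • x = x) (ha : a * a = 1)
    {k : Fin 2 → E6} (hk : LinearIndependent ℝ k) (hiso : ∀ i j, S.omega.ev x ![k i, k j] = 0)
    (hak : ∀ i, actDeriv a x (k i) = k i) (w : E6) : actDeriv a x w = w := by
  obtain ⟨e, hω, hJ, hψ⟩ := S.exists_frame x
  set D := actDeriv a x
  have hDD : ∀ v, D (D v) = v := fun v => by
    have h1 : ∀ y, y = x → actDeriv a y (D v) = D (D v) := by rintro y rfl; rfl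
    rw [← h1 _ hx, ← actDeriv_mul hact.smooth, ha, actDeriv_one]
  have hDJ : ∀ v, D (S.jMap x v) = S.jMap x (D v) := fun v => by
    have h1 : ∀ y, y = x → S.jMap y (D v) = S.jMap x (D v) := by rintro y rfl; rfl
    exact (hact.map_J a x v).symm.trans (h1 _ hx)
  have hDψ : ∀ v : Fin 3 → E6, S.psi.ev x (fun i => D (v i)) = S.psi.ev x v := fun v => by
    have h1 : ∀ y, y = x → S.psi.ev y (fun i => D (v i)) = S.psi.ev x (fun i => D (v i)) := by
      rintro y rfl; rfl
    exact (h1 _ hx).symm.trans (hact.map_psi a x v)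
  have hDe : ∀ (c : ℂ) (v : E6), D (e.symm (c • e v)) = e.symm (c • e (D v)) := fun c v => by
    have h1 : ∀ v : E6, e.symm (c • e v) = c.re • v + c.im • S.jMap x v := fun v => by
      apply e.injective
      rw [e.apply_symm_apply, map_add, map_smul, map_smul, hJ]
      ext i
      simp only [Pi.smul_apply, Pi.add_apply, Complex.real_smul, smul_eq_mul]
      conv_lhs => rw [← Complex.re_add_im c]
      ring
    rw [h1, h1, map_add, map_smul, map_smul, hDJ]
  set u := D w - w with hu
  have hDu : D u = -u := by rw [hu, map_sub, hDD, neg_sub]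
  have hψu : S.psi.ev x ![k 0, k 1, u] = 0 := by
    have h1 := hDψ ![k 0, k 1, u]
    have h2 : (fun i => D (![k 0, k 1, u] i)) = ![k 0, k 1, -u] := by
      ext i : 1; fin_cases i
      · exact hak 0
      · exact hak 1
      · exact hDu
    have h3 : S.psi.ev x ![k 0, k 1, -u] = -S.psi.ev x ![k 0, k 1, u] := by
      have := (S.psi.ev x).toAlternatingMap.map_update_neg ![k 0, k 1, u] 2 u
      have e1 : Function.update ![k 0, k 1, u] 2 (-u) = ![k 0, k 1, -u] := by
        ext i : 1; fin_cases i <;> rfl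
      have e2 : Function.update ![k 0, k 1, u] 2 u = ![k 0, k 1, u] := by
        ext i : 1; fin_cases i <;> rfl
      rw [e1, e2] at this
      exact this
    rw [h2, h3] at h1
    exact self_eq_neg.1 h1.symm
  rw [hψ] at hψu
  obtain ⟨c, hc0, hc⟩ := Matrix.exists_vecMul_eq_zero_iff.2 hψu
  have hc' : ∀ j, c 0 * e (k 0) j + c 1 * e (k 1) j + c 2 * e u j = 0 := fun j => by
    have := congrFun hc j
    simpa [Matrix.vecMul, dotProduct, Fin.sum_univ_three] using this
  have hc2 : c 2 ≠ 0 := by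
    intro h2
    have h3 : (fun i : Fin 2 => c i.castSucc) = 0 := by
      refine S.eq_zero_of_isotropic hω hk hiso fun j => ?_
      have := hc' j
      rw [h2, zero_mul, add_zero] at this
      rw [Fin.sum_univ_two]
      exact this
    apply hc0
    ext i : 1
    fin_cases i
    · exact congrFun h3 0
    · exact congrFun h3 1
    · exact h2
  have hu' : u = e.symm ((-(c 0) / c 2) • e (k 0)) + e.symm ((-(c 1) / c 2) • e (k 1)) := by
    apply e.injective
    rw [map_add, e.apply_symm_apply, e.apply_symm_apply]
    ext j
    simp only [Pi.add_apply, Pi.smul_apply, smul_eq_mul]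
    field_simp
    linear_combination hc' j
  have hDu' : D u = u := by
    rw [hu', map_add, hDe, hDe, hak, hak]
  have h0 : (2 : ℝ) • u = 0 := by
    rw [two_smul]
    exact eq_neg_iff_add_eq_zero.1 (hDu'.symm.trans hDu)
  exact sub_eq_zero.1 ((smul_eq_zero.1 h0).resolve_left two_ne_zero)

end NearlyKahler

/-! ### Involutions with trivial differential at a fixed point -/

section Involution

/-- The map H = G - id is ½-Lipschitz near y₀. For an involution H(y) - H(Gy) = 2(Gy - y), so 2|Gy -
y| ≤ ½|Gy - y|. -/
theorem eventually_eq_self_of_involution {E : Type*} [NormedAddCommGroup E] [NormedSpace ℝ E]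
    {G : E → E} {y₀ : E} (hG : ContDiffAt ℝ 1 G y₀) (h0 : G y₀ = y₀)
    (hd : fderiv ℝ G y₀ = ContinuousLinearMap.id ℝ E) (hGG : ∀ᶠ y in 𝓝 y₀, G (G y) = y) :
    ∀ᶠ y in 𝓝 y₀, G y = y := by
  have hs : HasStrictFDerivAt G (ContinuousLinearMap.id ℝ E) y₀ := by
    rw [← hd]; exact hG.hasStrictFDerivAt (by simp)
  have hH : HasStrictFDerivAt (fun y => G y - y) (0 : E →L[ℝ] E) y₀ := by
    have := hs.sub (hasStrictFDerivAt_id y₀)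
    rwa [sub_self] at this
  have hlip := hH.isLittleO.def (c := 1 / 2) (by norm_num)
  have hpair : Filter.Tendsto (fun y => (y, G y)) (𝓝 y₀) (𝓝 (y₀, y₀)) := by
    have h1 : Filter.Tendsto G (𝓝 y₀) (𝓝 y₀) := by
      have := hG.continuousAt.tendsto
      rwa [h0] at this
    exact Filter.tendsto_id.prodMk_nhds h1
  filter_upwards [hGG, hpair.eventually hlip] with y hy hy2
  simp only [zero_apply, sub_zero, hy] at hy2
  have h1 : G y - y - (y - G y) = (2 : ℝ) • (G y - y) := by rw [two_smul]; abel
  rw [h1, norm_smul, norm_sub_rev y (G y)] at hy2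
  have h2 : ‖G y - y‖ = 0 := by
    have := norm_nonneg (G y - y)
    norm_num at hy2
    linarith
  exact sub_eq_zero.1 (norm_eq_zero.1 h2)

variable {M : Type*} [TopologicalSpace M] [ChartedSpace E6 M] [MulAction SU2 M]
  (h : IsSmoothAction M) [IsManifold (𝓡 6) ∞ M]
include h

/-- An involution of a connected manifold whose differential at a fixed point is trivial is
trivial. -/
theorem smul_eq_self_of_actDeriv_eq_self [T2Space M] [ConnectedSpace M] {a : SU2} (ha : a * a = 1)
    {x : M} (hx : a • x = x) (hd : ∀ w, actDeriv a x w = w) (z : M) : a • z = z := by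
  let G : M → E6 → E6 := fun z y => chartAt E6 z (a • (chartAt E6 z).symm y)
  have hcont : Continuous fun z : M => a • z := (h.contMDiff_smul a).continuous
  have hGd : ∀ z : M, a • z = z → ContDiffAt ℝ 2 (G z) (chartAt E6 z z) := fun z hz => by
    rw [← contMDiffAt_iff_contDiffAt]
    have h1 : ContMDiffAt (𝓡 6) (𝓡 6) 2 (chartAt E6 z).symm (chartAt E6 z z) :=
      contMDiffOn_chart_symm.contMDiffAt ((chartAt E6 z).open_target.mem_nhds (mem_chart_target E6 z))
    have h2 : ContMDiffAt (𝓡 6) (𝓡 6) 2 (fun w : M => a • w)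
        ((chartAt E6 z).symm (chartAt E6 z z)) :=
      ((h.contMDiff_smul a).of_le (by exact WithTop.coe_le_coe.2 le_top)) _
    have h3 : ContMDiffAt (𝓡 6) (𝓡 6) 2 (chartAt E6 z)
        (a • (chartAt E6 z).symm (chartAt E6 z z)) := by
      rw [(chartAt E6 z).left_inv (mem_chart_source E6 z), hz]
      exact contMDiffAt_of_mem_maximalAtlas (IsManifold.chart_mem_maximalAtlas z)
        (mem_chart_source E6 z)
    exact h3.comp (chartAt E6 z z) (h2.comp (chartAt E6 z z) h1)
  have hG0 : ∀ z : M, a • z = z → G z (chartAt E6 z z) = chartAt E6 z z := fun z hz => by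
    simp only [G]
    rw [(chartAt E6 z).left_inv (mem_chart_source E6 z), hz]
  have hlocal : ∀ z : M, a • z = z → fderiv ℝ (G z) (chartAt E6 z z) = ContinuousLinearMap.id ℝ E6 →
      ∀ᶠ w in 𝓝 z, a • w = w := fun z hz hdz => by
    have hsrc : ∀ᶠ w in 𝓝 z, w ∈ (chartAt E6 z).source :=
      (chartAt E6 z).open_source.mem_nhds (mem_chart_source E6 z)
    have hasrc : ∀ᶠ w in 𝓝 z, a • w ∈ (chartAt E6 z).source :=
      hcont.continuousAt.eventually_mem (by
        rw [hz]; exact (chartAt E6 z).open_source.mem_nhds (mem_chart_source E6 z))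
    have hsymm : Filter.Tendsto (chartAt E6 z).symm (𝓝 (chartAt E6 z z)) (𝓝 z) := by
      have := ((chartAt E6 z).continuousAt_symm (mem_chart_target E6 z)).tendsto
      rwa [(chartAt E6 z).left_inv (mem_chart_source E6 z)] at this
    have hGG : ∀ᶠ y in 𝓝 (chartAt E6 z z), G z (G z y) = y := by
      filter_upwards [hsymm.eventually hasrc,
        (chartAt E6 z).open_target.mem_nhds (mem_chart_target E6 z)] with y hy1 hy2
      simp only [G]
      rw [(chartAt E6 z).left_inv hy1, smul_smul, ha, one_smul, (chartAt E6 z).right_inv hy2]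
    have h1 := eventually_eq_self_of_involution ((hGd z hz).of_le (by norm_num)) (hG0 z hz) hdz hGG
    filter_upwards [hsrc, hasrc, ((chartAt E6 z).continuousAt (mem_chart_source E6 z)).tendsto.eventually h1]
      with w hw haw hGw
    simp only [G] at hGw
    rw [(chartAt E6 z).left_inv hw] at hGw
    exact (chartAt E6 z).injOn haw hw hGw
  have hx' : fderiv ℝ (G x) (chartAt E6 x x) = ContinuousLinearMap.id ℝ E6 := by
    have hch := mdifferentiable_chart (I := 𝓡 6) x
    have hs0 : (chartAt E6 x).symm (chartAt E6 x x) = x :=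
      (chartAt E6 x).left_inv (mem_chart_source E6 x)
    refine ContinuousLinearMap.ext fun v => ?_
    have hsd := hch.symm.mdifferentiableAt (mem_chart_target E6 x)
    have hcd := hch.mdifferentiableAt (mem_chart_source E6 x)
    have had := mdifferentiableAt_smul h a x
    have h1 := mfderiv_comp_apply_of_base (g := fun w : M => a • w) hs0 had hsd v
    have h2 := mfderiv_comp_apply_of_base (g := chartAt E6 x)
      (f := (fun w : M => a • w) ∘ (chartAt E6 x).symm) (y := chartAt E6 x x) (x := x)
      (by simp only [Function.comp_apply]; rw [hs0, hx]) hcd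
      (MDifferentiableAt.comp (chartAt E6 x x) (by rw [hs0]; exact had) hsd) v
    have h3 := mfderiv_comp_apply_of_base (g := chartAt E6 x) hs0 hcd hsd v
    have h4 : chartAt E6 x ∘ (chartAt E6 x).symm =ᶠ[𝓝 (chartAt E6 x x)] id := by
      filter_upwards [(chartAt E6 x).open_target.mem_nhds (mem_chart_target E6 x)] with y hy
      exact (chartAt E6 x).right_inv hy
    have h5 := hd ((mfderiv (𝓡 6) (𝓡 6) (chartAt E6 x).symm (chartAt E6 x x) : E6 →L[ℝ] E6) v)
    rw [← mfderiv_eq_fderiv]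
    refine h2.trans ?_
    rw [h1]
    refine Eq.trans (congrArg _ h5) ?_
    rw [← h3, h4.mfderiv_eq, mfderiv_id]
    rfl
  -- `A` is the interior of the fixed point set. At a limit point the element still acts trivially
  -- and, by continuity of the first derivative, its differential in the chart is still the
  -- identity; the local result makes `A` closed as well as open.
  let A : Set M := {z | ∀ᶠ w in 𝓝 z, a • w = w}
  have hAo : IsOpen A := isOpen_setOfPred_eventually_nhds
  have hAc : IsClosed A := by
    refine isClosed_of_closure_subset fun z hz => ?_
    rw [mem_closure_iff_frequently] at hz
    have hfix : a • z = z := by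
      have hcl : IsClosed {w : M | a • w = w} := isClosed_eq hcont continuous_id
      refine hcl.closure_subset (mem_closure_iff_frequently.2 (hz.mono fun w hw => ?_))
      exact (show ∀ᶠ w in 𝓝 w, a • w = w from hw).self_of_nhds
    refine hlocal z hfix ?_
    by_contra hne
    have hcf : ContinuousAt (fderiv ℝ (G z)) (chartAt E6 z z) :=
      ((hGd z hfix).fderiv_right (m := 1) (by norm_num)).continuousAt
    have h1 : ∀ᶠ y in 𝓝 (chartAt E6 z z), fderiv ℝ (G z) y ≠ ContinuousLinearMap.id ℝ E6 :=
      hcf.eventually_ne hne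
    have h2 := ((chartAt E6 z).continuousAt (mem_chart_source E6 z)).tendsto.eventually h1
    have hsrc : ∀ᶠ w in 𝓝 z, w ∈ (chartAt E6 z).source :=
      (chartAt E6 z).open_source.mem_nhds (mem_chart_source E6 z)
    obtain ⟨w, hw, hw2, hws⟩ := (hz.and_eventually (h2.and hsrc)).exists
    refine hw2 ?_
    have hsymm : Filter.Tendsto (chartAt E6 z).symm (𝓝 (chartAt E6 z w)) (𝓝 w) := by
      have := ((chartAt E6 z).continuousAt_symm ((chartAt E6 z).map_source hws)).tendsto
      rwa [(chartAt E6 z).left_inv hws] at this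
    have h3 : G z =ᶠ[𝓝 (chartAt E6 z w)] id := by
      filter_upwards [hsymm.eventually hw,
        (chartAt E6 z).open_target.mem_nhds ((chartAt E6 z).map_source hws)] with y hy hyt
      simp only [G, id]
      rw [hy, (chartAt E6 z).right_inv hyt]
    rw [h3.fderiv_eq, fderiv_id]
  have hA : A = Set.univ := IsClopen.eq_univ ⟨hAc, hAo⟩ ⟨x, hlocal x hx hx'⟩
  have hz : z ∈ A := hA.symm ▸ Set.mem_univ z
  exact (show ∀ᶠ w in 𝓝 z, a • w = w from hz).self_of_nhds

end Involution

/-! ### Two-dimensional orbits -/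

section SphereOrbit

variable {M : Type*} [TopologicalSpace M] [ChartedSpace E6 M] [MulAction SU2 M]

omit [TopologicalSpace M] [ChartedSpace E6 M] in
theorem smul_eq_smul_of_hopf_eq {x : M} (hx : ∀ t : ℝ, expSU2 (t • diagSU2) • x = x) {a b : SU2}
    (hab : hopf a = hopf b) : a • x = b • x := by
  obtain ⟨t, ht⟩ := exists_expSU2_diag ((hopf_eq_iff a b).1 hab)
  rw [← mul_inv_cancel_left a b, ht, mul_smul, hx]

/-- The parametrisation of the orbit of `x` by `S²`. -/
def sphereOrbit (x : M) (p : USphere 2) : M := Function.surjInv hopf_surjective p • x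

omit [TopologicalSpace M] [ChartedSpace E6 M] in
theorem sphereOrbit_hopf {x : M} (hx : ∀ t : ℝ, expSU2 (t • diagSU2) • x = x) (a : SU2) :
    sphereOrbit x (hopf a) = a • x :=
  smul_eq_smul_of_hopf_eq hx (Function.surjInv_eq hopf_surjective _)

omit [TopologicalSpace M] [ChartedSpace E6 M] in
theorem range_sphereOrbit {x : M} (hx : ∀ t : ℝ, expSU2 (t • diagSU2) • x = x) :
    Set.range (sphereOrbit x) = MulAction.orbit SU2 x := by
  ext y
  constructor
  · rintro ⟨p, rfl⟩
    exact ⟨_, rfl⟩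
  · rintro ⟨a, rfl⟩
    exact ⟨hopf a, sphereOrbit_hopf hx a⟩

variable (h : IsSmoothAction M)
include h

theorem infAct_diag {x : M} (h0 : fundVec diagSU2 x = 0) : infAct x ![1, 0, 0] = 0 := by
  rw [fundVec_eq h, diagSU2, su2Coord.apply_symm_apply] at h0
  exact h0

/-- The kernel is invariant under the adjoint action of the stabiliser, and exp(π/4 · diag) acts as
a quarter turn on the last two coordinates. -/
theorem adSU2_diag_mem_ker {x : M} (hx : ∀ t : ℝ, expSU2 (t • diagSU2) • x = x) {c : Fin 3 → ℝ}
    (hc : infAct x c = 0) : infAct x ![c 0, c 2, -c 1] = 0 := by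
  have h1 := fundVec_adSU2 h (expSU2 ((Real.pi / 4) • diagSU2)) (su2Coord.symm c) x
  rw [fundVec_eq h _ x, su2Coord.apply_symm_apply, hc, map_zero, hx, fundVec_eq h] at h1
  rw [← h1]
  congr 1
  apply su2Coord.symm.injective
  rw [su2Coord.symm_apply_apply]
  apply Subtype.ext
  rw [adSU2_coe, SU2.inv_coe, expSU2_diag, su2Coord_symm_coe, su2Coord_symm_coe,
    Real.cos_pi_div_four, Real.sin_pi_div_four]
  have h2 : (√2 / 2) * (√2 / 2) = 1 / 2 := by
    rw [div_mul_div_comm, Real.mul_self_sqrt (by norm_num)]; norm_num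
  generalize √2 / 2 = r at h2
  ext i j
  fin_cases i <;> fin_cases j <;>
    simp [Matrix.mul_apply, Fin.sum_univ_two, Complex.ext_iff] <;>
    (try refine ⟨?_, ?_⟩) <;>
    first
    | (linear_combination (-2 * c 0) * h2)
    | (linear_combination (2 * c 0) * h2)
    | (linear_combination (-2 * c 1) * h2)
    | (linear_combination (2 * c 1) * h2)
    | (linear_combination (-2 * c 2) * h2)
    | (linear_combination (2 * c 2) * h2)

/-- Any further kernel vector and its quarter turn span, together with the torus direction, the
whole Lie algebra. So a one-dimensional orbit cannot occur. -/
theorem infAct_ker_of_ne_zero {x : M} (hx : ∀ t : ℝ, expSU2 (t • diagSU2) • x = x)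
    (h0 : fundVec diagSU2 x = 0) (hne : infAct x ≠ 0) (c : Fin 3 → ℝ) (hc : infAct x c = 0) :
    c 1 = 0 ∧ c 2 = 0 := by
  by_contra hcon
  have hpos : 0 < c 1 ^ 2 + c 2 ^ 2 := by
    rcases not_and_or.1 hcon with h1 | h1 <;> positivity
  apply hne
  refine ContinuousLinearMap.ext fun b => ?_
  have h1 := infAct_diag h h0
  have h2 := adSU2_diag_mem_ker h hx hc
  have h3 : b = (b 0 - (b 1 * c 1 + b 2 * c 2) / (c 1 ^ 2 + c 2 ^ 2) * c 0
        - (b 1 * c 2 - b 2 * c 1) / (c 1 ^ 2 + c 2 ^ 2) * c 0) • ![1, 0, 0] +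
      ((b 1 * c 1 + b 2 * c 2) / (c 1 ^ 2 + c 2 ^ 2)) • c +
      ((b 1 * c 2 - b 2 * c 1) / (c 1 ^ 2 + c 2 ^ 2)) • ![c 0, c 2, -c 1] := by
    ext i
    simp only [Pi.add_apply, Pi.smul_apply, smul_eq_mul]
    fin_cases i
    · simp; ring
    · simp; field_simp; ring
    · simp; field_simp; ring
  rw [h3, map_add, map_add, map_smul, map_smul, map_smul, h1, hc, h2]
  simp

/-- If the kernel of the infinitesimal action is the diagonal torus, then the stabiliser is
contained in the normaliser of the torus. -/
theorem mem_stabilizer_diag {x : M} (hx : ∀ t : ℝ, expSU2 (t • diagSU2) • x = x)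
    (h0 : fundVec diagSU2 x = 0) (hker : ∀ c, infAct x c = 0 → c 1 = 0 ∧ c 2 = 0) {s : SU2}
    (hs : s • x = x) : s.1 1 0 = 0 ∨ (s.1 0 0 = 0 ∧ weylSU2 • x = x) := by
  have h1 := fundVec_adSU2 h s diagSU2 x
  rw [h0, map_zero, hs, fundVec_eq h] at h1
  obtain ⟨h2, h3⟩ := hker _ h1
  have h4 : (adSU2 s diagSU2).1 1 0 = 2 * Complex.I * s.1 1 0 * starRingEnd ℂ (s.1 0 0) := by
    rw [adSU2_coe, diagSU2, su2Coord_symm_coe, SU2.inv_coe, Matrix.mul_apply, Fin.sum_univ_two,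
      Matrix.mul_apply, Fin.sum_univ_two, Matrix.mul_apply, Fin.sum_univ_two,
      Matrix.conjTranspose_apply, Matrix.conjTranspose_apply, SU2.apply_zero_one,
      SU2.apply_one_one]
    simp [Complex.ext_iff]
    constructor <;> ring
  have h5 : (adSU2 s diagSU2).1 1 0 = 0 := Complex.ext h2 h3
  rw [h4] at h5
  rcases mul_eq_zero.1 h5 with h6 | h6
  · exact Or.inl ((mul_eq_zero.1 h6).resolve_left (by simp))
  · have h7 : s.1 0 0 = 0 := (map_eq_zero _).1 h6
    refine Or.inr ⟨h7, ?_⟩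
    have h8 : hopf s = hopf weylSU2 := by
      rw [← one_mul weylSU2, hopf_mul_weyl, hopf_eq_neg_iff, inv_one, one_mul, h7]
    rw [← smul_eq_smul_of_hopf_eq hx h8, hs]

omit [MulAction SU2 M] h in
theorem mfderiv_comp_of_hasFDerivAt {U V : Type*} [NormedAddCommGroup U] [NormedSpace ℝ U]
    [NormedAddCommGroup V] [NormedSpace ℝ V] {f : V → M} {m : U → V} {m' : U →L[ℝ] V} {u : U} {v : V}
    (hv : m u = v) (hf : MDifferentiableAt 𝓘(ℝ, V) (𝓡 6) f v) (hm : HasFDerivAt m m' u) (w : U) :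
    (mfderiv 𝓘(ℝ, U) (𝓡 6) (f ∘ m) u : U →L[ℝ] E6) w =
      (mfderiv 𝓘(ℝ, V) (𝓡 6) f v : V →L[ℝ] E6) (m' w) := by
  subst hv
  have hm2 : HasMFDerivAt 𝓘(ℝ, U) 𝓘(ℝ, V) m u m' := hm.hasMFDerivAt
  rw [mfderiv_comp u hf hm2.mdifferentiableAt, hm2.mfderiv]
  rfl

omit [TopologicalSpace M] [ChartedSpace E6 M] h in
-- The inverse of `stereoSU2 w` acts on the sphere by the Möbius map z ↦ (z - w)/(1 + w̄z). This
-- moves questions at `w` to the base point 0.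
theorem stereoSU2_smul_eq {x : M} (hx : ∀ t : ℝ, expSU2 (t • diagSU2) • x = x) {w z : ℂ}
    (hz : 1 + starRingEnd ℂ w * z ≠ 0) : stereoSU2 z • x =
      stereoSU2 w • stereoSU2 ((z - w) / (1 + starRingEnd ℂ w * z)) • x := by
  have h1 : hopf (stereoSU2 ((z - w) / (1 + starRingEnd ℂ w * z))) =
      hopf ((stereoSU2 w)⁻¹ * stereoSU2 z) := by
    have hm : (z - w) / (1 + starRingEnd ℂ w * z) * (1 + starRingEnd ℂ w * z) = z - w :=
      div_mul_cancel₀ _ hz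
    generalize (z - w) / (1 + starRingEnd ℂ w * z) = m at hm ⊢
    rw [hopf_eq_iff, SU2.inv_mul_one_zero, SU2.inv_mul_one_zero, SU2.inv_mul_zero_zero,
      stereoSU2_zero_zero, stereoSU2_zero_zero, stereoSU2_zero_zero, stereoSU2_one_zero,
      stereoSU2_one_zero, stereoSU2_one_zero, map_mul, Complex.conj_ofReal]
    generalize (((√(1 + w.re ^ 2 + w.im ^ 2))⁻¹ : ℝ) : ℂ) = c₁
    generalize (((√(1 + z.re ^ 2 + z.im ^ 2))⁻¹ : ℝ) : ℂ) = c₂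
    generalize (((√(1 + m.re ^ 2 + m.im ^ 2))⁻¹ : ℝ) : ℂ) = c₃
    linear_combination -(c₁ * c₂ * c₃) * hm
  rw [smul_eq_smul_of_hopf_eq hx h1, smul_smul, mul_inv_cancel_left]

/-- The coordinates of the tangent vector `w` at the base point of the orbit. -/
def stereoLin : ℂ →L[ℝ] (Fin 3 → ℝ) :=
  ContinuousLinearMap.pi ![0, Complex.reCLM, Complex.imCLM]

omit [TopologicalSpace M] [ChartedSpace E6 M] [MulAction SU2 M] h in
theorem stereoSU2_eq (w : ℂ) : stereoSU2 w = gnomonic (stereoLin w) := by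
  rw [stereoSU2]
  congr 1
  ext i; fin_cases i <;> rfl

theorem contMDiff_stereoSU2_smul (x : M) :
    ContMDiff 𝓘(ℝ, ℂ) (𝓡 6) ∞ (fun w => stereoSU2 w • x) := by
  simp only [stereoSU2_eq]
  exact (contMDiff_gnomonic_smul h x).comp stereoLin.contDiff.contMDiff

theorem exists_mfderiv_stereoSU2_smul {x : M} (hx : ∀ t : ℝ, expSU2 (t • diagSU2) • x = x) (w : ℂ) :
    ∃ c : ℂ, c ≠ 0 ∧ ∀ v : ℂ,
      (mfderiv 𝓘(ℝ, ℂ) (𝓡 6) (fun w => stereoSU2 w • x) w : ℂ →L[ℝ] E6) v =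
        actDeriv (stereoSU2 w) x (infAct x (stereoLin (v * c))) := by
  have h0 : (1 + starRingEnd ℂ w * w) ≠ 0 := by
    rw [← Complex.normSq_eq_conj_mul_self]
    have := Complex.normSq_nonneg w
    exact_mod_cast (by positivity : (1 + Complex.normSq w) ≠ 0)
  -- The factor is the complex derivative at `w` of the Möbius map taking `w` to 0.
  refine ⟨(1 + starRingEnd ℂ w * w)⁻¹, inv_ne_zero h0, fun v => ?_⟩
  let m : ℂ → ℂ := fun z => (z - w) / (1 + starRingEnd ℂ w * z)
  have hm : HasDerivAt m ((1 + starRingEnd ℂ w * w)⁻¹) w := by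
    have h1 := ((hasDerivAt_id w).sub_const w).div
      (((hasDerivAt_id w).const_mul (starRingEnd ℂ w)).const_add 1) h0
    refine h1.congr_deriv ?_
    simp only [id, sub_self]
    field_simp
    ring
  have hm0 : m w = 0 := by simp [m]
  have hml : HasFDerivAt (stereoLin ∘ m) (stereoLin.comp
      ((ContinuousLinearMap.toSpanSingleton ℂ ((1 + starRingEnd ℂ w * w)⁻¹)).restrictScalars ℝ)) w :=
    stereoLin.hasFDerivAt.comp w (hm.hasFDerivAt.restrictScalars ℝ)
  have hev : (fun z => stereoSU2 z • x) =ᶠ[𝓝 w]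
      (fun y : M => stereoSU2 w • y) ∘ ((fun p => gnomonic p • x) ∘ (stereoLin ∘ m)) := by
    have hc : ContinuousAt (fun z : ℂ => 1 + starRingEnd ℂ w * z) w := by fun_prop
    filter_upwards [hc.eventually_ne h0] with z hz
    simp only [Function.comp_apply]
    rw [← stereoSU2_eq]
    exact stereoSU2_smul_eq hx hz
  have hb : (stereoLin ∘ m) w = 0 := by
    simp only [Function.comp_apply]; rw [hm0, map_zero]
  have hg := (contMDiff_gnomonic_smul h x).mdifferentiable (by simp)
  have h1 := mfderiv_comp_of_hasFDerivAt (f := fun p => gnomonic p • x) hb (hg 0) hml v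
  have hbx : ((fun p => gnomonic p • x) ∘ (stereoLin ∘ m)) w = x := by
    rw [Function.comp_apply, hb, gnomonic_zero, one_smul]
  have h2 := mfderiv_comp_apply_of_base (g := fun y : M => stereoSU2 w • y) hbx
    (mdifferentiableAt_smul h _ x)
    (MDifferentiableAt.comp w (by rw [hb]; exact hg 0) hml.hasMFDerivAt.mdifferentiableAt) v
  rw [hev.mfderiv_eq]
  refine h2.trans ?_
  rw [h1]
  rfl

/-- Local description of the parametrisation of the orbit by `S²`. -/
theorem contMDiffAt_of_stereo {x : M} (hx : ∀ t : ℝ, expSU2 (t • diagSU2) • x = x)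
    (hker : ∀ c, infAct x c = 0 → c 1 = 0 ∧ c 2 = 0) {f : USphere 2 → M} {p : USphere 2} {g : SU2}
    {s : EuclideanSpace ℝ (Fin 3) → ℂ} {r : ℂ → EuclideanSpace ℝ (Fin 3)}
    (hs : ContDiffAt ℝ ∞ s p.1) (hr : DifferentiableAt ℝ r (s p.1))
    (hrs : ∀ᶠ q : USphere 2 in 𝓝 p, r (s q.1) = q.1)
    (hf : ∀ᶠ q : USphere 2 in 𝓝 p, f q = g • stereoSU2 (s q.1) • x) :
    ContMDiffAt (𝓡 2) (𝓡 6) ∞ f p ∧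
    (∀ u, ∃ ζ : su2, (mfderiv (𝓡 2) (𝓡 6) f p : EuclideanSpace ℝ (Fin 2) →L[ℝ] E6) u =
      fundVec ζ (f p)) ∧ Function.Injective (mfderiv (𝓡 2) (𝓡 6) f p) := by
  have : Fact (Module.finrank ℝ (EuclideanSpace ℝ (Fin 3)) = 2 + 1) := ⟨by
    rw [finrank_euclideanSpace_fin]⟩
  let S : USphere 2 → ℂ := fun q => s q.1
  have hcoe : ContMDiff (𝓡 2) 𝓘(ℝ, EuclideanSpace ℝ (Fin 3)) ∞
      (fun q : USphere 2 => (q : EuclideanSpace ℝ (Fin 3))) := contMDiff_coe_sphere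
  have hS : ContMDiffAt (𝓡 2) 𝓘(ℝ, ℂ) ∞ S p := hs.contMDiffAt.comp p (hcoe p)
  have hSd := hS.mdifferentiableAt (by simp)
  let dS : EuclideanSpace ℝ (Fin 2) →L[ℝ] ℂ := mfderiv (𝓡 2) 𝓘(ℝ, ℂ) S p
  have hF := contMDiff_stereoSU2_smul h x
  have hFd := hF.mdifferentiable (by simp) (S p)
  have hfe : f =ᶠ[𝓝 p] (fun y : M => g • y) ∘ ((fun w => stereoSU2 w • x) ∘ S) := hf
  have hFS : ContMDiffAt (𝓡 2) (𝓡 6) ∞ ((fun w => stereoSU2 w • x) ∘ S) p := (hF (S p)).comp p hS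
  obtain ⟨c, hc, hder⟩ := exists_mfderiv_stereoSU2_smul h hx (S p)
  have hmf : ∀ u, (mfderiv (𝓡 2) (𝓡 6) f p : EuclideanSpace ℝ (Fin 2) →L[ℝ] E6) u =
      actDeriv g (stereoSU2 (S p) • x) (actDeriv (stereoSU2 (S p)) x (infAct x (stereoLin
        (dS u * c)))) := fun u => by
    rw [hfe.mfderiv_eq]
    refine (mfderiv_comp_apply_of_base (g := fun y : M => g • y) rfl
      (mdifferentiableAt_smul h _ _) (hFS.mdifferentiableAt (by simp)) u).trans ?_
    rw [← hder, mfderiv_comp p hFd hSd]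
    rfl
  refine ⟨?_, fun u => ?_, fun u v huv => ?_⟩
  · exact (((h.contMDiff_smul g) _).comp p hFS).congr_of_eventuallyEq hfe
  · rw [hmf]
    refine ⟨adSU2 g (adSU2 (stereoSU2 (S p)) (su2Coord.symm (stereoLin
        (dS u * c)))), ?_⟩
    have h1 : f p = g • stereoSU2 (S p) • x := hf.self_of_nhds
    rw [h1, fundVec_adSU2 h, fundVec_adSU2 h, fundVec_eq h, su2Coord.apply_symm_apply]
  · have h1 := (hmf u).symm.trans (huv.trans (hmf v))
    have h2 := actDeriv_injective h _ _ (actDeriv_injective h _ _ h1)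
    rw [← sub_eq_zero, ← map_sub, ← map_sub] at h2
    obtain ⟨h3, h4⟩ := hker _ h2
    have h5 : dS u * c -
      dS v * c = 0 := Complex.ext h3 h4
    have h6 := mul_right_cancel₀ hc (sub_eq_zero.1 h5)
    -- Near `p` the inclusion of S² in ℝ³ factors through the coordinate `S`. Vectors with equal
    -- images under its differential are therefore equal, since the inclusion is an immersion.
    have hrS : r ∘ S =ᶠ[𝓝 p] fun q : USphere 2 => (q : EuclideanSpace ℝ (Fin 3)) := hrs
    have h7 : ∀ u, (mfderiv (𝓡 2) 𝓘(ℝ, EuclideanSpace ℝ (Fin 3))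
        (fun q : USphere 2 => (q : EuclideanSpace ℝ (Fin 3))) p :
          EuclideanSpace ℝ (Fin 2) →L[ℝ] EuclideanSpace ℝ (Fin 3)) u =
        (mfderiv 𝓘(ℝ, ℂ) 𝓘(ℝ, EuclideanSpace ℝ (Fin 3)) r (S p) :
          ℂ →L[ℝ] EuclideanSpace ℝ (Fin 3))
          (dS u) := fun u => by
      rw [← hrS.mfderiv_eq, mfderiv_comp p hr.mdifferentiableAt hSd]
      rfl
    refine injective_mvfderiv_subtypeVal_sphere (n := 2) p ?_
    exact (h7 u).trans ((congrArg _ h6).trans (h7 v).symm)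

end SphereOrbit

section SphereOrbit

variable {M : Type*} [TopologicalSpace M] [ChartedSpace E6 M] [MulAction SU2 M]
  (h : IsSmoothAction M)
include h

/-- The differential of the parametrisation of a two-dimensional orbit. -/
theorem sphereOrbit_immersion {x : M} (hx : ∀ t : ℝ, expSU2 (t • diagSU2) • x = x)
    (hker : ∀ c, infAct x c = 0 → c 1 = 0 ∧ c 2 = 0) (p : USphere 2) :
    ContMDiffAt (𝓡 2) (𝓡 6) ∞ (sphereOrbit x) p ∧
    (∀ u, ∃ ζ : su2, (mfderiv (𝓡 2) (𝓡 6) (sphereOrbit x) p :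
      EuclideanSpace ℝ (Fin 2) →L[ℝ] E6) u = fundVec ζ (sphereOrbit x p)) ∧
    Function.Injective (mfderiv (𝓡 2) (𝓡 6) (sphereOrbit x) p) := by
  have hcoord : ∀ v : EuclideanSpace ℝ (Fin 3), 1 + v 0 ≠ 0 → ContDiffAt ℝ ∞ stereoCoord v := by
    intro v hv
    have h0 : ∀ i, ContDiffAt ℝ ∞ (fun v : EuclideanSpace ℝ (Fin 3) => v i) v := fun i => by fun_prop
    have h1 : ContDiffAt ℝ ∞ (fun v : EuclideanSpace ℝ (Fin 3) =>
        ((v 1 / (1 + v 0) : ℝ) : ℂ) + ((v 2 / (1 + v 0) : ℝ) : ℂ) * Complex.I) v :=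
      (Complex.ofRealCLM.contDiff.contDiffAt.comp v ((h0 1).div (contDiffAt_const.add (h0 0)) hv)).add
        ((Complex.ofRealCLM.contDiff.contDiffAt.comp v
          ((h0 2).div (contDiffAt_const.add (h0 0)) hv)).mul contDiffAt_const)
    refine h1.congr_of_eventuallyEq (Filter.Eventually.of_forall fun w => ?_)
    exact Complex.mk_eq_add_mul_I _ _
  have hvec : Differentiable ℝ stereoVec := by
    have h1 : ContDiff ℝ 1 stereoVec := by
      rw [contDiff_euclidean]
      have hre : ContDiff ℝ 1 fun w : ℂ => w.re := Complex.reCLM.contDiff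
      have him : ContDiff ℝ 1 fun w : ℂ => w.im := Complex.imCLM.contDiff
      have hne : ∀ w : ℂ, 1 + w.re ^ 2 + w.im ^ 2 ≠ 0 := fun w => by positivity
      have hd : ContDiff ℝ 1 fun w : ℂ => 1 + w.re ^ 2 + w.im ^ 2 :=
        (contDiff_const.add (hre.pow 2)).add (him.pow 2)
      intro i
      fin_cases i
      · exact ((contDiff_const.sub (hre.pow 2)).sub (him.pow 2)).div hd hne
      · exact (contDiff_const.mul hre).div hd hne
      · exact (contDiff_const.mul him).div hd hne
    exact h1.differentiable (by simp)
  have hc0 : Continuous fun q : USphere 2 => q.1 0 :=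
    (show Continuous fun v : EuclideanSpace ℝ (Fin 3) => v 0 by fun_prop).comp
      continuous_subtype_val
  -- Two charts cover S²: stereographic projection away from -e₀, and its translate by the Weyl
  -- element at that point.
  by_cases hp : p.1 0 = -1
  · have hp1 : p.1 0 ≠ 1 := by rw [hp]; norm_num
    have hev : ∀ᶠ q : USphere 2 in 𝓝 p, q.1 0 ≠ 1 := hc0.continuousAt.eventually_ne hp1
    refine contMDiffAt_of_stereo h hx hker (g := weylSU2) (s := fun v => stereoCoord (halfTurn v))
      (r := fun w => halfTurn (stereoVec w)) ?_ ?_ ?_ ?_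
    · refine (hcoord _ ?_).comp p.1 halfTurn.contDiff.contDiffAt
      rw [halfTurn_apply]
      simp only [Matrix.cons_val_zero]
      rw [hp]; norm_num
    · exact halfTurn.differentiableAt.comp _ (hvec _)
    · filter_upwards [hev] with q hq
      have h1 := congrArg Subtype.val (hopf_weyl_stereo_of_ne hq)
      rw [hopf_weyl_mul, hopf_stereoSU2] at h1
      exact h1
    · filter_upwards [hev] with q hq
      rw [smul_smul, ← sphereOrbit_hopf hx, hopf_weyl_stereo_of_ne hq]
  · have hev : ∀ᶠ q : USphere 2 in 𝓝 p, q.1 0 ≠ -1 := hc0.continuousAt.eventually_ne hp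
    refine contMDiffAt_of_stereo h hx hker (g := 1) (s := stereoCoord) (r := stereoVec)
      (hcoord _ fun h0 => hp (by linarith)) (hvec _) ?_ ?_
    · filter_upwards [hev] with q hq using stereoVec_stereoCoord hq
    · filter_upwards [hev] with q hq
      rw [one_smul, ← sphereOrbit_hopf hx, hopf_stereo_of_ne hq]

/-- The stabiliser lies in the normaliser of the torus. The torus is collapsed by the Hopf map, and
the other coset acts on S² by the antipodal map, so identifications beyond equality occur exactly
when the Weyl element fixes `x`. -/
theorem sphereOrbit_eq_iff {x : M} (hx : ∀ t : ℝ, expSU2 (t • diagSU2) • x = x)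
    (h0 : fundVec diagSU2 x = 0) (hker : ∀ c, infAct x c = 0 → c 1 = 0 ∧ c 2 = 0)
    (p q : USphere 2) : sphereOrbit x p = sphereOrbit x q ↔
      (q = p ∨ (q = -p ∧ weylSU2 • x = x)) := by
  obtain ⟨a, rfl⟩ := hopf_surjective p
  obtain ⟨b, rfl⟩ := hopf_surjective q
  rw [sphereOrbit_hopf hx, sphereOrbit_hopf hx]
  constructor
  · intro hab
    have hs : (a⁻¹ * b) • x = x := by rw [mul_smul, ← hab, inv_smul_smul]
    rcases mem_stabilizer_diag h hx h0 hker hs with h1 | ⟨h1, h2⟩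
    · exact Or.inl ((hopf_eq_iff a b).2 h1).symm
    · exact Or.inr ⟨(hopf_eq_neg_iff a b).2 h1, h2⟩
  · rintro (h1 | ⟨h1, h2⟩)
    · exact smul_eq_smul_of_hopf_eq hx h1.symm
    · rw [← hopf_mul_weyl] at h1
      rw [smul_eq_smul_of_hopf_eq hx h1, mul_smul, h2]

end SphereOrbit

/-! ### Orbits on which ν and μ vanish. -/

theorem weylSU2_sq_coe : (weylSU2 * weylSU2).1 = -1 := by
  change weylSU2.1 * weylSU2.1 = -1
  rw [weylSU2_coe]
  ext i j; fin_cases i <;> fin_cases j <;> simp [Matrix.mul_apply, Fin.sum_univ_two]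

namespace NearlyKahler

variable {M : Type*} [TopologicalSpace M] [ChartedSpace E6 M] [IsManifold (𝓡 6) ∞ M] [T2Space M]
  [MulAction SU2 M] {S : NearlyKahler M} (hact : S.IsAutomorphicAction)
  {ξ : Module.Basis (Fin 3) ℝ su2}
include hact

/-- The central element -1, the square of the Weyl element, lies in the torus and fixes `x`. Being
central it is trivial on the tangent plane of the orbit, hence on the tangent space and on `M`. The
argument covers spheres and projective planes alike. -/
theorem not_faithfulSMul_of_isotropic [ConnectedSpace M] {x : M} (hμ : S.mu ξ x = 0)
    (h0 : fundVec diagSU2 x = 0) (hker : ∀ c, infAct x c = 0 → c 1 = 0 ∧ c 2 = 0) :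
    ¬ FaithfulSMul SU2 M := by
  intro hf
  have hx := expSU2_smul_eq_of_fundVec_eq_zero hact.smooth h0
  set a : SU2 := weylSU2 * weylSU2 with ha
  have haa : a * a = 1 := by
    apply Subtype.ext
    change a.1 * a.1 = 1
    rw [weylSU2_sq_coe, neg_mul_neg, one_mul]
  have hax : a • x = x := by
    have h1 : hopf a = hopf 1 := by
      rw [ha, hopf_mul_weyl, ← one_mul weylSU2, hopf_mul_weyl, neg_neg]
    rw [smul_eq_smul_of_hopf_eq hx h1, one_smul]
  have had : ∀ η : su2, adSU2 a η = η := fun η => by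
    apply Subtype.ext
    rw [adSU2_coe, SU2.inv_coe, weylSU2_sq_coe]
    simp
  let k : Fin 2 → E6 := fun i => fundVec (su2Coord.symm (Pi.single i.succ 1)) x
  have hk : LinearIndependent ℝ k := by
    rw [Fintype.linearIndependent_iff]
    intro c hc
    have h1 : infAct x ![0, c 0, c 1] = 0 := by
      rw [← hc, Fin.sum_univ_two]
      simp only [k, fundVec_eq hact.smooth, su2Coord.apply_symm_apply]
      rw [← map_smul, ← map_smul, ← map_add]
      congr 1
      ext i; fin_cases i <;> simp
    obtain ⟨h2, h3⟩ := hker _ h1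
    intro i; fin_cases i
    · exact h2
    · exact h3
  have hd := actDeriv_eq_self_of_isotropic hact hax haa hk
    (fun i j => (mu_eq_zero_iff hact x).1 hμ _ _) (fun i => by
      have h1 := fundVec_adSU2 hact.smooth a (su2Coord.symm (Pi.single i.succ 1)) x
      rw [had, hax] at h1
      exact h1.symm)
  have htriv := smul_eq_self_of_actDeriv_eq_self hact.smooth haa hax hd
  have h1 : a = 1 := eq_of_smul_eq_smul fun z : M => by rw [htriv, one_smul]
  have h2 := congrArg (fun b : SU2 => (b.1 0 0).re) h1
  simp only [ha, weylSU2_sq_coe] at h2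
  norm_num at h2

/-- Injectivity of the infinitesimal action would force ν ≠ 0. If that action is not zero, a kernel
vector is conjugated into the diagonal torus by moving along the orbit to `y`, where the Hopf
parametrisation applies. -/
theorem fixed_or_isotropicSphere [ConnectedSpace M] (hξ : IsStandardBasis ξ) {x : M}
    (hν : S.nu ξ x = 0) (hμ : S.mu ξ x = 0) :
    (∀ a : SU2, a • x = x) ∨ S.IsIsotropicSphereOrbit x := by
  have hs := hact.smooth
  by_cases hz : infAct x = 0
  · left
    intro a
    obtain ⟨η, rfl⟩ := exists_expSU2_eq a
    exact expSU2_smul_eq_of_fundVec_eq_zero hs (by rw [fundVec_eq hs, hz]; rfl) 1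
  right
  have hni : ¬ Function.Injective (infAct x) := fun hi =>
    nu_ne_zero_of_isotropic hact hξ ((infAct_injective_iff hact x).1 hi) hμ hν
  obtain ⟨η, hη0, hη⟩ : ∃ η : su2, η ≠ 0 ∧ fundVec η x = 0 := by
    rw [← ContinuousLinearMap.coe_coe, ← LinearMap.ker_eq_bot, LinearMap.ker_eq_bot'] at hni
    push Not at hni
    obtain ⟨v, hv, hv0⟩ := hni
    refine ⟨su2Coord.symm v, fun h0 => hv0 (by simpa using congrArg su2Coord h0), ?_⟩
    rw [fundVec_eq hs, su2Coord.apply_symm_apply]; exact hv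
  obtain ⟨a, r, hr, har⟩ := exists_adSU2_eq_diag hη0
  set y := a • x with hy
  have h0 : fundVec diagSU2 y = 0 := by
    have h1 := fundVec_adSU2 hs a η x
    rw [har, hη, map_zero, fundVec_smul hs] at h1
    exact (smul_eq_zero.1 h1).resolve_left hr
  have hyx := expSU2_smul_eq_of_fundVec_eq_zero hs h0
  have hne : infAct y ≠ 0 := by
    intro h1
    apply hz
    refine ContinuousLinearMap.ext fun c => ?_
    have h2 := fundVec_adSU2 hs a (su2Coord.symm c) x
    rw [fundVec_eq hs, ← hy, h1, fundVec_eq hs, su2Coord.apply_symm_apply] at h2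
    exact actDeriv_injective hs a x (h2.symm.trans (map_zero _).symm)
  have hker := infAct_ker_of_ne_zero hs hyx h0 hne
  have hμy : S.mu ξ y = 0 := mu_smul_eq_zero hact a hμ
  have himm := sphereOrbit_immersion hs hyx hker
  refine ⟨sphereOrbit y, fun p => (himm p).1, ?_, fun p => (himm p).2.2, fun p u v => ?_, ?_⟩
  · rw [range_sphereOrbit hyx, hy, MulAction.orbit_smul]
  · obtain ⟨ζ, hζ⟩ := (himm p).2.1 u
    obtain ⟨θ, hθ⟩ := (himm p).2.1 v
    have h1 : S.mu ξ (sphereOrbit y p) = 0 := mu_smul_eq_zero hact _ hμy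
    refine Eq.trans ?_ ((mu_eq_zero_iff hact _).1 h1 ζ θ)
    rw [← hζ, ← hθ]; rfl
  · by_cases hw : weylSU2 • y = y
    · refine Or.inr ⟨not_faithfulSMul_of_isotropic hact hμy h0 hker, fun p q => ?_⟩
      rw [sphereOrbit_eq_iff hs hyx h0 hker]
      simp [hw]
    · refine Or.inl fun p q hpq => ?_
      rcases (sphereOrbit_eq_iff hs hyx h0 hker p q).1 hpq with h1 | ⟨-, h1⟩
      · exact h1.symm
      · exact absurd h1 hw

end NearlyKahler

/-! ### Complexes with an exact contraction -/

section RelLength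

variable {V W : Type*} [AddCommGroup V] [Module ℝ V] [AddCommGroup W] [Module ℝ W]

/-- The dimension of `U / (A ∩ U)`. -/
def relLength (A U : Submodule ℝ V) : ℕ∞ := Module.length ℝ (U ⧸ A.submoduleOf U)

theorem relLength_eq_length {A U : Submodule ℝ V} (φ : U →ₗ[ℝ] W) (hφ : Function.Surjective φ)
    (hker : ∀ u : U, φ u = 0 ↔ (u : V) ∈ A) : relLength A U = Module.length ℝ W := by
  have h1 : A.submoduleOf U = LinearMap.ker φ := by
    ext u
    exact (hker u).symm
  exact ((Submodule.quotEquivOfEq _ _ h1).trans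
    (φ.quotKerEquivOfSurjective hφ)).length_eq

theorem relLength_add {A B U : Submodule ℝ V} (hAB : A ≤ B) (hBU : B ≤ U) :
    relLength A U = relLength A B + relLength B U := by
  have h1 : A.submoduleOf B ≤ (A.submoduleOf U).comap (Submodule.inclusion hBU) :=
    fun x hx => hx
  have h2 : A.submoduleOf U ≤ B.submoduleOf U := fun x hx => hAB hx
  refine Module.length_eq_add_of_exact (Submodule.mapQ _ _ (Submodule.inclusion hBU) h1)
    (Submodule.factor h2) ?_ (Submodule.factor_surjective h2) ?_
  · rw [← LinearMap.ker_eq_bot, LinearMap.ker_eq_bot']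
    intro x
    obtain ⟨x, rfl⟩ := Submodule.Quotient.mk_surjective _ x
    intro hx
    rw [Submodule.mapQ_apply, Submodule.Quotient.mk_eq_zero] at hx
    exact (Submodule.Quotient.mk_eq_zero _).2 hx
  · intro x
    obtain ⟨x, rfl⟩ := Submodule.Quotient.mk_surjective _ x
    have : Submodule.factor h2 (Submodule.Quotient.mk x) = Submodule.Quotient.mk x := rfl
    rw [this, Submodule.Quotient.mk_eq_zero]
    constructor
    · intro hx
      exact ⟨Submodule.Quotient.mk ⟨x, hx⟩, rfl⟩
    · rintro ⟨y, hy⟩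
      obtain ⟨y, rfl⟩ := Submodule.Quotient.mk_surjective _ y
      rw [Submodule.mapQ_apply, Submodule.Quotient.eq] at hy
      have h3 : (y : V) - x ∈ A := hy
      have h4 := B.sub_mem y.2 (hAB h3)
      rwa [sub_sub_cancel] at h4

/-- The map U → f(U)/f(A) is onto with kernel A + (ker f ∩ U). -/
theorem relLength_map (f : V →ₗ[ℝ] W) {A U : Submodule ℝ V} (hAU : A ≤ U) :
    relLength (A ⊔ (LinearMap.ker f ⊓ U)) U = relLength (A.map f) (U.map f) := by
  refine relLength_eq_length (((A.map f).submoduleOf (U.map f)).mkQ ∘ₗ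
    f.submoduleMap U) ((Submodule.mkQ_surjective _).comp (f.submoduleMap_surjective U)) ?_
  intro u
  rw [LinearMap.comp_apply, Submodule.mkQ_apply, Submodule.Quotient.mk_eq_zero]
  change f u ∈ A.map f ↔ _
  constructor
  · rintro ⟨a, ha, hau⟩
    rw [Submodule.mem_sup]
    refine ⟨a, ha, u - a, ⟨?_, U.sub_mem u.2 (hAU ha)⟩, add_sub_cancel _ _⟩
    change f (u - a) = 0
    rw [map_sub, hau, sub_self]
  · rw [Submodule.mem_sup]
    rintro ⟨a, ha, b, ⟨hb, -⟩, hab⟩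
    exact ⟨a, ha, by rw [← hab, map_add, LinearMap.mem_ker.1 hb, add_zero]⟩

theorem relLength_inf_sup (A C : Submodule ℝ V) :
    relLength (A ⊓ C) C = relLength A (A ⊔ C) := by
  refine relLength_eq_length ((A.submoduleOf (A ⊔ C)).mkQ ∘ₗ
    Submodule.inclusion le_sup_right) ?_ ?_
  · intro x
    obtain ⟨⟨x, hx⟩, rfl⟩ := Submodule.Quotient.mk_surjective _ x
    obtain ⟨a, ha, c, hc, rfl⟩ := Submodule.mem_sup.1 hx
    refine ⟨⟨c, hc⟩, ?_⟩
    rw [LinearMap.comp_apply, Submodule.mkQ_apply, Submodule.Quotient.eq]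
    change c - (a + c) ∈ A
    rw [sub_add_cancel_right]
    exact A.neg_mem ha
  · intro u
    rw [LinearMap.comp_apply, Submodule.mkQ_apply, Submodule.Quotient.mk_eq_zero]
    exact ⟨fun h => ⟨h, u.2⟩, fun h => h.1⟩

theorem relLength_self (A : Submodule ℝ V) : relLength A A = 0 := by
  rw [relLength, Submodule.submoduleOf_self]
  exact Module.length_eq_zero

end RelLength

section Contraction

variable {X : ℕ → Type*} [∀ k, AddCommGroup (X k)] [∀ k, Module ℝ (X k)]

/-- The boundaries of a cochain complex. -/
def coboundaries (d : ∀ k, X k →ₗ[ℝ] X (k + 1)) : ∀ k, Submodule ℝ (X k)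
  | 0 => ⊥
  | k + 1 => LinearMap.range (d k)

/-- The basic elements, killed by the contraction. -/
def basics (i : ∀ k, X (k + 1) →ₗ[ℝ] X k) : ∀ k, Submodule ℝ (X k)
  | 0 => ⊤
  | k + 1 => LinearMap.ker (i k)

/-- The coboundaries of basic elements. -/
def basicCoboundaries (d : ∀ k, X k →ₗ[ℝ] X (k + 1)) (i : ∀ k, X (k + 1) →ₗ[ℝ] X k) :
    ∀ k, Submodule ℝ (X k)
  | 0 => ⊥
  | k + 1 => (basics i k).map (d k)

variable {d : ∀ k, X k →ₗ[ℝ] X (k + 1)} {i : ∀ k, X (k + 1) →ₗ[ℝ] X k}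
  (hdd : ∀ k x, d (k + 1) (d k x) = 0) (hii : ∀ k x, i k (i (k + 1) x) = 0)
  (hid0 : ∀ x, i 0 (d 0 x) = 0)
  (hid : ∀ k x, i (k + 1) (d (k + 1) x) = -d k (i k x))
  (hex0 : Function.Surjective (i 0)) (hex : ∀ k x, i k x = 0 → ∃ y, i (k + 1) y = x)

include hdd in
theorem coboundaries_le_ker : ∀ k, coboundaries d k ≤ LinearMap.ker (d k)
  | 0 => bot_le
  | k + 1 => by
    rintro _ ⟨x, rfl⟩
    exact hdd k x

include hid0 hid in
theorem map_basics_le : ∀ k, (basics i k).map (d k) ≤ basics i (k + 1)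
  | 0 => by
    rintro _ ⟨x, -, rfl⟩
    exact hid0 x
  | k + 1 => by
    rintro _ ⟨x, hx, rfl⟩
    change i (k + 1) (d (k + 1) x) = 0
    rw [hid, LinearMap.mem_ker.1 hx, map_zero, neg_zero]

include hid0 hid in
theorem basicCoboundaries_le : ∀ k, basicCoboundaries d i k ≤ coboundaries d k ⊓ basics i k
  | 0 => bot_le
  | k + 1 => le_inf (LinearMap.map_le_range) (map_basics_le hid0 hid k)

include hii hex0 hex in
theorem map_contraction_top : ∀ k, LinearMap.range (i k) = basics i k
  | 0 => LinearMap.range_eq_top.2 hex0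
  | k + 1 => by
    ext x
    exact ⟨by rintro ⟨y, rfl⟩; exact hii k y, fun h => hex k x h⟩

include hii hid0 hid hex0 hex in
theorem map_contraction_coboundaries : ∀ k,
    (coboundaries d (k + 1)).map (i k) = basicCoboundaries d i k
  | 0 => by
    rw [eq_comm]
    refine le_antisymm bot_le ?_
    rintro _ ⟨_, ⟨x, rfl⟩, rfl⟩
    exact hid0 x
  | k + 1 => by
    change _ = (basics i k).map (d k)
    rw [← map_contraction_top hii hex0 hex k]
    ext x
    constructor
    · rintro ⟨_, ⟨y, rfl⟩, rfl⟩
      exact ⟨-i k y, ⟨-y, map_neg _ _⟩, by rw [hid, map_neg]⟩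
    · rintro ⟨_, ⟨y, rfl⟩, rfl⟩
      exact ⟨d (k + 1) (-y), ⟨-y, rfl⟩, by rw [hid, map_neg, map_neg, neg_neg]⟩

include hdd hii hid0 hid hex0 hex in
-- Closed basic elements are i(U) with U = ker(i∘d), and contain i(ker d), which contains i of the
-- coboundaries, the basic coboundaries. The lower quotient is what contraction retains of
-- cohomology. The upper one equals U/(ker d + ker i), which is symmetric: applying d instead of i
-- gives exact basic elements modulo basic coboundaries two degrees higher.
theorem relLength_basic (k : ℕ) :
    relLength (basicCoboundaries d i k) (LinearMap.ker (d k) ⊓ basics i k) =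
      relLength (coboundaries d (k + 1) ⊔ (LinearMap.ker (d (k + 1)) ⊓ basics i (k + 1)))
        (LinearMap.ker (d (k + 1))) +
      relLength (basicCoboundaries d i (k + 2))
        (coboundaries d (k + 2) ⊓ basics i (k + 2)) := by
  have hmapZ : (LinearMap.ker (d (k + 1))).map (i k) ≤ LinearMap.ker (d k) ⊓ basics i k := by
    rintro _ ⟨x, hx, rfl⟩
    refine ⟨?_, map_contraction_top hii hex0 hex k ▸ ⟨x, rfl⟩⟩
    have h1 := hid k x
    rw [LinearMap.mem_ker.1 hx, map_zero] at h1
    exact neg_eq_zero.1 h1.symm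
  rw [relLength_add (A := basicCoboundaries d i k) (B := (LinearMap.ker (d (k + 1))).map (i k))
    (by
      rw [← map_contraction_coboundaries hii hid0 hid hex0 hex k]
      exact Submodule.map_mono (coboundaries_le_ker hdd (k + 1))) hmapZ]
  congr 1
  · rw [← map_contraction_coboundaries hii hid0 hid hex0 hex k,
      ← relLength_map _ (coboundaries_le_ker hdd (k + 1)), inf_comm]
    rfl
  · set U : Submodule ℝ (X (k + 1)) := LinearMap.ker (i (k + 1) ∘ₗ d (k + 1)) with hU
    have hZU : LinearMap.ker (d (k + 1)) ≤ U := fun x hx => by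
      change i (k + 1) (d (k + 1) x) = 0
      rw [LinearMap.mem_ker.1 hx, map_zero]
    have hBU : LinearMap.ker (i k) ≤ U := fun x hx => by
      change i (k + 1) (d (k + 1) x) = 0
      rw [hid, LinearMap.mem_ker.1 hx, map_zero, neg_zero]
    have h1 : U.map (i k) = LinearMap.ker (d k) ⊓ basics i k := by
      ext x
      rw [← map_contraction_top hii hex0 hex k]
      constructor
      · rintro ⟨y, hy, rfl⟩
        refine ⟨?_, ⟨y, rfl⟩⟩
        have h2 : i (k + 1) (d (k + 1) y) = 0 := hy
        rw [hid] at h2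
        exact neg_eq_zero.1 h2
      · rintro ⟨hx, ⟨y, rfl⟩⟩
        refine ⟨y, ?_, rfl⟩
        change i (k + 1) (d (k + 1) y) = 0
        rw [hid, LinearMap.mem_ker.1 hx, neg_zero]
    have h2 : U.map (d (k + 1)) = coboundaries d (k + 2) ⊓ basics i (k + 2) := by
      ext x
      constructor
      · rintro ⟨y, hy, rfl⟩
        exact ⟨⟨y, rfl⟩, hy⟩
      · rintro ⟨⟨y, rfl⟩, hy⟩
        exact ⟨y, hy, rfl⟩
    rw [← h1, ← h2, ← relLength_map _ hZU]
    change _ = relLength ((LinearMap.ker (i k)).map (d (k + 1))) _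
    rw [← relLength_map _ hBU, inf_eq_left.2 hZU, inf_eq_left.2 hBU, sup_comm]

include hdd hii hid0 hid hex0 hex in
/-- A bounded cochain complex with finite-dimensional cohomology, together with an exact
contraction anticommuting with the differential, has vanishing Euler characteristic. -/
theorem eulerChar_eq_zero_of_contraction [∀ k, Subsingleton (X (k + 7))]
    (hfin : ∀ k, relLength (coboundaries d k) (LinearMap.ker (d k)) ≠ ⊤) :
    ∑ k ∈ Finset.range 7, (-1 : ℤ) ^ k *
      ((relLength (coboundaries d k) (LinearMap.ker (d k))).toNat : ℤ) = 0 := by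
  -- The letters are dimensions in the Gysin sequence H^{k+1} → B^k → B^{k+2} → H^{k+2}: `H` is
  -- cohomology, `B` basic cohomology, `a` the image of B^k in H^k, `r` the kernel of that map, and
  -- `c` the image of H^k under contraction.
  set H := fun k => relLength (coboundaries d k) (LinearMap.ker (d k)) with hH
  set B := fun k => relLength (basicCoboundaries d i k) (LinearMap.ker (d k) ⊓ basics i k) with hB
  set a := fun k => relLength (coboundaries d k ⊓ basics i k) (LinearMap.ker (d k) ⊓ basics i k)
    with ha
  set c := fun k => relLength (coboundaries d k ⊔ (LinearMap.ker (d k) ⊓ basics i k))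
        (LinearMap.ker (d k)) with hc
  set r := fun k => relLength (basicCoboundaries d i k) (coboundaries d k ⊓ basics i k) with hr
  have e1 : ∀ k, H k = a k + c k := fun k => by
    have h1 := coboundaries_le_ker hdd k
    simp only [hH, ha, hc]
    rw [relLength_add (A := coboundaries d k) (B := coboundaries d k ⊔
      (LinearMap.ker (d k) ⊓ basics i k)) le_sup_left (sup_le h1 inf_le_left),
      ← relLength_inf_sup, ← inf_assoc, inf_eq_left.2 h1]
  have e2 : ∀ k, B k = r k + a k := fun k =>
    relLength_add (basicCoboundaries_le hid0 hid k)
      (inf_le_inf_right _ (coboundaries_le_ker hdd k))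
  have e3 : ∀ k, B k = c (k + 1) + r (k + 2) := fun k =>
    relLength_basic hdd hii hid0 hid hex0 hex k
  have c0 : c 0 = 0 := by
    have h1 : coboundaries d 0 ⊔ (LinearMap.ker (d 0) ⊓ basics i 0) = LinearMap.ker (d 0) := by
      change ⊥ ⊔ (_ ⊓ ⊤) = _
      rw [inf_top_eq, bot_sup_eq]
    simp only [hc]
    rw [h1, relLength_self]
  have r0 : r 0 = 0 := by
    have h1 : coboundaries d 0 ⊓ basics i 0 = basicCoboundaries d i 0 := by
      change ⊥ ⊓ ⊤ = ⊥
      rw [inf_top_eq]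
    simp only [hr]
    rw [h1, relLength_self]
  have r1 : r 1 = 0 := by
    have h1 : coboundaries d 1 ⊓ basics i 1 = basicCoboundaries d i 1 := by
      refine le_antisymm ?_ (basicCoboundaries_le hid0 hid 1)
      refine inf_le_left.trans ?_
      rintro _ ⟨x, rfl⟩
      exact ⟨x, trivial, rfl⟩
    simp only [hr]
    rw [h1, relLength_self]
  have hz : ∀ (k : ℕ) (A U : Submodule ℝ (X (k + 7))), relLength A U = 0 := fun k A U =>
    Module.length_eq_zero
  -- Only `H` is known to be finite. As `a` is bounded by `H`, and r(k+2) by B(k), finiteness of `B`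
  -- propagates in steps of two.
  have hBfin : ∀ k, B k ≠ ⊤ := by
    intro k
    induction k using Nat.strong_induction_on with
    | _ k ih =>
      have h1 : a k ≠ ⊤ := fun h => hfin k (by
        change H k = ⊤
        rw [e1, h, top_add])
      have h2 : r k ≠ ⊤ := by
        match k, ih with
        | 0, _ => rw [r0]; exact ENat.zero_ne_top
        | 1, _ => rw [r1]; exact ENat.zero_ne_top
        | k + 2, ih => exact fun h => ih k (by lia) (by rw [e3, h, add_top])
      rw [e2]
      exact WithTop.add_ne_top.2 ⟨h2, h1⟩
  have f1 : ∀ k, a k ≠ ⊤ := fun k h => hBfin k (by rw [e2, h, add_top])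
  have f2 : ∀ k, r k ≠ ⊤ := fun k h => hBfin k (by rw [e2, h, top_add])
  have f3 : ∀ k, c k ≠ ⊤ := fun k h => hfin k (by
    change H k = ⊤
    rw [e1, h, add_top])
  have g1 : ∀ k, (H k).toNat = (a k).toNat + (c k).toNat := fun k => by
    rw [e1, ENat.toNat_add (f1 k) (f3 k)]
  have g2 : ∀ k, (r k).toNat + (a k).toNat = (c (k + 1)).toNat + (r (k + 2)).toNat := fun k => by
    rw [← ENat.toNat_add (f2 k) (f1 k), ← ENat.toNat_add (f3 _) (f2 _), ← e2, ← e3]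
  have z0 : (c 0).toNat = 0 := by rw [c0]; rfl
  have z1 : (r 0).toNat = 0 := by rw [r0]; rfl
  have z2 : (r 1).toNat = 0 := by rw [r1]; rfl
  have z3 : (c 7).toNat = 0 := by rw [show c 7 = 0 from hz 0 _ _]; rfl
  have z4 : (r 7).toNat = 0 := by rw [show r 7 = 0 from hz 0 _ _]; rfl
  have z5 : (r 8).toNat = 0 := by rw [show r 8 = 0 from hz 1 _ _]; rfl
  -- Substituting a(k) = c(k+1) + r(k+2) - r(k) makes the alternating sum of a + c telescope,
  -- leaving only the boundary terms that vanish by `z0` to `z5`.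
  change ∑ k ∈ Finset.range 7, (-1 : ℤ) ^ k * ((H k).toNat : ℤ) = 0
  have t0 := g2 0
  have t1 := g2 1
  have t2 := g2 2
  have t3 := g2 3
  have t4 := g2 4
  have t5 := g2 5
  have t6 := g2 6
  norm_num only at t0 t1 t2 t3 t4 t5 t6
  simp only [Finset.sum_range_succ, Finset.sum_range_zero, g1]
  clear_value a c r H B
  push_cast
  omega

end Contraction

/-! ### Smooth dependence of integrals on parameters -/

section ParametricIntegral

open MeasureTheory Set

universe u

variable {E : Type} [NormedAddCommGroup E] [NormedSpace ℝ E]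

theorem continuous_slice_of_contDiffAt {G : Type*} [NormedAddCommGroup G] [NormedSpace ℝ G]
    {F : ℝ × E → G} {n : WithTop ℕ∞} {y : E} (hF : ∀ t, ContDiffAt ℝ n F (t, y)) :
    Continuous fun t => F (t, y) :=
  continuous_iff_continuousAt.2 fun t =>
    ContinuousAt.comp (g := F) (f := fun t => (t, y)) (hF t).continuousAt
      (continuous_id.prodMk continuous_const).continuousAt

theorem contDiffAt_partial {G : Type*} [NormedAddCommGroup G] [NormedSpace ℝ G]
    {F : ℝ × E → G} {p : ℝ × E} (hF : ContDiffAt ℝ ∞ F p) :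
    ContDiffAt ℝ ∞ (fun p => (fderiv ℝ F p).comp (ContinuousLinearMap.inr ℝ ℝ E)) p :=
  (hF.fderiv_right (m := ∞) (by simp)).clm_comp contDiffAt_const

theorem hasFDerivAt_partial {G : Type*} [NormedAddCommGroup G] [NormedSpace ℝ G]
    {F : ℝ × E → G} {t : ℝ} {y : E} (hF : DifferentiableAt ℝ F (t, y)) :
    HasFDerivAt (fun z => F (t, z))
      ((fderiv ℝ F (t, y)).comp (ContinuousLinearMap.inr ℝ ℝ E)) y :=
  HasFDerivAt.comp (f := fun z => (t, z)) y hF.hasFDerivAt (hasFDerivAt_prodMk_right t y)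

variable [FiniteDimensional ℝ E]

theorem hasFDerivAt_intervalIntegral_of_contDiffAt {G : Type*} [NormedAddCommGroup G]
    [NormedSpace ℝ G] {F : ℝ × E → G} {U : Set E} (hU : IsOpen U)
    (hF : ∀ t, ∀ y ∈ U, ContDiffAt ℝ ∞ F (t, y)) (a b : ℝ) {y : E} (hy : y ∈ U) :
    HasFDerivAt (fun z => ∫ t in a..b, F (t, z))
      (∫ t in a..b, (fderiv ℝ F (t, y)).comp (ContinuousLinearMap.inr ℝ ℝ E)) y := by
  set F' : ℝ × E → E →L[ℝ] G := fun p => (fderiv ℝ F p).comp (ContinuousLinearMap.inr ℝ ℝ E)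
  have hF' : ∀ t, ∀ y ∈ U, ContDiffAt ℝ ∞ F' (t, y) := fun t y hy => contDiffAt_partial (hF t y hy)
  obtain ⟨ε, hε, hεU⟩ := Metric.isOpen_iff.1 hU y hy
  have hball : Metric.closedBall y (ε / 2) ⊆ U :=
    (Metric.closedBall_subset_ball (by linarith)).trans hεU
  -- Compactness of the interval times a closed ball gives one bound for the partial derivative, the
  -- dominating constant for differentiation under the integral.
  have hcomp : IsCompact (uIcc a b ×ˢ Metric.closedBall y (ε / 2)) :=
    isCompact_uIcc.prod (isCompact_closedBall y _)
  obtain ⟨C, hC⟩ := hcomp.exists_bound_of_continuousOn (f := F')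
    fun p hp => (hF' p.1 p.2 (hball hp.2)).continuousAt.continuousWithinAt
  refine intervalIntegral.hasFDerivAt_integral_of_dominated_of_fderiv_le
    (F := fun z t => F (t, z)) (F' := fun z t => F' (t, z)) (bound := fun _ => C)
    (Metric.closedBall_mem_nhds y (half_pos hε)) ?_ ?_ ?_ ?_ ?_ ?_
  · filter_upwards [hU.mem_nhds hy] with z hz
    exact (continuous_slice_of_contDiffAt fun t => hF t z hz).aestronglyMeasurable
  · exact (continuous_slice_of_contDiffAt fun t => hF t y hy).intervalIntegrable _ _
  · exact (continuous_slice_of_contDiffAt fun t => hF' t y hy).aestronglyMeasurable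
  · exact Filter.Eventually.of_forall fun t ht z hz => hC (t, z) ⟨uIoc_subset_uIcc ht, hz⟩
  · exact intervalIntegrable_const
  · exact Filter.Eventually.of_forall fun t _ z hz =>
      hasFDerivAt_partial ((hF t z (hball hz)).differentiableAt (by simp))

/-- The induction ranges over all targets `G`, since the derivative takes values in E →L[ℝ] G. With
`E` in the lowest universe this target stays in the universe of `G`. -/
theorem contDiffOn_nat_intervalIntegral {U : Set E} (hU : IsOpen U) (a b : ℝ) (n : ℕ) :
    ∀ {G : Type u} [NormedAddCommGroup G] [NormedSpace ℝ G] {F : ℝ × E → G}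
    (_ : ∀ t, ∀ y ∈ U, ContDiffAt ℝ ∞ F (t, y)),
    ContDiffOn ℝ n (fun z => ∫ t in a..b, F (t, z)) U := by
  induction n with
  | zero =>
    intro G _ _ F hF
    exact contDiffOn_zero.2 fun y hy =>
      (hasFDerivAt_intervalIntegral_of_contDiffAt hU hF a b hy).continuousAt.continuousWithinAt
  | succ n ih =>
    intro G _ _ F hF
    have h1 : ((n + 1 : ℕ) : WithTop ℕ∞) = (n : WithTop ℕ∞) + 1 := by simp
    rw [h1, contDiffOn_succ_iff_fderiv_of_isOpen hU]
    refine ⟨fun y hy => (hasFDerivAt_intervalIntegral_of_contDiffAt hU hF a b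
      hy).differentiableAt.differentiableWithinAt, by simp, ?_⟩
    refine (ih fun t y hy => contDiffAt_partial (hF t y hy)).congr fun y hy => ?_
    exact (hasFDerivAt_intervalIntegral_of_contDiffAt hU hF a b hy).fderiv

theorem contDiffOn_intervalIntegral {G : Type*} [NormedAddCommGroup G]
    [NormedSpace ℝ G] {F : ℝ × E → G} {U : Set E} (hU : IsOpen U)
    (hF : ∀ t, ∀ y ∈ U, ContDiffAt ℝ ∞ F (t, y)) (a b : ℝ) :
    ContDiffOn ℝ ∞ (fun z => ∫ t in a..b, F (t, z)) U :=
  contDiffOn_infty.2 fun n => contDiffOn_nat_intervalIntegral hU a b n hF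

theorem clm_fderiv_intervalIntegral {G H : Type*} [NormedAddCommGroup G]
    [NormedSpace ℝ G] [CompleteSpace G] [NormedAddCommGroup H] [NormedSpace ℝ H] [CompleteSpace H]
    {F : ℝ × E → G} {U : Set E} (hU : IsOpen U) (hF : ∀ t, ∀ y ∈ U, ContDiffAt ℝ ∞ F (t, y))
    (a b : ℝ) {y : E} (hy : y ∈ U) (L : (E →L[ℝ] G) →L[ℝ] H) :
    L (fderiv ℝ (fun z => ∫ t in a..b, F (t, z)) y) =
      ∫ t in a..b, L (fderiv ℝ (fun z => F (t, z)) y) := by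
  have h1 : Continuous fun t => (fderiv ℝ F (t, y)).comp (ContinuousLinearMap.inr ℝ ℝ E) :=
    continuous_slice_of_contDiffAt
      (F := fun p => (fderiv ℝ F p).comp (ContinuousLinearMap.inr ℝ ℝ E))
      fun t => contDiffAt_partial (hF t y hy)
  rw [(hasFDerivAt_intervalIntegral_of_contDiffAt hU hF a b hy).fderiv,
    ← ContinuousLinearMap.intervalIntegral_comp_comm L (h1.intervalIntegrable a b)]
  refine intervalIntegral.integral_congr fun t _ => ?_
  rw [(hasFDerivAt_partial ((hF t y hy).differentiableAt (by simp))).fderiv]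

theorem extDeriv_intervalIntegral {G : Type*} [NormedAddCommGroup G]
    [NormedSpace ℝ G] [CompleteSpace G] {k : ℕ} {F : ℝ × E → E [⋀^Fin k]→L[ℝ] G} {U : Set E}
    (hU : IsOpen U) (hF : ∀ t, ∀ y ∈ U, ContDiffAt ℝ ∞ F (t, y)) (a b : ℝ) {y : E} (hy : y ∈ U) :
    extDeriv (fun z => ∫ t in a..b, F (t, z)) y =
      ∫ t in a..b, extDeriv (fun z => F (t, z)) y :=
  clm_fderiv_intervalIntegral (G := E [⋀^Fin k]→L[ℝ] G) (H := E [⋀^Fin (k + 1)]→L[ℝ] G)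
    hU hF a b hy (ContinuousAlternatingMap.alternatizeUncurryFinCLM ℝ E G)

end ParametricIntegral

/-! ### Integration along the flow of a fundamental vector field -/

namespace DForm

section

variable {M : Type*} [TopologicalSpace M] [ChartedSpace E6 M]
  {F : Type*} [NormedAddCommGroup F] [NormedSpace ℝ F] {k : ℕ}

theorem ev_eq_inChart [IsManifold (𝓡 6) ∞ M] (α : DForm M F k) (x : M) :
    α.ev x = (α.inChart x (chartAt E6 x x)).compContinuousLinearMap
      (mfderiv (𝓡 6) (𝓡 6) (chartAt E6 x) x : E6 →L[ℝ] E6) := by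
  have h2 := (mdifferentiable_chart (I := 𝓡 6) x).symm_comp_deriv (mem_chart_source E6 x)
  have h3 : (chartAt E6 x).symm (chartAt E6 x x) = x := (chartAt E6 x).left_inv
    (mem_chart_source E6 x)
  ext v
  have h5 : ∀ (z : M) (_ : z = x) (w w' : Fin k → E6), w = w' → α.ev z w = α.ev x w' := by
    rintro z rfl w w' rfl; rfl
  refine (h5 _ h3 _ _ (funext fun i => ?_)).symm
  exact congrArg (fun L : E6 →L[ℝ] E6 => L (v i)) h2

/-- The integral of a family of forms. -/
def integralForm (f : ℝ → DForm M F k) (a b : ℝ) : DForm M F k := fun x =>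
  (∫ s in a..b, (f s).ev x : E6 [⋀^Fin k]→L[ℝ] F)

variable [IsManifold (𝓡 6) ∞ M]

/-- A family of forms depending smoothly on a real parameter. -/
def IsSmoothFamily (f : ℝ → DForm M F k) : Prop :=
  ∀ x₀ : M, ∀ s : ℝ, ∀ y ∈ (chartAt E6 x₀).target,
    ContDiffAt ℝ ∞ (fun p : ℝ × E6 => (f p.1).inChart x₀ p.2) (s, y)

variable {f g : ℝ → DForm M F k}

omit [IsManifold (𝓡 6) ∞ M] in
theorem IsSmoothFamily.continuous_inChart (hf : IsSmoothFamily f) {x₀ : M} {y : E6}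
    (hy : y ∈ (chartAt E6 x₀).target) : Continuous fun s => (f s).inChart x₀ y :=
  continuous_slice_of_contDiffAt fun t => hf x₀ t y hy

omit [IsManifold (𝓡 6) ∞ M] in
theorem IsSmoothFamily.isSmooth (hf : IsSmoothFamily f) (s : ℝ) : (f s).IsSmooth := fun x₀ y hy =>
  ((hf x₀ s y hy).comp y
    (contDiffAt_const.prodMk contDiffAt_id : ContDiffAt ℝ ∞ (fun z : E6 => (s, z)) y)).contDiffWithinAt

theorem IsSmoothFamily.continuous_ev (hf : IsSmoothFamily f) (x : M) :
    Continuous fun s => (f s).ev x := by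
  simp only [ev_eq_inChart]
  exact (ContinuousAlternatingMap.compContinuousLinearMapCLM
    (mfderiv (𝓡 6) (𝓡 6) (chartAt E6 x) x : E6 →L[ℝ] E6)).continuous.comp
    (hf.continuous_inChart (mem_chart_target E6 x))

variable [CompleteSpace F]

theorem IsSmoothFamily.inChart_integralForm (hf : IsSmoothFamily f) (a b : ℝ) (x₀ : M) (y : E6) :
    (integralForm f a b).inChart x₀ y = ∫ s in a..b, (f s).inChart x₀ y := by
  let L : E6 [⋀^Fin k]→L[ℝ] F →L[ℝ] E6 [⋀^Fin k]→L[ℝ] F :=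
    ContinuousAlternatingMap.compContinuousLinearMapCLM
      (mfderiv (𝓡 6) (𝓡 6) (chartAt E6 x₀).symm y : E6 →L[ℝ] E6)
  exact (ContinuousLinearMap.intervalIntegral_comp_comm L
    ((hf.continuous_ev ((chartAt E6 x₀).symm y)).intervalIntegrable a b)).symm

theorem IsSmoothFamily.inChart_integralForm_apply (hf : IsSmoothFamily f) (a b : ℝ) {x₀ : M}
    {y : E6} (hy : y ∈ (chartAt E6 x₀).target) (v : Fin k → E6) :
    (integralForm f a b).inChart x₀ y v = ∫ s in a..b, (f s).inChart x₀ y v := by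
  rw [hf.inChart_integralForm]
  exact (ContinuousLinearMap.intervalIntegral_comp_comm
    (ContinuousAlternatingMap.apply ℝ E6 F v)
    ((hf.continuous_inChart hy).intervalIntegrable a b)).symm

theorem IsSmoothFamily.isSmooth_integralForm (hf : IsSmoothFamily f) (a b : ℝ) :
    (integralForm f a b).IsSmooth := fun x₀ =>
  (contDiffOn_intervalIntegral (chartAt E6 x₀).open_target (fun t y hy => hf x₀ t y hy) a b).congr
    fun y _ => hf.inChart_integralForm a b x₀ y

theorem IsSmoothFamily.d_integralForm (hf : IsSmoothFamily f)
    (hdf : IsSmoothFamily fun s => (f s).d) (a b : ℝ) :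
    (integralForm f a b).d = integralForm (fun s => (f s).d) a b := by
  refine ext_inChart fun x₀ y hy => ?_
  rw [← (hf.isSmooth_integralForm a b).extDeriv_inChart hy, hdf.inChart_integralForm,
    funext (hf.inChart_integralForm a b x₀)]
  refine (extDeriv_intervalIntegral (chartAt E6 x₀).open_target
    (fun t y hy => hf x₀ t y hy) a b hy).trans ?_
  exact intervalIntegral.integral_congr fun t _ => (hf.isSmooth t).extDeriv_inChart hy

omit [CompleteSpace F] in
theorem IsSmoothFamily.integralForm_add (hf : IsSmoothFamily f) (hg : IsSmoothFamily g) (a b : ℝ) :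
    integralForm (fun s => f s + g s) a b = integralForm f a b + integralForm g a b := by
  funext x
  exact intervalIntegral.integral_add (E := E6 [⋀^Fin k]→L[ℝ] F) ((hf.continuous_ev x).intervalIntegrable a b)
    ((hg.continuous_ev x).intervalIntegrable a b)

end

section

variable {M : Type*} [TopologicalSpace M] [ChartedSpace E6 M] [MulAction SU2 M]
  {F : Type*} [NormedAddCommGroup F] [NormedSpace ℝ F] {k : ℕ} [IsManifold (𝓡 6) ∞ M]

theorem IsSmoothFamily.iota_integralForm [CompleteSpace F] {f : ℝ → DForm M F (k + 1)}
    (hf : IsSmoothFamily f) (ξ : su2) (a b : ℝ) :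
    iota ξ (integralForm f a b) = integralForm (fun s => iota ξ (f s)) a b := by
  funext x
  let L : E6 [⋀^Fin (k + 1)]→L[ℝ] F →L[ℝ] E6 [⋀^Fin k]→L[ℝ] F :=
    (ContinuousLinearMap.apply ℝ (E6 [⋀^Fin k]→L[ℝ] F) (fundVec ξ x)).comp
      (ContinuousAlternatingMap.curryLeftLI (𝕜 := ℝ) (E := E6) (F := F)
      (n := k)).toContinuousLinearMap
  exact (ContinuousLinearMap.intervalIntegral_comp_comm L
    ((hf.continuous_ev x).intervalIntegrable a b)).symm

/-- The Lie derivative along a fundamental vector field, given by Cartan's formula. -/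
def lie (ξ : su2) : ∀ {k : ℕ}, DForm M F k → DForm M F k
  | 0, α => iota ξ α.d
  | _ + 1, α => (iota ξ α).d + iota ξ α.d

variable (h : IsSmoothAction M)
include h

theorem IsSmooth.lie (ξ : su2) : ∀ {k : ℕ} {α : DForm M F k}, α.IsSmooth → (lie ξ α).IsSmooth
  | 0, _, hα => hα.d.iota h ξ
  | _ + 1, _, hα => (hα.iota h ξ).d.add (hα.d.iota h ξ)

theorem hasDerivAt_actPull_lie (ξ : su2) : ∀ {k : ℕ} {α : DForm M F k} (_ : α.IsSmooth) {x₀ : M}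
    {y : E6} (_ : y ∈ (chartAt E6 x₀).target) (t : ℝ) (v : Fin k → E6),
    HasDerivAt (fun s : ℝ => (DForm.actPull (expSU2 (s • ξ)) α).inChart x₀ y v)
      ((DForm.actPull (expSU2 (t • ξ)) (DForm.lie ξ α)).inChart x₀ y v) t
  | _ + 1, _, hα, _, _, hy, t, v => hasDerivAt_actPull_inChart h ξ hα hy t v
  | 0, α, hα, x₀, y, hy, t, v => by
    have hu : ContMDiffAt 𝓘(ℝ, E6) (𝓡 6) ∞ (chartAt E6 x₀).symm y := contMDiffAt_chart_symm hy
    have hflow := contMDiffAt_flow h ξ hu t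
    have hd := hα.extDeriv_pb hflow
    have hdiff := (hα.contDiffAt_pb hflow).differentiableAt (by simp)
    have h1 := (hdiff.continuousAlternatingMap_apply_const ![]).hasFDerivAt.comp_hasDerivAt t
        ((hasFDerivAt_prodMk_left (𝕜 := ℝ) t y).hasDerivAt)
    have h2 := extDeriv_zeroForm_apply hdiff ((1 : ℝ), (0 : E6))
    rw [hd] at h2
    refine (h1.congr_of_eventuallyEq (Filter.Eventually.of_forall fun s => ?_)).congr_deriv ?_
    · beta_reduce
      rw [inChart_actPull h _ _ hy, ← pb_flow_inr h ξ α hu s]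
      exact congrArg (pb (fun p : ℝ × E6 => expSU2 (p.1 • ξ) • (chartAt E6 x₀).symm p.2) α (s, y))
        (Subsingleton.elim _ _)
    · rw [inChart_actPull h _ _ hy]
      refine Eq.trans h2.symm ?_
      refine Eq.trans ?_ (congrArg (fun A => A v) (pb_flow_iota h ξ α.d hu t))
      refine congrArg (pb (fun p : ℝ × E6 => expSU2 (p.1 • ξ) • (chartAt E6 x₀).symm p.2) α.d (t, y))
        (funext fun i => ?_)
      fin_cases i; rfl

theorem isSmoothFamily_flow (ξ : su2) {w : ℝ → ℝ} (hw : ContDiff ℝ ∞ w) {α : DForm M F k}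
    (hα : α.IsSmooth) : IsSmoothFamily fun s => w s • actPull (expSU2 (s • ξ)) α :=
  fun _ t _ hy => (hw.contDiffAt.comp (t, _) contDiffAt_fst).smul (contDiffAt_pb_flow h ξ hα hy t)

omit [IsManifold (𝓡 6) ∞ M] in
theorem actPull_expSU2_iota (ξ : su2) (t : ℝ) (α : DForm M F (k + 1)) :
    actPull (expSU2 (t • ξ)) (iota ξ α) = iota ξ (actPull (expSU2 (t • ξ)) α) := by
  rw [actPull_iota h]
  congr 1
  have h1 := adSU2_mul (expSU2 (t • ξ))⁻¹ (expSU2 (t • ξ)) ξ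
  rw [inv_mul_cancel, adSU2_one, adSU2_expSU2_self] at h1
  exact h1.symm

/-- The weighted average of a form along the flow of a fundamental vector field. -/
def flowAverage (w : ℝ → ℝ) (ξ : su2) (α : DForm M F k) : DForm M F k :=
  integralForm (fun s => w s • actPull (expSU2 (s • ξ)) α) 0 1

variable [CompleteSpace F] (ξ : su2) {w : ℝ → ℝ} (hw : ContDiff ℝ ∞ w)
include hw

theorem IsSmooth.flowAverage {α : DForm M F k} (hα : α.IsSmooth) :
    (flowAverage w ξ α).IsSmooth :=
  (isSmoothFamily_flow h ξ hw hα).isSmooth_integralForm 0 1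

theorem d_flowAverage {α : DForm M F k} (hα : α.IsSmooth) :
    (DForm.flowAverage w ξ α).d = DForm.flowAverage w ξ α.d := by
  have h1 : (fun s => (w s • DForm.actPull (expSU2 (s • ξ)) α).d) =
      fun s => w s • DForm.actPull (expSU2 (s • ξ)) α.d :=
    funext fun s => by rw [d_smul, d_actPull h _ hα]
  rw [DForm.flowAverage, (isSmoothFamily_flow h ξ hw hα).d_integralForm
    (h1 ▸ isSmoothFamily_flow h ξ hw hα.d), h1, DForm.flowAverage]

theorem iota_flowAverage {α : DForm M F (k + 1)} (hα : α.IsSmooth) :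
    DForm.iota ξ (DForm.flowAverage w ξ α) = DForm.flowAverage w ξ (DForm.iota ξ α) := by
  rw [DForm.flowAverage, (isSmoothFamily_flow h ξ hw hα).iota_integralForm, DForm.flowAverage]
  congr 1
  funext s
  rw [actPull_expSU2_iota h]
  rfl

omit [CompleteSpace F] in
theorem flowAverage_add {α β : DForm M F k} (hα : α.IsSmooth) (hβ : β.IsSmooth) :
    DForm.flowAverage w ξ (α + β) = DForm.flowAverage w ξ α + DForm.flowAverage w ξ β := by
  rw [DForm.flowAverage, DForm.flowAverage, DForm.flowAverage,
    ← (isSmoothFamily_flow h ξ hw hα).integralForm_add (isSmoothFamily_flow h ξ hw hβ)]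
  congr 1
  funext s
  rw [← smul_add]
  rfl

theorem lie_flowAverage : ∀ {k : ℕ} {α : DForm M F k} (_ : α.IsSmooth),
    DForm.lie ξ (DForm.flowAverage w ξ α) = DForm.flowAverage w ξ (DForm.lie ξ α)
  | 0, α, hα => by
    rw [DForm.lie, DForm.lie, d_flowAverage h ξ hw hα, iota_flowAverage h ξ hw hα.d]
  | k + 1, α, hα => by
    rw [DForm.lie, DForm.lie, d_flowAverage h ξ hw hα, iota_flowAverage h ξ hw hα.d,
      iota_flowAverage h ξ hw hα, d_flowAverage h ξ hw (hα.iota h ξ),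
      flowAverage_add h ξ hw (hα.iota h ξ).d (hα.d.iota h ξ)]

omit hw
variable {ξ} (hξ : expSU2 ξ = 1)
include hξ

/-- The integrand is the derivative of the pulled-back form over one full period of the flow, so the
integral vanishes. -/
theorem flowAverage_one_lie {α : DForm M ℝ k} (hα : α.IsSmooth) :
    DForm.flowAverage (fun _ => 1) ξ (DForm.lie ξ α) = 0 := by
  refine ext_inChart fun x₀ y hy => ContinuousAlternatingMap.ext fun v => ?_
  have hs := isSmoothFamily_flow h ξ (w := fun _ => 1) contDiff_const (hα.lie h ξ)
  rw [DForm.flowAverage, hs.inChart_integralForm_apply 0 1 hy]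
  have hc : Continuous fun s : ℝ => (actPull (expSU2 (s • ξ)) (DForm.lie ξ α)).inChart x₀ y v := by
    have := (ContinuousAlternatingMap.apply ℝ E6 ℝ v).continuous.comp (hs.continuous_inChart hy)
    simp only [one_smul] at this
    exact this
  simp only [one_smul]
  rw [intervalIntegral.integral_eq_sub_of_hasDerivAt
    (fun s (_ : s ∈ Set.uIcc (0 : ℝ) 1) => hasDerivAt_actPull_lie h ξ hα hy s v) (hc.intervalIntegrable 0 1), one_smul, hξ,
    expSU2_zero_smul, sub_self]
  rfl

/-- Integration by parts with weight s: the boundary term is the pullback at time 1, which is α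
itself. For closed α the second summand is exact, so this is the homotopy between α and its average.
-/
theorem flowAverage_id_lie {α : DForm M ℝ k} (hα : α.IsSmooth) :
    α = DForm.flowAverage (fun _ => 1) ξ α + DForm.flowAverage id ξ (DForm.lie ξ α) := by
  refine ext_inChart fun x₀ y hy => ContinuousAlternatingMap.ext fun v => ?_
  have hs := isSmoothFamily_flow h ξ (w := id) contDiff_id (hα.lie h ξ)
  have hs1 := isSmoothFamily_flow h ξ (w := fun _ => 1) contDiff_const (hα.lie h ξ)
  have hs2 := isSmoothFamily_flow h ξ (w := fun _ => 1) contDiff_const hα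
  rw [inChart_add, Pi.add_apply, ContinuousAlternatingMap.add_apply,
    DForm.flowAverage, DForm.flowAverage, hs.inChart_integralForm_apply 0 1 hy,
    hs2.inChart_integralForm_apply 0 1 hy]
  have hc : Continuous fun s : ℝ => (actPull (expSU2 (s • ξ)) (DForm.lie ξ α)).inChart x₀ y v := by
    have := (ContinuousAlternatingMap.apply ℝ E6 ℝ v).continuous.comp (hs1.continuous_inChart hy)
    simp only [one_smul] at this
    exact this
  have h1 := intervalIntegral.integral_mul_deriv_eq_deriv_mul (a := 0) (b := 1)
    (fun s _ => hasDerivAt_id s) (fun s (_ : s ∈ Set.uIcc (0 : ℝ) 1) => hasDerivAt_actPull_lie h ξ hα hy s v)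
    intervalIntegrable_const (hc.intervalIntegrable 0 1)
  simp only [one_smul]
  have h2 : ∀ s : ℝ, (id s • actPull (expSU2 (s • ξ)) (DForm.lie ξ α)).inChart x₀ y v =
    id s * (actPull (expSU2 (s • ξ)) (DForm.lie ξ α)).inChart x₀ y v := fun s => rfl
  simp only [h2]
  rw [h1, one_smul, hξ, actPull_one]
  simp

end

end DForm

/-! ### The wedge product with a 1-form -/

section Wedge

variable {E : Type*} [NormedAddCommGroup E] [NormedSpace ℝ E] {k : ℕ}

/-- The linear form underlying an alternating map in one variable. -/
def linearOfAlternating : (E [⋀^Fin 1]→L[ℝ] ℝ) →L[ℝ] E →L[ℝ] ℝ :=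
  ((ContinuousAlternatingMap.apply ℝ E ℝ ![]).postcomp E).comp
    (ContinuousAlternatingMap.curryLeftLI (𝕜 := ℝ) (E := E) (F := ℝ)
      (n := 0)).toContinuousLinearMap

/-- The wedge product of a linear form and an alternating form. -/
def wedgeLeft (a : E [⋀^Fin 1]→L[ℝ] ℝ) (b : E [⋀^Fin k]→L[ℝ] ℝ) : E [⋀^Fin (k + 1)]→L[ℝ] ℝ :=
  ContinuousAlternatingMap.alternatizeUncurryFin ((linearOfAlternating a).smulRight b)

theorem wedgeLeft_apply (a : E [⋀^Fin 1]→L[ℝ] ℝ) (b : E [⋀^Fin k]→L[ℝ] ℝ)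
    (v : Fin (k + 1) → E) : wedgeLeft a b v =
      ∑ i : Fin (k + 1), (-1) ^ (i : ℕ) • (a ![v i] * b (i.removeNth v)) := by
  rw [wedgeLeft, ContinuousAlternatingMap.alternatizeUncurryFin_apply]
  rfl

theorem contDiff_wedgeLeft {n : WithTop ℕ∞} :
    ContDiff ℝ n (fun p : (E [⋀^Fin 1]→L[ℝ] ℝ) × (E [⋀^Fin k]→L[ℝ] ℝ) => wedgeLeft p.1 p.2) := by
  have h1 : ContDiff ℝ n (fun p : (E [⋀^Fin 1]→L[ℝ] ℝ) × (E [⋀^Fin k]→L[ℝ] ℝ) =>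
      linearOfAlternating p.1) :=
    ContDiff.comp (ContinuousLinearMap.contDiff (𝕜 := ℝ) (E := E [⋀^Fin 1]→L[ℝ] ℝ)
      (F := E →L[ℝ] ℝ) linearOfAlternating) contDiff_fst
  have h2 : ContDiff ℝ n (fun p : (E [⋀^Fin 1]→L[ℝ] ℝ) × (E [⋀^Fin k]→L[ℝ] ℝ) =>
      (linearOfAlternating p.1).smulRight p.2) := h1.smulRight contDiff_snd
  exact ContDiff.comp (ContinuousLinearMap.contDiff (𝕜 := ℝ) (E := E →L[ℝ] E [⋀^Fin k]→L[ℝ] ℝ)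
    (F := E [⋀^Fin (k + 1)]→L[ℝ] ℝ) (ContinuousAlternatingMap.alternatizeUncurryFinCLM ℝ E ℝ)) h2

theorem wedgeLeft_cons_zero (a : E [⋀^Fin 1]→L[ℝ] ℝ) (b : E [⋀^Fin 0]→L[ℝ] ℝ) (u : E)
    (v : Fin 0 → E) : wedgeLeft a b (Fin.cons u v) = a ![u] * b v := by
  rw [wedgeLeft_apply, Fin.sum_univ_one, Fin.val_zero, pow_zero, one_smul]
  congr 2

/-- Every summand after the first still has `u` as an argument of the basic form. -/
theorem wedgeLeft_cons_of_basic (a : E [⋀^Fin 1]→L[ℝ] ℝ) (b : E [⋀^Fin (k + 1)]→L[ℝ] ℝ) (u : E)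
    (hb : ∀ w, b (Fin.cons u w) = 0) (v : Fin (k + 1) → E) :
    wedgeLeft a b (Fin.cons u v) = a ![u] * b v := by
  rw [wedgeLeft_apply, Fin.sum_univ_succ, Fin.val_zero, pow_zero, one_smul,
    Finset.sum_eq_zero, add_zero]
  · congr 2
  · intro j _
    have h1 : j.succ.removeNth (Fin.cons u v : Fin (k + 2) → E) =
        Fin.cons u (j.removeNth v) := by
      funext l
      refine Fin.cases ?_ (fun l => ?_) l
      · simp [Fin.removeNth]
      · simp [Fin.removeNth]
    rw [h1, hb, mul_zero, smul_zero]

end Wedge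

namespace DForm

section

variable {M : Type*} [TopologicalSpace M] [ChartedSpace E6 M] [MulAction SU2 M] {k : ℕ}

/-- A right inverse of the contraction with a nowhere vanishing fundamental vector field on
basic forms, constructed from a 1-form `θ`. -/
def basicLift (ξ : su2) (θ : DForm M ℝ 1) (β : DForm M ℝ k) : DForm M ℝ (k + 1) := fun x =>
  ((toFun (iota ξ θ) x)⁻¹ • wedgeLeft (θ.ev x) (β.ev x) : E6 [⋀^Fin (k + 1)]→L[ℝ] ℝ)

theorem toFun_iota (ξ : su2) (θ : DForm M ℝ 1) (x : M) :
    toFun (iota ξ θ) x = θ.ev x ![fundVec ξ x] := rfl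

variable {ξ : su2} {θ : DForm M ℝ 1} (hθ : ∀ x, toFun (DForm.iota ξ θ) x ≠ 0)
include hθ

theorem iota_basicLift_zero (β : DForm M ℝ 0) : iota ξ (basicLift ξ θ β) = β := by
  refine ext_ev fun x v => ?_
  have h1 : (iota ξ (basicLift ξ θ β)).ev x v =
    (toFun (iota ξ θ) x)⁻¹ * wedgeLeft (θ.ev x) (β.ev x) (Fin.cons (fundVec ξ x) v) := rfl
  rw [h1, wedgeLeft_cons_zero, ← toFun_iota, inv_mul_cancel_left₀ (hθ x)]

theorem iota_basicLift {β : DForm M ℝ (k + 1)} (hβ : iota ξ β = 0) :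
    iota ξ (basicLift ξ θ β) = β := by
  refine ext_ev fun x v => ?_
  have h1 : (iota ξ (basicLift ξ θ β)).ev x v =
    (toFun (iota ξ θ) x)⁻¹ * wedgeLeft (θ.ev x) (β.ev x) (Fin.cons (fundVec ξ x) v) := rfl
  rw [h1, wedgeLeft_cons_of_basic _ _ _ fun w => ?_, ← toFun_iota, inv_mul_cancel_left₀ (hθ x)]
  rw [← iota_apply, hβ]
  rfl

theorem IsSmooth.basicLift [IsManifold (𝓡 6) ∞ M] (h : IsSmoothAction M) (hs : θ.IsSmooth)
    {β : DForm M ℝ k} (hβ : β.IsSmooth) : (basicLift ξ θ β).IsSmooth := fun x₀ => by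
  have h1 : ∀ y, (DForm.basicLift ξ θ β).inChart x₀ y =
      ((DForm.iota ξ θ).inChart x₀ y ![])⁻¹ • wedgeLeft (θ.inChart x₀ y) (β.inChart x₀ y) := by
    intro y
    have h2 : (DForm.iota ξ θ).inChart x₀ y ![] =
        toFun (DForm.iota ξ θ) ((chartAt E6 x₀).symm y) :=
      congrArg ((DForm.iota ξ θ).ev ((chartAt E6 x₀).symm y)) (Subsingleton.elim _ _)
    ext v
    rw [h2, ContinuousAlternatingMap.smul_apply, wedgeLeft_apply]
    let D : E6 →L[ℝ] E6 := mfderiv (𝓡 6) (𝓡 6) (chartAt E6 x₀).symm y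
    have h3 : (DForm.basicLift ξ θ β).inChart x₀ y v =
      (toFun (DForm.iota ξ θ) ((chartAt E6 x₀).symm y))⁻¹ • wedgeLeft
        (θ.ev ((chartAt E6 x₀).symm y)) (β.ev ((chartAt E6 x₀).symm y)) (fun i => D (v i)) := rfl
    rw [h3, wedgeLeft_apply]
    congr 1
    refine Finset.sum_congr rfl fun i _ => ?_
    congr 2
    refine congrArg (θ.ev ((chartAt E6 x₀).symm y)) (funext fun j => ?_)
    fin_cases j; rfl
  intro y hy
  refine ContDiffWithinAt.congr ?_ (fun z _ => h1 z) (h1 y)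
  have h4 := (contDiff_wedgeLeft (n := ∞)).contDiffAt.comp y
    ((hs.contDiffAt_inChart hy).prodMk (hβ.contDiffAt_inChart hy))
  have h5 : ContDiffAt ℝ ∞ (fun y => (DForm.iota ξ θ).inChart x₀ y ![]) y :=
    (ContinuousAlternatingMap.apply ℝ E6 ℝ ![]).contDiff.contDiffAt.comp y
      ((hs.iota h ξ).contDiffAt_inChart hy)
  have h6 : (DForm.iota ξ θ).inChart x₀ y ![] ≠ 0 := by
    have h2 : (DForm.iota ξ θ).inChart x₀ y ![] =
        toFun (DForm.iota ξ θ) ((chartAt E6 x₀).symm y) :=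
      congrArg ((DForm.iota ξ θ).ev ((chartAt E6 x₀).symm y)) (Subsingleton.elim _ _)
    rw [h2]
    exact hθ _
  exact ((h5.inv h6).smul h4).contDiffWithinAt

end

end DForm

/-! ### The complex of invariant forms -/

namespace DForm

section

variable {M : Type*} [TopologicalSpace M] [ChartedSpace E6 M] [MulAction SU2 M]
  [IsManifold (𝓡 6) ∞ M] {k : ℕ}

omit [MulAction SU2 M] [IsManifold (𝓡 6) ∞ M] in
theorem d_neg (α : DForm M ℝ k) : (-α).d = -α.d := by
  have h1 := d_smul (-1) α
  rwa [neg_one_smul, neg_one_smul] at h1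

/-- More than six vectors of ℝ⁶ are dependent. This bounds the complex of invariant forms. -/
instance (k : ℕ) : Subsingleton (DForm M ℝ (k + 7)) where
  allEq α β := by
    have h0 : ∀ (γ : DForm M ℝ (k + 7)) x v, γ.ev x v = 0 := fun γ x v => by
      refine (γ.ev x).toAlternatingMap.map_linearDependent v fun hv => ?_
      have := hv.fintype_card_le_finrank
      rw [Fintype.card_fin, finrank_euclideanSpace_fin] at this
      omega
    exact ext_ev fun x v => by rw [h0, h0]

omit [IsManifold (𝓡 6) ∞ M] in
theorem lie_zero (ξ : su2) : ∀ {k : ℕ}, lie ξ (0 : DForm M ℝ k) = 0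
  | 0 => by rw [lie, d_zero, iota_zero]
  | k + 1 => by rw [lie, iota_zero, d_zero, d_zero, iota_zero, add_zero]

omit [IsManifold (𝓡 6) ∞ M] in
theorem lie_smul (ξ : su2) (c : ℝ) : ∀ {k : ℕ} (α : DForm M ℝ k), lie ξ (c • α) = c • lie ξ α
  | 0, α => by rw [lie, d_smul]; rfl
  | k + 1, α => by
    have h1 : iota ξ (c • α) = c • iota ξ α := rfl
    rw [lie, lie, h1, d_smul, d_smul, smul_add]
    rfl

variable (h : IsSmoothAction M)
include h

theorem lie_add (ξ : su2) : ∀ {k : ℕ} {α β : DForm M ℝ k} (_ : α.IsSmooth) (_ : β.IsSmooth),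
    lie ξ (α + β) = lie ξ α + lie ξ β
  | 0, α, β, hα, hβ => by rw [lie, lie, lie, d_add hα hβ, iota_add]
  | k + 1, α, β, hα, hβ => by
    rw [lie, lie, lie, d_add hα hβ, iota_add, iota_add, d_add (hα.iota h ξ) (hβ.iota h ξ)]
    abel

/-- The smooth forms that are invariant under the flow of a fundamental vector field. -/
def invariantForms (ξ : su2) (k : ℕ) : Submodule ℝ (DForm M ℝ k) where
  carrier := {α | α.IsSmooth ∧ lie ξ α = 0}
  add_mem' := fun h₁ h₂ => ⟨h₁.1.add h₂.1, by rw [lie_add h ξ h₁.1 h₂.1, h₁.2, h₂.2, add_zero]⟩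
  zero_mem' := ⟨isSmooth_zero, lie_zero ξ⟩
  smul_mem' := fun c _ hα => ⟨hα.1.smul c, by rw [lie_smul, hα.2, smul_zero]⟩

theorem lie_d (ξ : su2) : ∀ {k : ℕ} {α : DForm M ℝ k} (_ : α.IsSmooth) (_ : lie ξ α = 0),
    lie ξ α.d = 0
  | 0, α, hα, hl => by
    rw [lie] at hl
    change (iota ξ α.d).d + iota ξ α.d.d = 0
    rw [hl, hα.d_d, iota_zero, d_zero, add_zero]
  | k + 1, α, hα, hl => by
    rw [lie] at hl ⊢
    rw [eq_neg_of_add_eq_zero_right hl, d_neg, (hα.iota h ξ).d_d, hα.d_d, iota_zero, neg_zero,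
      add_zero]

omit h [IsManifold (𝓡 6) ∞ M] in
theorem lie_iota (ξ : su2) : ∀ {k : ℕ} {α : DForm M ℝ (k + 1)} (_ : lie ξ α = 0),
    lie ξ (iota ξ α) = 0
  | 0, α, hl => by
    change (iota ξ α).d + iota ξ α.d = 0 at hl
    rw [lie, eq_neg_of_add_eq_zero_left hl, iota_neg, iota_iota_self, neg_zero]
  | k + 1, α, hl => by
    rw [lie] at hl ⊢
    rw [eq_neg_of_add_eq_zero_left hl, iota_neg, iota_iota_self, iota_iota_self, neg_zero, d_zero,
      add_zero]

/-- The exterior derivative of invariant forms. -/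
def invariantD (ξ : su2) (k : ℕ) : invariantForms h ξ k →ₗ[ℝ] invariantForms h ξ (k + 1) where
  toFun α := ⟨α.1.d, α.2.1.d, lie_d h ξ α.2.1 α.2.2⟩
  map_add' α β := Subtype.ext (d_add α.2.1 β.2.1)
  map_smul' c α := Subtype.ext (d_smul c α.1)

/-- The contraction of invariant forms. -/
def invariantIota (ξ : su2) (k : ℕ) :
    invariantForms h ξ (k + 1) →ₗ[ℝ] invariantForms h ξ k where
  toFun α := ⟨iota ξ α.1, α.2.1.iota h ξ, lie_iota ξ α.2.2⟩
  map_add' _ _ := rfl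
  map_smul' _ _ := rfl

variable {ξ : su2} (hξ : expSU2 ξ = 1)
include hξ

theorem lie_flowAverage_one {α : DForm M ℝ k} (hα : α.IsSmooth) :
    lie ξ (flowAverage (fun _ => 1) ξ α) = 0 := by
  rw [lie_flowAverage h ξ contDiff_const hα, flowAverage_one_lie h hξ hα]

omit h hξ [IsManifold (𝓡 6) ∞ M] in
theorem flowAverage_zero (w : ℝ → ℝ) (ξ : su2) :
    flowAverage w ξ (0 : DForm M ℝ k) = 0 := by
  funext x
  have h1 : ∀ s : ℝ, (w s • actPull (expSU2 (s • ξ)) (0 : DForm M ℝ k)).ev x = 0 := fun s =>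
    smul_zero (w s)
  exact (congrArg (fun f : ℝ → E6 [⋀^Fin k]→L[ℝ] ℝ => ∫ s in (0 : ℝ)..1, f s)
    (funext h1)).trans intervalIntegral.integral_zero

theorem flowAverage_of_invariant {α : DForm M ℝ k} (hα : α.IsSmooth) (hl : lie ξ α = 0) :
    flowAverage (fun _ => 1) ξ α = α := by
  have h1 := flowAverage_id_lie h hξ hα
  rw [hl, flowAverage_zero, add_zero] at h1
  exact h1.symm

/-- In positive degree the average works: it differs from α by the differential of the average of ι
α with weight s. Closed functions are already invariant. -/
theorem exists_invariant_closed : ∀ {k : ℕ} (α : closedForms M k), ∃ β : closedForms M k,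
    lie ξ β.1 = 0 ∧ α.1 - β.1 ∈ exactForms M k
  | 0, α => by
    have h1 : lie ξ α.1 = 0 := by rw [lie, α.2.2, iota_zero]
    exact ⟨α, h1, by rw [sub_self]; exact zero_mem _⟩
  | k + 1, α => by
    have hα := α.2.1
    refine ⟨⟨flowAverage (fun _ => 1) ξ α.1, hα.flowAverage h ξ contDiff_const, ?_⟩,
      lie_flowAverage_one h hξ hα, ?_⟩
    · rw [d_flowAverage h ξ contDiff_const hα, α.2.2, flowAverage_zero]
    · refine ⟨flowAverage id ξ (iota ξ α.1), (hα.iota h ξ).flowAverage h ξ contDiff_id, ?_⟩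
      have h1 := flowAverage_id_lie h hξ hα
      rw [lie, α.2.2, iota_zero, add_zero, ← d_flowAverage h ξ contDiff_id (hα.iota h ξ)] at h1
      exact eq_sub_of_add_eq' h1.symm

/-- Averaging a primitive of an invariant form gives an invariant primitive, as averaging commutes
with d and fixes invariant forms. -/
theorem mem_coboundaries_iff : ∀ {k : ℕ} (α : invariantForms h ξ k),
    α ∈ coboundaries (invariantD h ξ) k ↔ α.1 ∈ exactForms M k
  | 0, α => by
    change α = 0 ↔ α.1 = 0
    rw [Subtype.ext_iff]; rfl
  | k + 1, α => by
    constructor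
    · rintro ⟨β, rfl⟩
      exact ⟨β.1, β.2.1, rfl⟩
    · rintro ⟨β, hβ, hd⟩
      refine ⟨⟨flowAverage (fun _ => 1) ξ β, hβ.flowAverage h ξ contDiff_const,
        lie_flowAverage_one h hξ hβ⟩, Subtype.ext ?_⟩
      refine (d_flowAverage h ξ contDiff_const hβ).trans ?_
      rw [hd, flowAverage_of_invariant h hξ α.2.1 α.2.2]

/-- Invariant forms compute the de Rham cohomology. -/
theorem relLength_invariantForms (k : ℕ) :
    relLength (coboundaries (invariantD h ξ) k) (LinearMap.ker (invariantD h ξ k)) =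
      Module.length ℝ (DeRham M k) := by
  let ι : LinearMap.ker (invariantD h ξ k) →ₗ[ℝ] closedForms M k :=
    { toFun := fun α => ⟨α.1.1, α.1.2.1, congrArg Subtype.val α.2⟩
      map_add' := fun _ _ => rfl
      map_smul' := fun _ _ => rfl }
  refine relLength_eq_length
    (((exactForms M k).submoduleOf (closedForms M k)).mkQ ∘ₗ ι) ?_ ?_
  · intro c
    obtain ⟨α, rfl⟩ := Submodule.Quotient.mk_surjective _ c
    obtain ⟨β, hβ, hαβ⟩ := exists_invariant_closed h hξ α
    refine ⟨⟨⟨β.1, β.2.1, hβ⟩, Subtype.ext β.2.2⟩, ?_⟩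
    rw [LinearMap.comp_apply, Submodule.mkQ_apply, eq_comm, Submodule.Quotient.eq]
    exact hαβ
  · intro α
    rw [LinearMap.comp_apply, Submodule.mkQ_apply, Submodule.Quotient.mk_eq_zero,
      mem_coboundaries_iff h hξ]
    rfl

/-- A manifold with a circle action generated by a nowhere vanishing vector field has vanishing
Euler characteristic, if its cohomology is finite-dimensional. -/
theorem eulerChar_eq_zero {θ : DForm M ℝ 1} (hs : θ.IsSmooth)
    (hθ : ∀ x, toFun (iota ξ θ) x ≠ 0) (hfin : ∀ k, Module.Finite ℝ (DeRham M k)) :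
    eulerChar M = 0 := by
  -- The form θ need not be invariant, so its lift is averaged afterwards. Contraction commutes with
  -- averaging and the average of the invariant form β is β, so the lift remains a lift.
  have hlift : ∀ {k : ℕ} (β : invariantForms h ξ k), iota ξ (basicLift ξ θ β.1) = β.1 →
      ∃ γ, invariantIota h ξ k γ = β := by
    intro k β hβ
    have h1 := IsSmooth.basicLift hθ h hs β.2.1
    refine ⟨⟨flowAverage (fun _ => 1) ξ (basicLift ξ θ β.1), h1.flowAverage h ξ contDiff_const,
      lie_flowAverage_one h hξ h1⟩, Subtype.ext ?_⟩
    refine (iota_flowAverage h ξ contDiff_const h1).trans ?_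
    rw [hβ, flowAverage_of_invariant h hξ β.2.1 β.2.2]
  have hlen : ∀ k, relLength (coboundaries (invariantD h ξ) k) (LinearMap.ker (invariantD h ξ k)) =
      Module.finrank ℝ (DeRham M k) := fun k => by
    rw [relLength_invariantForms h hξ k, Module.length_eq_finrank]
  have key := eulerChar_eq_zero_of_contraction (d := invariantD h ξ) (i := invariantIota h ξ)
    (fun k α => Subtype.ext α.2.1.d_d) (fun k α => Subtype.ext (iota_iota_self ξ α.1))
    (fun α => Subtype.ext α.2.2)
    -- By Cartan's formula invariance says precisely that d and ι anticommute.
    (fun k α => Subtype.ext (eq_neg_of_add_eq_zero_right α.2.2))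
    (fun β => hlift β (iota_basicLift_zero hθ β.1))
    (fun k β hβ => hlift β (iota_basicLift hθ (congrArg Subtype.val hβ)))
    (fun k => by rw [hlen]; exact ENat.natCast_ne_top _)
  simp only [hlen, ENat.toNat_natCast] at key
  exact key

end

end DForm

/-! ### Zeros of ν and the Euler characteristic. -/

theorem exists_smul_expSU2_eq_one {ξ : su2} (hξ : ξ ≠ 0) :
    ∃ c : ℝ, c ≠ 0 ∧ expSU2 (c • ξ) = 1 := by
  obtain ⟨r, hr, h⟩ := exists_su2_norm hξ
  refine ⟨2 * Real.pi / r, by positivity, Subtype.ext ?_⟩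
  rw [exp_su2_formula hr.ne' h, mul_div_cancel₀ _ hr.ne']
  simp

namespace NearlyKahler

variable {M : Type*} [TopologicalSpace M] [ChartedSpace E6 M] [MulAction SU2 M]
  [IsManifold (𝓡 6) ∞ M] {S : NearlyKahler M} (hact : S.IsAutomorphicAction)
  (ξ : Module.Basis (Fin 3) ℝ su2)

include hact in
-- The 1-form Im ψ(K₀,K₁,·) takes the value ν on K₂. If ν had no zero, K₂ rescaled to period one
-- would generate a circle action with nowhere vanishing field, and the Euler characteristic would
-- be zero.
theorem exists_nu_eq_zero (hfin : ∀ k, Module.Finite ℝ (DeRham M k)) (hχ : eulerChar M ≠ 0) :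
    ∃ x : M, S.nu ξ x = 0 := by
  by_contra! hν
  obtain ⟨c, hc, hexp⟩ := exists_smul_expSU2_eq_one (ξ.ne_zero 2)
  refine hχ (DForm.eulerChar_eq_zero hact.smooth hexp
    ((S.smooth_imPsi.iota hact.smooth (ξ 0)).iota hact.smooth (ξ 1)) (fun x => ?_) hfin)
  have h1 : DForm.toFun (DForm.iota (c • ξ 2) (DForm.iota (ξ 1) (DForm.iota (ξ 0) S.imPsi))) x =
      c * S.nu ξ x := by
    rw [nu_eq_toFun, DForm.toFun]
    have h2 : fundVec (c • ξ 2) x = c • fundVec (ξ 2) x := by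
      rw [fundVec_eq hact.smooth, fundVec_eq hact.smooth, map_smul, map_smul]
    change ContinuousAlternatingMap.curryLeft _ (fundVec (c • ξ 2) x) ![] = _
    rw [h2, map_smul]
    rfl
  rw [h1]
  exact mul_ne_zero hc (hν x)

end NearlyKahler

end

/-! ### Assembly of the theorem. -/

theorem mainTheorem5 {M : Type*} [TopologicalSpace M] [ChartedSpace E6 M]
    [IsManifold (𝓡 6) ∞ M] [T2Space M] [SecondCountableTopology M] [ConnectedSpace M]
    (S : NearlyKahler M) [MulAction SU2 M] (hact : S.IsAutomorphicAction)
    (hdim : HasThreeDimPrincipalOrbits M)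
    (ξ : Module.Basis (Fin 3) ℝ su2) (hξ : IsStandardBasis ξ) :
    -- the orbit of `x` is special Lagrangian iff `ν(x) ≠ 0` and `μ(x) = 0`
    (∀ x : M, S.IsSpecialLagrangian (MulAction.orbit SU2 x) ↔ S.nu ξ x ≠ 0 ∧ S.mu ξ x = 0) ∧
    -- the set `ν⁻¹(0) ∩ μ⁻¹(0)` is a union of orbits that are fixed points or isotropic spheres
    (∀ x : M, S.nu ξ x = 0 → S.mu ξ x = 0 →
      (∀ y ∈ MulAction.orbit SU2 x, S.nu ξ y = 0 ∧ S.mu ξ y = 0) ∧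
      ((∀ a : SU2, a • x = x) ∨ S.IsIsotropicSphereOrbit x)) ∧
    -- if the Euler characteristic is defined and non-zero, then `ν` has a zero
    ((∀ k, Module.Finite ℝ (DeRham M k)) → eulerChar M ≠ 0 → ∃ x : M, S.nu ξ x = 0) ∧
    -- `ν` is smooth and not identically zero; if it is constant, all orbits are special Lagrangian
    ContMDiff (𝓡 6) 𝓘(ℝ, ℝ) ∞ (S.nu ξ) ∧
    (∃ x : M, S.nu ξ x ≠ 0) ∧
    ((∀ x y : M, S.nu ξ x = S.nu ξ y) →
      ∀ x : M, S.IsSpecialLagrangian (MulAction.orbit SU2 x)) ∧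
    -- the critical points of `ν` with `ν ≠ 0` form exactly the special Lagrangian orbits
    (∀ x : M, (mfderiv (𝓡 6) 𝓘(ℝ, ℝ) (S.nu ξ) x = 0 ∧ S.nu ξ x ≠ 0) ↔
      S.IsSpecialLagrangian (MulAction.orbit SU2 x)) ∧
    -- existence of a special Lagrangian orbit in the compact case
    (CompactSpace M → ∃ x : M, S.IsSpecialLagrangian (MulAction.orbit SU2 x)) := by
  have hiff : ∀ x : M, S.IsSpecialLagrangian (MulAction.orbit SU2 x) ↔
      S.nu ξ x ≠ 0 ∧ S.mu ξ x = 0 := fun x => NearlyKahler.isSpecialLagrangian_orbit_iff hact hξ x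
  refine ⟨hiff, fun x hν hμ => ⟨?_, NearlyKahler.fixed_or_isotropicSphere hact hξ hν hμ⟩,
    NearlyKahler.exists_nu_eq_zero hact ξ, NearlyKahler.contMDiff_nu hact,
    NearlyKahler.exists_nu_ne_zero hact hξ hdim, fun hconst x => ?_, fun x => ?_, fun _ => ?_⟩
  · rintro _ ⟨a, rfl⟩
    exact ⟨NearlyKahler.nu_smul_eq_zero hact hξ a hν, NearlyKahler.mu_smul_eq_zero hact a hμ⟩
  · obtain ⟨y, hy⟩ := NearlyKahler.exists_nu_ne_zero hact hξ hdim
    have hx : S.nu ξ x ≠ 0 := hconst y x ▸ hy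
    refine (hiff x).2 ⟨hx, (NearlyKahler.mfderiv_nu_eq_zero_iff hact hξ hx).1 ?_⟩
    rw [show S.nu ξ = fun _ => S.nu ξ x from funext fun z => hconst z x]
    exact mfderiv_const
  · rw [hiff, and_comm]
    exact and_congr_right fun hx => NearlyKahler.mfderiv_nu_eq_zero_iff hact hξ hx
  · obtain ⟨x, hx⟩ := NearlyKahler.exists_nu_ne_zero_and_mu_eq_zero hact hξ hdim
    exact ⟨x, (hiff x).2 hx⟩
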